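/- Let $G=(\mathcal V,\mathcal E)$ be a finite connected simple graph that is not bipartite. Let $\mathcal S$ be the finite set of lists of preferences, i.e. of families $(\sigma(v))_{v\in\mathcal V}$ where $\sigma(v)$ is a permutation of the set of neighbours of $v$. Items arrive one by one; item $n\in\mathbb Z$ has a class $V_n\in\mathcal V$ and a list of preferences $\Sigma_n\in\mathcal S$. A queue detail is a finite word over $\mathcal V$ without two adjacent letters, listing the classes of the waiting items in order of arrival. An admissible matching policy $\phi$ consists of a probability $\nu_\phi$ on $\mathcal S$ and of a rule which, whenever the queue detail $w$ contains a neighbour of the incoming class $v$, selects, as a function of $w$, $v$ and the list of preferences $\sigma$ only, the waiting item (of a class adjacent to $v$) with which the incoming item is matched; both then leave. If there is no such waiting item, the incoming item is stored at the end of the queue. Let $Q_\phi(z,\varsigma)$ be the queue detail after the arrivals of classes $z\in\mathcal V^*$ with lists of preferences $\varsigma\in\mathcal S^*$, $|\varsigma|=|z|$, in a system started empty. Assume that $\phi$ is sub-additive: $|Q_\phi(z'z'',\varsigma'\varsigma'')|\le|Q_\phi(z',\varsigma')|+|Q_\phi(z'',\varsigma'')|$ for all words $z',z''$ over $\mathcal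 V$ and all words $\varsigma',\varsigma''$ of the same respective lengths whose letters lie in the support of $\nu_\phi$. A strong erasing word is a word $z\in\mathcal V^*$ of even length $2p$ such that, for all lists of preferences in the support of $\nu_\phi$, $Q_\phi(ijz,\cdot)=\emptyset$ for all non-adjacent $i,j\in\mathcal V$ (including $i=j$), and $Q_\phi(z_{2\ell+1}\cdots z_{2p},\cdot)=\emptyset$ for $0\le\ell<p$. Let $\mu$ be a probability on $\mathcal V$ with full support. Let $\mathbb P^0$ be the law of the sequence of pairs $(V_{2n},\Sigma_{2n},V_{2n+1},\Sigma_{2n+1})_{n\in\mathbb Z}$ on the space $(\mathcal V\times\mathcal S\times\mathcal V\times\mathcal S)^{\mathbb Z}$ with shift $\theta$, let $U_n$ be the queue detail at time $2n$ (just before item $2n$) in the system started empty at time $0$, and let $\mathcal A_n=\{U_n=\emptyset\}$. Assume that one of the following two sets of conditions holds. 1. (a) $(V_n,\Sigma_n)_{n\in\mathbb Z}$ is stationary and ergodic, with $V_n\sim\mu$ and $\Sigma_n\sim\nu_\phi$; (b) the sequences of pairs $(V_{2n},\Sigma_{2n},V_{2n+1},\Sigma_{2n+1})_{n\in\mathbb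 Z}$ and $(V_{2n-1},\Sigma_{2n-1},V_{2n},\Sigma_{2n})_{n\in\mathbb Z}$ are both stationary and ergodic; (c) there is a strong erasing word; (d) for every integer $r\ge1$ there are strong erasing words $z^1,\dots,z^r$ such that $$\lim_{n\to\infty}\mathbb P^0\Bigl[\bigcap_{k=0}^\infty\bigcup_{l=0}^n \mathcal A_l\cap\theta^k\mathcal A_{l+k}\cap\theta^{-l}\mathcal B^r\Bigr]=1,$$ where $\mathcal B^r$ is the event that the classes of the items arriving from time $0$ on spell the word $z^1z^2\cdots z^r$. 2. The $(V_n,\Sigma_n)$, $n\in\mathbb Z$, are i.i.d. of law $\mu\otimes\nu_\phi$, and $\tau=\inf\{n>0: U_n=\emptyset\}$ is integrable under $\mathbb P^0$. A perfect $\phi$-matching of a sequence of arrivals is a perfect matching of $\mathbb Z$ that pairs items of adjacent classes, such that just before each time $n$ only finitely many items are waiting (i.e. have arrived before $n$ and are matched with an item $\ge n$), and such that the incoming item $n$ is matched with the waiting item selected by $\phi$ if a waiting item of an adjacent class exists, and is stored otherwise. A stationary perfect $\phi$-matching of the input is a measurable function of the input $(V_n,\Sigma_n)_{n\in\mathbb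 Z}$, defined up to almost sure equality, that is almost surely a perfect $\phi$-matching and that is compatible with the shift of the input by one pair of items, i.e. by two items. Then there are exactly two stationary perfect $\phi$-matchings of the input. Almost surely, for one of them the buffer is empty at infinitely many positive and infinitely many negative times, all of them even, and for the other one the buffer is empty at infinitely many positive and infinitely many negative times, all of them odd. -/

import Mathlib

open MeasureTheory ProbabilityTheory Filter Topology
open scoped ENNReal

namespace GeneralMatching

universe u

/-- Lists of preferences: for each class `v`, a permutation of the classes compatible with `v`. -/
def Pref {V : Type u} (G : SimpleGraph V) : Type u :=
  (v : V) → Equiv.Perm (G.neighborSet v)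

instance instMeasurableSpacePref {V : Type u} (G : SimpleGraph V) : MeasurableSpace (Pref G) := ⊤

instance instDiscretePref {V : Type u} (G : SimpleGraph V) : DiscreteMeasurableSpace (Pref G) :=
  ⟨fun _ => trivial⟩

instance instFinitePref {V : Type u} [Finite V] (G : SimpleGraph V) : Finite (Pref G) :=
  inferInstanceAs (Finite ((v : V) → Equiv.Perm (G.neighborSet v)))

/-- An arrival: the class of the incoming item together with a list of preferences. -/
abbrev Arrival {V : Type u} (G : SimpleGraph V) : Type u := V × Pref G

/-- The admissible queue details: words without two compatible letters. -/
def admissibleWords {V : Type u} (G : SimpleGraph V) : Set (List V) :=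
  {w | ∀ a ∈ w, ∀ b ∈ w, ¬ G.Adj a b}

/-- An admissible matching policy. `prefLaw` is the law of the lists of preferences. Whenever the
queue detail `w` contains a letter compatible with the incoming class `v`, the number
`choice w v σ` is the position in `w` (counted from `0`, in the order of arrivals) of the item
with which the incoming item is matched; this item has to be compatible. -/
structure MatchingPolicy {V : Type u} (G : SimpleGraph V) where
  prefLaw : PMF (Pref G)
  choice : List V → V → Pref G → ℕ
  choice_compatible : ∀ w ∈ admissibleWords G, ∀ (v : V) (σ : Pref G), (∃ a ∈ w, G.Adj v a) →
    ∃ a, w[choice w v σ]? = some a ∧ G.Adj v a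

section Policy

variable {V : Type u} {G : SimpleGraph V} (φ : MatchingPolicy G)

open Classical in
/-- The queue detail after an arrival, given the queue detail `w` just before it. -/
noncomputable def MatchingPolicy.next (w : List V) (x : Arrival G) : List V :=
  if ∃ a ∈ w, G.Adj x.1 a then w.eraseIdx (φ.choice w x.1 x.2) else w ++ [x.1]

/-- The queue detail of a system started empty, after the arrivals with classes `z` and lists of
preferences `s` (two words of the same length). -/
noncomputable def MatchingPolicy.queue (z : List V) (s : List (Pref G)) : List V :=
  (z.zip s).foldl φ.next []

/-- All letters of `s` can be drawn from the law of the lists of preferences. -/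
def MatchingPolicy.CanDraw (s : List (Pref G)) : Prop :=
  ∀ σ ∈ s, σ ∈ φ.prefLaw.support

def MatchingPolicy.SubAdditive : Prop :=
  ∀ (z₁ z₂ : List V) (s₁ s₂ : List (Pref G)), s₁.length = z₁.length → s₂.length = z₂.length →
    φ.CanDraw s₁ → φ.CanDraw s₂ →
    (φ.queue (z₁ ++ z₂) (s₁ ++ s₂)).length ≤ (φ.queue z₁ s₁).length + (φ.queue z₂ s₂).length

/-- Strong erasing words: words of even length that are completely matched together with any
two-letter word of non-adjacent letters put in front, and all of whose right sub-words of even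
length are completely matched, for all lists of preferences that can be drawn. -/
def MatchingPolicy.IsStrongErasing (z : List V) : Prop :=
  Even z.length ∧
  (∀ i j : V, ¬ G.Adj i j → ∀ s t : List (Pref G), s.length = 2 → t.length = z.length →
    φ.CanDraw s → φ.CanDraw t → φ.queue ([i, j] ++ z) (s ++ t) = []) ∧
  (∀ l : ℕ, 2 * l < z.length → ∀ t : List (Pref G), t.length = z.length → φ.CanDraw t →
    φ.queue (z.drop (2 * l)) (t.drop (2 * l)) = [])

/-- The buffer content at even times, driven by the pairs of arrivals `ω 0, ω 1, …` and started
at the random word `Y`. -/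
noncomputable def MatchingPolicy.evenBuffer (Y : (ℤ → Arrival G × Arrival G) → List V) :
    ℕ → (ℤ → Arrival G × Arrival G) → List V
  | 0, ω => Y ω
  | n + 1, ω => φ.next (φ.next (MatchingPolicy.evenBuffer Y n ω) (ω n).1) (ω n).2

/-- The event that the even buffer content started at `Y` is empty at time `n`. -/
def MatchingPolicy.emptyEvent (Y : (ℤ → Arrival G × Arrival G) → List V) (n : ℕ) :
    Set (ℤ → Arrival G × Arrival G) :=
  {ω | φ.evenBuffer Y n ω = []}

/-- The first time `n > 0` at which the even buffer content started at `Y` is empty (`∞` if there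
is none). -/
noncomputable def MatchingPolicy.firstEmptyTime (Y : (ℤ → Arrival G × Arrival G) → List V)
    (ω : ℤ → Arrival G × Arrival G) : ℝ≥0∞ :=
  ⨅ (n : ℕ) (_ : 0 < n ∧ ω ∈ φ.emptyEvent Y n), (n : ℝ≥0∞)

end Policy

/-- The shift by `k`; the shift `θ` is `shiftBy 1` and its iterate `θ ^ k` is `shiftBy k`. -/
def shiftBy {α : Type*} (k : ℤ) (ω : ℤ → α) : ℤ → α := fun n => ω (n + k)

/-- The arrivals grouped by pairs, each pair starting at an even time. -/
def evenPairs {α : Type*} (x : ℤ → α) : ℤ → α × α := fun n => (x (2 * n), x (2 * n + 1))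

/-- The arrivals grouped by pairs, each pair starting at an odd time. -/
def oddPairs {α : Type*} (x : ℤ → α) : ℤ → α × α := fun n => (x (2 * n - 1), x (2 * n))

section Renovation

variable {V : Type u} {G : SimpleGraph V} (φ : MatchingPolicy G)

/-- The classes of the items in the first `m` pairs of arrivals, in the order of arrivals. -/
def pairLetters (ω : ℤ → Arrival G × Arrival G) (m : ℕ) : List V :=
  (List.range m).flatMap fun i => [(ω i).1.1, (ω i).2.1]

/-- The event that the classes of the items arriving from time `0` on spell the word `z` (of even
length). -/
def arrivalEvent (G : SimpleGraph V) (z : List V) : Set (ℤ → Arrival G × Arrival G) :=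
  {ω | pairLetters ω (z.length / 2) = z}

/-- The event `⋂ k, ⋃ l ≤ n, A_l ∩ θ^k A_{l+k} ∩ θ^{-l} B`, where `A_n` is the event that the
system started empty at time `0` is empty at time `n`, and `B` is the event that the arrivals from
time `0` on spell the word `z`. Here `θ^k A` is the preimage of `A` under the shift by `-k`. -/
def MatchingPolicy.renovationEvent (z : List V) (n : ℕ) : Set (ℤ → Arrival G × Arrival G) :=
  ⋂ k : ℕ, ⋃ l : ℕ, ⋃ _ : l ≤ n,
    φ.emptyEvent (fun _ => []) l ∩
    shiftBy (-(k : ℤ)) ⁻¹' φ.emptyEvent (fun _ => []) (l + k) ∩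
    shiftBy (l : ℤ) ⁻¹' arrivalEvent G z

/-- The renovation condition of order `r` under the law `P₀` of the pairs of arrivals: for some
strong erasing words `z¹, …, zʳ`, the probability of the renovation event of `z¹ ⋯ zʳ` tends
to `1`. -/
def MatchingPolicy.Renovation [MeasurableSpace V] (P₀ : Measure (ℤ → Arrival G × Arrival G))
    (r : ℕ) : Prop :=
  ∃ zs : List (List V), zs.length = r ∧ (∀ z ∈ zs, φ.IsStrongErasing z) ∧
    Tendsto (fun n : ℕ => P₀ (φ.renovationEvent zs.flatten n)) atTop (𝓝 1)

/-- The first visit time to the empty word of the even buffer content started at `Y` is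
integrable. -/
def MatchingPolicy.IntegrableFirstEmptyTime [MeasurableSpace V]
    (P₀ : Measure (ℤ → Arrival G × Arrival G))
    (Y : (ℤ → Arrival G × Arrival G) → List V) : Prop :=
  ∫⁻ ω, φ.firstEmptyTime Y ω ∂P₀ ≠ ⊤

end Renovation

section Input

variable {V : Type u} [MeasurableSpace V] {G : SimpleGraph V} {Ω : Type*} [MeasurableSpace Ω]

/-- The sample path of the input. -/
def inputPath (C : ℤ → Ω → V) (S : ℤ → Ω → Pref G) (ω : Ω) : ℤ → Arrival G :=
  fun n => (C n ω, S n ω)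

/-- The law of the input on the canonical space of bi-infinite sequences of arrivals. -/
noncomputable def inputLaw (Pr : Measure Ω) (C : ℤ → Ω → V) (S : ℤ → Ω → Pref G) :
    Measure (ℤ → Arrival G) :=
  Pr.map (inputPath C S)

/-- The law of the pairs of arrivals started at even times. -/
noncomputable def evenPairLaw (Pr : Measure Ω) (C : ℤ → Ω → V) (S : ℤ → Ω → Pref G) :
    Measure (ℤ → Arrival G × Arrival G) :=
  Pr.map fun ω => evenPairs (inputPath C S ω)

/-- The law of the pairs of arrivals started at odd times. -/
noncomputable def oddPairLaw (Pr : Measure Ω) (C : ℤ → Ω → V) (S : ℤ → Ω → Pref G) :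
    Measure (ℤ → Arrival G × Arrival G) :=
  Pr.map fun ω => oddPairs (inputPath C S ω)

/-- The input is stationary ergodic, with classes of law `μ` and preferences of law `ν`. -/
structure StationaryErgodicInput (Pr : Measure Ω) (C : ℤ → Ω → V) (S : ℤ → Ω → Pref G)
    (μ : PMF V) (ν : PMF (Pref G)) : Prop where
  ergodic : Ergodic (shiftBy 1) (inputLaw Pr C S)
  class_law : ∀ n, Pr.map (C n) = μ.toMeasure
  pref_law : ∀ n, Pr.map (S n) = ν.toMeasure

/-- The sequence of pairs of arrivals started at even times is stationary ergodic, with classes of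
laws `μ₀` and `μ₁` and preferences of law `ν`. -/
structure StationaryErgodicEvenPairs (Pr : Measure Ω) (C : ℤ → Ω → V) (S : ℤ → Ω → Pref G)
    (μ₀ μ₁ : PMF V) (ν : PMF (Pref G)) : Prop where
  ergodic : Ergodic (shiftBy 1) (evenPairLaw Pr C S)
  first_class_law : ∀ n, Pr.map (C (2 * n)) = μ₀.toMeasure
  second_class_law : ∀ n, Pr.map (C (2 * n + 1)) = μ₁.toMeasure
  first_pref_law : ∀ n, Pr.map (S (2 * n)) = ν.toMeasure
  second_pref_law : ∀ n, Pr.map (S (2 * n + 1)) = ν.toMeasure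

/-- The sequence of pairs of arrivals started at odd times is stationary ergodic, with classes of
laws `μ₀` and `μ₁` and preferences of law `ν`. -/
structure StationaryErgodicOddPairs (Pr : Measure Ω) (C : ℤ → Ω → V) (S : ℤ → Ω → Pref G)
    (μ₀ μ₁ : PMF V) (ν : PMF (Pref G)) : Prop where
  ergodic : Ergodic (shiftBy 1) (oddPairLaw Pr C S)
  first_class_law : ∀ n, Pr.map (C (2 * n - 1)) = μ₀.toMeasure
  second_class_law : ∀ n, Pr.map (C (2 * n)) = μ₁.toMeasure
  first_pref_law : ∀ n, Pr.map (S (2 * n - 1)) = ν.toMeasure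
  second_pref_law : ∀ n, Pr.map (S (2 * n)) = ν.toMeasure

/-- The input is independent and identically distributed with law `μ ⊗ ν`. -/
structure IIDInput (Pr : Measure Ω) (C : ℤ → Ω → V) (S : ℤ → Ω → Pref G)
    (μ : PMF V) (ν : PMF (Pref G)) : Prop where
  indep : iIndepFun (fun (n : ℤ) (ω : Ω) => (C n ω, S n ω)) Pr
  law : ∀ n, Pr.map (fun ω => (C n ω, S n ω)) = μ.toMeasure.prod ν.toMeasure

end Input

section Matching

/-- For a matching `m` (item `n` is matched with item `m n`), the items waiting in the buffer at
time `n`, that is, just before the arrival of item `n`. -/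
def waiting (m : ℤ → ℤ) (n : ℤ) : Set ℤ := {k | k < n ∧ n ≤ m k}

variable {V : Type u} {G : SimpleGraph V} (φ : MatchingPolicy G)

/-- `m` is a bi-infinite perfect `φ`-matching of the sequence of arrivals `x`: every item is
matched with exactly one other item, of a compatible class; at each time `n` the buffer consists
of finitely many items, which form a list `b` in the order of arrivals; the incoming item `n` is
matched with the item of `b` that `φ` selects from the queue detail, the class of `n` and the list
of preferences at time `n` if `b` has an item of a class compatible with item `n`, and is stored
(and matched later) otherwise. -/
structure IsPerfectMatching (x : ℤ → Arrival G) (m : ℤ → ℤ) : Prop where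
  involutive : ∀ n, m (m n) = n
  ne_self : ∀ n, m n ≠ n
  compatible : ∀ n, G.Adj (x n).1 (x (m n)).1
  follows_policy : ∀ n, ∃ b : List ℤ, b.Pairwise (· < ·) ∧ (∀ k, k ∈ b ↔ k ∈ waiting m n) ∧
    ((∃ k ∈ b, G.Adj (x n).1 (x k).1) →
      b[φ.choice (b.map fun k => (x k).1) (x n).1 (x n).2]? = some (m n)) ∧
    ((¬ ∃ k ∈ b, G.Adj (x n).1 (x k).1) → n < m n)

/-- The buffer of the matching `m` is empty only at times satisfying `p`, and it is empty at
arbitrarily large positive and arbitrarily large negative times. -/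
def EmptiesAt (p : ℤ → Prop) (m : ℤ → ℤ) : Prop :=
  (∀ n, waiting m n = ∅ → p n) ∧
  (∀ N : ℤ, ∃ n ≥ N, waiting m n = ∅) ∧
  (∀ N : ℤ, ∃ n ≤ N, waiting m n = ∅)

/-- A stationary bi-infinite perfect `φ`-matching of the input with law `P`: a measurable function
of the input, almost surely a perfect `φ`-matching, compatible with the shift of the pairs of
arrivals, that is, with the shift by two items. (The shift by one item exchanges the two parities
of the times at which the buffer can be empty.) -/
structure IsStationaryPerfectMatching [MeasurableSpace V] (P : Measure (ℤ → Arrival G))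
    (M : (ℤ → Arrival G) → ℤ → ℤ) : Prop where
  measurable : Measurable M
  perfect : ∀ᵐ x ∂P, IsPerfectMatching φ x (M x)
  stationary : ∀ᵐ x ∂P, ∀ n, M (shiftBy 2 x) n = M x (n + 2) - 2

end Matching

end GeneralMatching

open GeneralMatching

/-! The matchings are built by running systems started empty from times further and further in the
past. Two properties of the law of the input suffice: the queue lengths of a system started empty
are tight (`TightLengths`), and almost surely the run from any admissible word of even length is at
some time empty together with the run from the empty word (`AlmostSurelyCouples`). With stationarity
they bound, uniformly in the start times, the probability that two systems started empty at an even
distance have no common empty time soon after the later start (`measure_not_coupled_le`). For start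
times `-2 * k i` tending to `-∞` fast enough, Borel–Cantelli makes consecutive runs merge before any
given time; their buffers stabilise, and the limit is the evolution of a perfect matching
(`exists_isPerfectMatching_of_coupling`, `limitMatching`). Every arrival changes the buffer size by
one, so this limit is empty at even times only. Translating it by one item gives the second
matching.

Uniqueness is a parity dichotomy. For a stationary perfect matching, evenness of the buffer size at
time `0` is invariant under the shift by two, hence almost surely true or almost surely false by
ergodicity of that shift. In the even case the buffer size at `-2 * k i` is tight by stationarity,
so the matching couples with the run started empty there and equals the limit
(`IsStationaryPerfectMatching.ae_eq_limitMatching`); the odd case reduces to the even one by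
translation.

Under the renovation condition, sub-additivity lets each strong erasing word remove two letters,
which yields coupling, while the uniformity of the renovation event over past start times yields
tightness. In the i.i.d. case, integrability of the return time makes long excursions summable,
which yields tightness and recurrence. A fixed word erasing finitely many given words exists because
the graph has odd closed walks (`exists_erasing_word_of_walk`), and a renewal argument shows that it
almost surely arrives at an empty time (`ae_not_neverRenewed`). -/

namespace GeneralMatching

/-! ### Queue details: admissibility, parity and sub-additivity -/

section Words

variable {V : Type*} {G : SimpleGraph V} (φ : MatchingPolicy G)

theorem next_of_exists {w : List V} {x : Arrival G} (h : ∃ a ∈ w, G.Adj x.1 a) :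
    φ.next w x = w.eraseIdx (φ.choice w x.1 x.2) := by
  unfold MatchingPolicy.next; rw [if_pos h]

theorem next_of_not_exists {w : List V} {x : Arrival G} (h : ¬ ∃ a ∈ w, G.Adj x.1 a) :
    φ.next w x = w ++ [x.1] := by
  unfold MatchingPolicy.next; rw [if_neg h]

theorem choice_lt_length {w : List V} (hw : w ∈ admissibleWords G) {x : Arrival G}
    (h : ∃ a ∈ w, G.Adj x.1 a) : φ.choice w x.1 x.2 < w.length := by
  obtain ⟨a, ha, -⟩ := φ.choice_compatible w hw x.1 x.2 h
  exact (List.getElem?_eq_some_iff.1 ha).1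

theorem next_mem_admissibleWords {w : List V} (hw : w ∈ admissibleWords G) (x : Arrival G) :
    φ.next w x ∈ admissibleWords G := by
  by_cases h : ∃ a ∈ w, G.Adj x.1 a
  · rw [next_of_exists φ h]
    intro a ha b hb
    exact hw a (List.mem_of_mem_eraseIdx ha) b (List.mem_of_mem_eraseIdx hb)
  · rw [next_of_not_exists φ h]
    push Not at h
    intro a ha b hb
    simp only [List.mem_append, List.mem_singleton] at ha hb
    rcases ha with ha | rfl <;> rcases hb with hb | rfl
    · exact hw a ha b hb
    · exact fun hab => h a ha hab.symm
    · exact h b hb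
    · exact G.irrefl

theorem length_next {w : List V} (hw : w ∈ admissibleWords G) (x : Arrival G) :
    (φ.next w x).length + 1 = w.length ∨ (φ.next w x).length = w.length + 1 := by
  by_cases h : ∃ a ∈ w, G.Adj x.1 a
  · have := choice_lt_length φ hw h
    rw [next_of_exists φ h, List.length_eraseIdx_of_lt this]
    omega
  · rw [next_of_not_exists φ h]; simp

theorem nil_mem_admissibleWords : ([] : List V) ∈ admissibleWords G := by
  intro a ha; simp at ha

theorem foldl_next_mem_admissibleWords (L : List (Arrival G)) {w : List V}
    (hw : w ∈ admissibleWords G) : L.foldl φ.next w ∈ admissibleWords G := by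
  induction L generalizing w with
  | nil => exact hw
  | cons x L ih => exact ih (next_mem_admissibleWords φ hw x)

/-- Each arrival changes the length by exactly one. All later statements on the parity of empty
times rest on this. -/
theorem even_length_foldl_next (L : List (Arrival G)) {w : List V}
    (hw : w ∈ admissibleWords G) :
    (Even (L.foldl φ.next w).length ↔ (Even w.length ↔ Even L.length)) := by
  induction L generalizing w with
  | nil => simp
  | cons x L ih =>
    rw [List.foldl_cons, ih (next_mem_admissibleWords φ hw x), List.length_cons]
    rcases length_next φ hw x with h | h
    · rw [← h, Nat.even_add_one, Nat.even_add_one]; tauto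
    · rw [h, Nat.even_add_one, Nat.even_add_one]; tauto

theorem length_le_length_foldl_next_add (L : List (Arrival G)) {w : List V}
    (hw : w ∈ admissibleWords G) : w.length ≤ (L.foldl φ.next w).length + L.length := by
  induction L generalizing w with
  | nil => simp
  | cons x L ih =>
    have := ih (next_mem_admissibleWords φ hw x)
    rw [List.foldl_cons, List.length_cons]
    rcases length_next φ hw x with h | h <;> omega

theorem length_foldl_next_le (L : List (Arrival G)) {w : List V}
    (hw : w ∈ admissibleWords G) : (L.foldl φ.next w).length ≤ w.length + L.length := by
  induction L generalizing w with
  | nil => simp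
  | cons x L ih =>
    have := ih (next_mem_admissibleWords φ hw x)
    rw [List.foldl_cons, List.length_cons]
    rcases length_next φ hw x with h | h <;> omega

/-- An admissible word is stored without any matching. -/
theorem foldl_next_of_append_mem (u v : List V) (s : List (Pref G)) (hs : s.length = v.length)
    (hw : u ++ v ∈ admissibleWords G) : (v.zip s).foldl φ.next u = u ++ v := by
  induction v generalizing u s with
  | nil => simp
  | cons a v ih =>
    obtain _ | ⟨σ, s⟩ := s
    · simp at hs
    · rw [List.zip_cons_cons, List.foldl_cons, next_of_not_exists φ, ih]
      · simp
      · simpa using hs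
      · simpa using hw
      · rintro ⟨b, hb, hab⟩
        exact hw a (by simp) b (by simp [hb]) hab

theorem queue_of_mem_admissibleWords {w : List V} (hw : w ∈ admissibleWords G)
    {s : List (Pref G)} (hs : s.length = w.length) : φ.queue w s = w := by
  simpa [MatchingPolicy.queue] using
    foldl_next_of_append_mem φ [] w s hs (by simpa using hw)

theorem queue_append {z₁ z₂ : List V} {s₁ s₂ : List (Pref G)} (h₁ : s₁.length = z₁.length) :
    φ.queue (z₁ ++ z₂) (s₁ ++ s₂) = (z₂.zip s₂).foldl φ.next (φ.queue z₁ s₁) := by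
  unfold MatchingPolicy.queue
  rw [List.zip_append h₁.symm, List.foldl_append]

theorem zip_map_fst_map_snd (L : List (Arrival G)) :
    (L.map Prod.fst).zip (L.map Prod.snd) = L := by
  simpa [List.unzip_eq_map] using List.zip_unzip L

/-- All preferences of the arrivals in `L` can be drawn. -/
def Drawable (L : List (Arrival G)) : Prop := ∀ x ∈ L, x.2 ∈ φ.prefLaw.support

theorem Drawable.canDraw {φ : MatchingPolicy G} {L : List (Arrival G)} (h : Drawable φ L) :
    φ.CanDraw (L.map Prod.snd) := by
  intro σ hσ
  obtain ⟨x, hx, rfl⟩ := List.mem_map.1 hσ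
  exact h x hx

theorem canDraw_replicate {σ : Pref G} (h : σ ∈ φ.prefLaw.support) (n : ℕ) :
    φ.CanDraw (List.replicate n σ) := by
  intro τ hτ; rw [List.eq_of_mem_replicate hτ]; exact h

/-- Sub-additivity, for a system started with an admissible word. -/
theorem length_foldl_next_append_le {φ : MatchingPolicy G} (hφ : φ.SubAdditive) {u v : List V}
    (huv : u ++ v ∈ admissibleWords G) {L : List (Arrival G)} (hL : Drawable φ L) :
    (L.foldl φ.next (u ++ v)).length ≤ u.length + (L.foldl φ.next v).length := by
  obtain ⟨σ, hσ⟩ := φ.prefLaw.support_nonempty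
  have hu : u ∈ admissibleWords G := fun a ha b hb => huv a (by simp [ha]) b (by simp [hb])
  have hv : v ∈ admissibleWords G := fun a ha b hb => huv a (by simp [ha]) b (by simp [hb])
  -- Sub-additivity concerns systems started empty, so the state `u ++ v` is produced by letting its
  -- own letters arrive: they are stored unmatched, and their preferences, here a constant `σ` that
  -- can be drawn, play no role.
  have key := hφ u (v ++ L.map Prod.fst) (List.replicate u.length σ)
    (List.replicate v.length σ ++ L.map Prod.snd) (by simp) (by simp)
    (canDraw_replicate φ hσ _) (by
      intro τ hτ
      rcases List.mem_append.1 hτ with h | h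
      · exact canDraw_replicate φ hσ _ τ h
      · exact hL.canDraw τ h)
  rw [queue_append φ (by simp), queue_of_mem_admissibleWords φ hu (by simp),
    queue_append φ (by simp), queue_of_mem_admissibleWords φ hv (by simp),
    zip_map_fst_map_snd, List.zip_append (by simp), List.foldl_append, zip_map_fst_map_snd,
    foldl_next_of_append_mem φ u v _ (by simp) huv] at key
  exact key

theorem length_foldl_next_le_add {φ : MatchingPolicy G} (hφ : φ.SubAdditive) {w : List V}
    (hw : w ∈ admissibleWords G) {L : List (Arrival G)} (hL : Drawable φ L) :
    (L.foldl φ.next w).length ≤ w.length + (L.foldl φ.next []).length := by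
  simpa using length_foldl_next_append_le hφ (u := w) (v := []) (by simpa using hw) hL

theorem exists_eq_append_pair {w : List V} (hw : Even w.length) (h0 : w ≠ []) :
    ∃ (u : List V) (i j : V), w = u ++ [i, j] := by
  rcases List.eq_nil_or_concat w with rfl | ⟨w, j, rfl⟩
  · exact absurd rfl h0
  rcases List.eq_nil_or_concat w with rfl | ⟨u, i, rfl⟩
  · simp at hw
  exact ⟨u, i, j, by simp⟩

end Words

/-! ### Erasing a pair of incompatible letters along an odd walk -/

section Erasing

variable {V : Type*} {G : SimpleGraph V} (φ : MatchingPolicy G)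

theorem next_nil (x : Arrival G) : φ.next [] x = [x.1] := by
  rw [next_of_not_exists φ (by simp)]; rfl

theorem next_singleton_of_adj {a : V} {x : Arrival G} (h : G.Adj x.1 a) : φ.next [a] x = [] := by
  have hw : [a] ∈ admissibleWords G := by
    intro b hb c hc
    rw [List.mem_singleton] at hb hc
    subst hb hc; exact G.irrefl
  have hex : ∃ b ∈ [a], G.Adj x.1 b := ⟨a, by simp, h⟩
  have := choice_lt_length φ hw hex
  rw [next_of_exists φ hex, List.eraseIdx_eq_nil_iff]
  simp at this; simp [this]

theorem next_singleton_of_not_adj {a : V} {x : Arrival G} (h : ¬ G.Adj x.1 a) :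
    φ.next [a] x = [a, x.1] := by
  rw [next_of_not_exists φ (by simpa using h)]; rfl

theorem pair_mem_admissibleWords {i j : V} (h : ¬ G.Adj i j) : [i, j] ∈ admissibleWords G := by
  intro a ha b hb
  simp only [List.mem_cons, List.not_mem_nil, or_false] at ha hb
  rcases ha with rfl | rfl <;> rcases hb with rfl | rfl
  · exact G.irrefl
  · exact h
  · exact fun h' => h h'.symm
  · exact G.irrefl

theorem next_pair {i j : V} (h : ¬ G.Adj i j) {x : Arrival G} (hx : G.Adj x.1 i ∨ G.Adj x.1 j) :
    (φ.next [i, j] x = [i] ∧ G.Adj x.1 j) ∨ (φ.next [i, j] x = [j] ∧ G.Adj x.1 i) := by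
  have hw := pair_mem_admissibleWords h
  have hex : ∃ b ∈ [i, j], G.Adj x.1 b := by simpa using hx
  obtain ⟨a, ha, hxa⟩ := φ.choice_compatible _ hw x.1 x.2 hex
  rw [next_of_exists φ hex]
  rcases hc : φ.choice [i, j] x.1 x.2 with _ | _ | n
  · rw [hc] at ha; simp at ha; subst ha; right; simpa using hxa
  · rw [hc] at ha; simp at ha; subst ha; left; simpa using hxa
  · rw [hc] at ha; simp at ha

theorem exists_walk_cons_of_length_succ {i j : V} {n : ℕ} (p : G.Walk i j)
    (hp : p.length = n + 1) : ∃ (a : V) (q : G.Walk a j), G.Adj i a ∧ q.length = n := by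
  cases p with
  | nil => simp at hp
  | cons h q => exact ⟨_, q, h, by simpa using hp⟩

/-- Two incompatible letters joined by a walk of odd length can be matched completely by a word
which is itself completely matched, whatever the policy. -/
theorem exists_erasing_word_of_walk (σ : Pref G) (n : ℕ) {i j : V} (p : G.Walk i j)
    (hp : p.length = 2 * n + 1) (hij : ¬ G.Adj i j) :
    ∃ z : List V, Even z.length ∧ ((z.map fun v => (v, σ)).foldl φ.next [i, j] = []) ∧
      ((z.map fun v => (v, σ)).foldl φ.next [] = []) := by
  induction n generalizing i j with
  | zero => exact absurd (SimpleGraph.Walk.adj_of_length_eq_one (by simpa using hp)) hij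
  | succ n ih =>
    -- The walk reads `i, a, b, …, d, c, j`, and both ends are peeled off; the pieces that remain
    -- are two steps shorter, ready for the induction hypothesis.
    obtain ⟨a, p', hia, hp'⟩ :=
      exists_walk_cons_of_length_succ p (n := 2 * n + 2) (by omega)
    obtain ⟨c, q', hjc, hq'⟩ :=
      exists_walk_cons_of_length_succ p'.reverse (n := 2 * n + 1) (by simpa using hp')
    obtain ⟨b, q, hab, hq⟩ :=
      exists_walk_cons_of_length_succ q'.reverse (n := 2 * n) (by simpa using hq')
    obtain ⟨d, r, hcd, hr⟩ := exists_walk_cons_of_length_succ q' (n := 2 * n) hq'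
    by_cases haj : G.Adj a j
    · by_cases hci : G.Adj c i
      · have h1 : (φ.next (φ.next [i, j] (a, σ)) (c, σ)) = [] := by
          rcases next_pair φ hij (x := (a, σ)) (Or.inl hia.symm) with h | h
          · rw [h.1, next_singleton_of_adj φ (x := (c, σ)) hci]
          · rw [h.1, next_singleton_of_adj φ (x := (c, σ)) hjc.symm]
        by_cases hca : G.Adj c a
        · refine ⟨[a, c], by simp, by simpa using h1, ?_⟩
          simp [next_nil, next_singleton_of_adj φ (x := (c, σ)) hca]
        · obtain ⟨z, hz, hz1, hz2⟩ := ih q'.reverse (by simpa using hq') (fun h => hca h.symm)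
          refine ⟨a :: c :: z, by simpa [Nat.even_add_one] using hz, by simpa [h1] using hz2, ?_⟩
          simpa [next_nil, next_singleton_of_not_adj φ (x := (c, σ)) hca] using hz1
      -- The policy has no choice: `c` takes `j`. Then `d` either takes `i` or leaves the pair `[i,
      -- d]`, whose walk is shorter; in the system started empty `c` and `d` cancel.
      · have h1 : φ.next [i, j] (c, σ) = [i] := by
          rcases next_pair φ hij (x := (c, σ)) (Or.inr hjc.symm) with h | h
          · exact h.1
          · exact absurd h.2 hci
        by_cases hdi : G.Adj d i
        · refine ⟨[c, d], by simp, ?_, ?_⟩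
          · simp [h1, next_singleton_of_adj φ (x := (d, σ)) hdi]
          · simp [next_nil, next_singleton_of_adj φ (x := (d, σ)) hcd.symm]
        · obtain ⟨z, hz, hz1, hz2⟩ := ih (r.concat hia.symm).reverse (by simpa using hr)
            (fun h => hdi h.symm)
          refine ⟨c :: d :: z, by simpa [Nat.even_add_one] using hz, ?_, ?_⟩
          · simpa [h1, next_singleton_of_not_adj φ (x := (d, σ)) hdi] using hz1
          · simpa [next_nil, next_singleton_of_adj φ (x := (d, σ)) hcd.symm] using hz2
    -- The mirror case: `a` must take `i`, and `b` plays the role of `d`.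
    · have h1 : φ.next [i, j] (a, σ) = [j] := by
        rcases next_pair φ hij (x := (a, σ)) (Or.inl hia.symm) with h | h
        · exact absurd h.2 haj
        · exact h.1
      by_cases hbj : G.Adj b j
      · refine ⟨[a, b], by simp, ?_, ?_⟩
        · simp [h1, next_singleton_of_adj φ (x := (b, σ)) hbj]
        · simp [next_nil, next_singleton_of_adj φ (x := (b, σ)) hab.symm]
      · obtain ⟨z, hz, hz1, hz2⟩ := ih (q.concat hjc.symm).reverse (by simpa using hq)
          (fun h => hbj h.symm)
        refine ⟨a :: b :: z, by simpa [Nat.even_add_one] using hz, ?_, ?_⟩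
        · simpa [h1, next_singleton_of_not_adj φ (x := (b, σ)) hbj] using hz1
        · simpa [next_nil, next_singleton_of_adj φ (x := (b, σ)) hab.symm] using hz2

end Erasing

end GeneralMatching

namespace GeneralMatching

/-! ### Words that erase every short queue detail -/

section ErasingWords

variable {V : Type*} {G : SimpleGraph V}

/-- Non-bipartiteness provides a closed walk of odd length; a detour through it changes the parity
of any walk from `i` to `j` that visits its base point. -/
theorem exists_odd_walk (hconn : G.Connected) (hbip : ¬ G.IsBipartite) (i j : V) :
    ∃ p : G.Walk i j, Odd p.length := by
  have h : ¬ ∀ u, ∀ w : G.Walk u u, Even w.length := fun h =>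
    hbip (SimpleGraph.two_colorable_iff_forall_loop_even.2 h)
  push Not at h
  obtain ⟨u, c, hc⟩ := h
  rw [Nat.not_even_iff_odd] at hc
  obtain ⟨p⟩ := hconn.preconnected i u
  obtain ⟨q⟩ := hconn.preconnected u j
  rcases Nat.even_or_odd (p.append q).length with h | h
  · refine ⟨p.append (c.append q), ?_⟩
    rw [SimpleGraph.Walk.length_append] at h ⊢
    rw [SimpleGraph.Walk.length_append]
    have := h.add_odd hc
    convert this using 1; omega
  · exact ⟨_, h⟩

theorem drawable_map {φ : MatchingPolicy G} {σ : Pref G} (hσ : σ ∈ φ.prefLaw.support)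
    (z : List V) : Drawable φ (z.map fun v => (v, σ)) := by
  intro x hx
  obtain ⟨v, -, rfl⟩ := List.mem_map.1 hx
  exact hσ

/-- A word that erases the last two letters leaves, by sub-additivity, no more letters than the rest
had; so the length drops by at least two, and the argument is repeated on what is left. -/
theorem exists_erasing_word {φ : MatchingPolicy G} (hconn : G.Connected) (hbip : ¬ G.IsBipartite)
    (hφ : φ.SubAdditive) {σ : Pref G} (hσ : σ ∈ φ.prefLaw.support) (w : List V)
    (hw : w ∈ admissibleWords G) (he : Even w.length) :
    ∃ z : List V, Even z.length ∧ ((z.map fun v => (v, σ)).foldl φ.next w = []) ∧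
      ((z.map fun v => (v, σ)).foldl φ.next [] = []) := by
  induction hn : w.length using Nat.strong_induction_on generalizing w with
  | _ n ih =>
    by_cases h0 : w = []
    · exact ⟨[], by simp, by simpa using h0, by simp⟩
    obtain ⟨u, i, j, rfl⟩ := exists_eq_append_pair he h0
    have hij : ¬ G.Adj i j := hw i (by simp) j (by simp)
    obtain ⟨p, k, hp⟩ := exists_odd_walk hconn hbip i j
    obtain ⟨z, hz, hz1, hz2⟩ := exists_erasing_word_of_walk φ σ k p hp hij
    have hle := length_foldl_next_append_le hφ hw (drawable_map hσ z)
    rw [hz1] at hle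
    have hev := (even_length_foldl_next φ (z.map fun v => (v, σ)) hw).2 (by simp_all)
    obtain ⟨z', hz', hz1', hz2'⟩ := ih _ (by simp at hn hle; omega) _
      (foldl_next_mem_admissibleWords φ (z.map fun v => (v, σ)) hw) hev rfl
    exact ⟨z ++ z', by simpa using hz.add hz', by simpa using hz1', by simpa [hz2] using hz2'⟩

/-- The erasing words are concatenated one queue detail at a time. Queue details already erased stay
erased, because each added word is also completely matched from the empty queue. -/
theorem exists_erasing_word_of_list {φ : MatchingPolicy G} (hconn : G.Connected)
    (hbip : ¬ G.IsBipartite) (hφ : φ.SubAdditive) {σ : Pref G} (hσ : σ ∈ φ.prefLaw.support)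
    (ws : List (List V)) (hws : ∀ w ∈ ws, w ∈ admissibleWords G ∧ Even w.length) :
    ∃ z : List V, Even z.length ∧ (∀ w ∈ ws, (z.map fun v => (v, σ)).foldl φ.next w = []) ∧
      ((z.map fun v => (v, σ)).foldl φ.next [] = []) := by
  induction ws with
  | nil => exact ⟨[], by simp, by simp, by simp⟩
  | cons w ws ih =>
    obtain ⟨z, hz, hz1, hz2⟩ := ih fun v hv => hws v (by simp [hv])
    obtain ⟨hw, he⟩ := hws w (by simp)
    obtain ⟨z', hz', hz1', hz2'⟩ := exists_erasing_word hconn hbip hφ hσ _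
      (foldl_next_mem_admissibleWords φ (z.map fun v => (v, σ)) hw)
      ((even_length_foldl_next φ (z.map fun v => (v, σ)) hw).2 (by simp [he, hz]))
    refine ⟨z ++ z', by simpa using hz.add hz', fun v hv => ?_, by simpa [hz2] using hz2'⟩
    rcases List.mem_cons.1 hv with rfl | hv
    · simpa using hz1'
    · simpa [hz1 v hv] using hz2'

/-- Each strong erasing word cancels the last two letters of a non-empty queue and, by
sub-additivity, does not lengthen the rest; it returns an empty queue to empty. Hence `r` of them
absorb `2 * r` letters. -/
theorem foldl_next_of_isStrongErasing {φ : MatchingPolicy G} (hφ : φ.SubAdditive)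
    (zs : List (List V))
    (hzs : ∀ z ∈ zs, φ.IsStrongErasing z) {w : List V} (hw : w ∈ admissibleWords G)
    (he : Even w.length) (hlen : w.length ≤ 2 * zs.length) {L : List (Arrival G)}
    (hL : Drawable φ L) (hLz : L.map Prod.fst = zs.flatten) : L.foldl φ.next w = [] := by
  induction zs generalizing w L with
  | nil =>
    obtain rfl : w = [] := by simpa using hlen
    obtain rfl : L = [] := by simpa using hLz
    rfl
  | cons z zs ih =>
    rw [List.flatten_cons] at hLz
    obtain ⟨L₁, L₂, rfl, h₁, h₂⟩ := List.map_eq_append_iff.1 hLz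
    have hL₁ : Drawable φ L₁ := fun x hx => hL x (by simp [hx])
    have hL₂ : Drawable φ L₂ := fun x hx => hL x (by simp [hx])
    obtain ⟨hz, hz1, hz2⟩ := hzs z (by simp)
    have hlen₁ : (L₁.map Prod.snd).length = z.length := by simp [← h₁]
    have hev := (even_length_foldl_next φ L₁ hw).2 (by rw [← h₁] at hz; simp_all)
    rw [List.foldl_append]
    refine ih (fun v hv => hzs v (by simp [hv])) (foldl_next_mem_admissibleWords φ L₁ hw) hev ?_
      hL₂ h₂
    by_cases h0 : w = []
    · subst h0
      rcases Nat.eq_zero_or_pos z.length with hz0 | hz0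
      · have : L₁ = [] := by
          rw [← List.length_eq_zero_iff, ← hz0, ← h₁]; simp
        simp [this]
      -- The full word is its own right sub-word, the case `0` of the last clause.
      · have := hz2 0 (by simpa using hz0) _ hlen₁ hL₁.canDraw
        simp only [mul_zero, List.drop_zero] at this
        rw [MatchingPolicy.queue, ← h₁, zip_map_fst_map_snd] at this
        simp [this]
    · obtain ⟨u, i, j, rfl⟩ := exists_eq_append_pair he h0
      have hij : ¬ G.Adj i j := hw i (by simp) j (by simp)
      obtain ⟨σ, hσ⟩ := φ.prefLaw.support_nonempty
      have := hz1 i j hij [σ, σ] _ rfl hlen₁ (canDraw_replicate φ hσ 2) hL₁.canDraw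
      rw [queue_append φ (by simp), queue_of_mem_admissibleWords φ (pair_mem_admissibleWords hij)
        (by simp), ← h₁, zip_map_fst_map_snd] at this
      have hle := length_foldl_next_append_le hφ hw hL₁
      rw [this] at hle
      simp at hle hlen; omega

end ErasingWords

/-! ### Runs of the queue detail along a bi-infinite input -/

section Runs

variable {V : Type*} {G : SimpleGraph V} (φ : MatchingPolicy G)

/-- The `j` arrivals from time `s` on. -/
def arrivals (x : ℤ → Arrival G) (s : ℤ) (j : ℕ) : List (Arrival G) :=
  (List.range j).map fun i : ℕ => x (s + i)

theorem length_arrivals (x : ℤ → Arrival G) (s : ℤ) (j : ℕ) : (arrivals x s j).length = j := by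
  simp [arrivals]

theorem arrivals_succ (x : ℤ → Arrival G) (s : ℤ) (j : ℕ) :
    arrivals x s (j + 1) = arrivals x s j ++ [x (s + j)] := by
  simp [arrivals, List.range_succ]

theorem arrivals_add (x : ℤ → Arrival G) (s : ℤ) (j k : ℕ) :
    arrivals x s (j + k) = arrivals x s j ++ arrivals x (s + j) k := by
  simp [arrivals, List.range_add, add_assoc, Function.comp_def]

theorem arrivals_shiftBy (x : ℤ → Arrival G) (k s : ℤ) (j : ℕ) :
    arrivals (shiftBy k x) s j = arrivals x (s + k) j := by
  simp [arrivals, shiftBy, add_right_comm]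

theorem drawable_arrivals {φ : MatchingPolicy G} {x : ℤ → Arrival G}
    (hx : ∀ n, (x n).2 ∈ φ.prefLaw.support) (s : ℤ) (j : ℕ) : Drawable φ (arrivals x s j) := by
  intro y hy
  obtain ⟨i, -, rfl⟩ := List.mem_map.1 hy
  exact hx _

/-- The queue detail after the `j` arrivals from time `s` on, if it is `w` at time `s`. -/
noncomputable def wordRun (x : ℤ → Arrival G) (s : ℤ) (j : ℕ) (w : List V) : List V :=
  (arrivals x s j).foldl φ.next w

theorem wordRun_zero (x : ℤ → Arrival G) (s : ℤ) (w : List V) : wordRun φ x s 0 w = w := rfl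

theorem wordRun_succ (x : ℤ → Arrival G) (s : ℤ) (j : ℕ) (w : List V) :
    wordRun φ x s (j + 1) w = φ.next (wordRun φ x s j w) (x (s + j)) := by
  simp [wordRun, arrivals_succ]

theorem wordRun_add (x : ℤ → Arrival G) (s : ℤ) (j k : ℕ) (w : List V) :
    wordRun φ x s (j + k) w = wordRun φ x (s + j) k (wordRun φ x s j w) := by
  simp [wordRun, arrivals_add]

theorem wordRun_shiftBy (x : ℤ → Arrival G) (k s : ℤ) (j : ℕ) (w : List V) :
    wordRun φ (shiftBy k x) s j w = wordRun φ x (s + k) j w := by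
  simp [wordRun, arrivals_shiftBy]

theorem wordRun_mem_admissibleWords (x : ℤ → Arrival G) (s : ℤ) (j : ℕ) {w : List V}
    (hw : w ∈ admissibleWords G) : wordRun φ x s j w ∈ admissibleWords G :=
  foldl_next_mem_admissibleWords φ _ hw

theorem even_length_wordRun (x : ℤ → Arrival G) (s : ℤ) (j : ℕ) {w : List V}
    (hw : w ∈ admissibleWords G) :
    Even (wordRun φ x s (2 * j) w).length ↔ Even w.length := by
  rw [wordRun, even_length_foldl_next φ _ hw, length_arrivals]
  simp

/-- This keeps a queue within a finite set of words until the system started empty is next ready to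
receive an erasing word. -/
theorem length_wordRun_le {φ : MatchingPolicy G} (hφ : φ.SubAdditive) {x : ℤ → Arrival G}
    (hx : ∀ n, (x n).2 ∈ φ.prefLaw.support) (s : ℤ) (j : ℕ) {w : List V}
    (hw : w ∈ admissibleWords G) (h0 : wordRun φ x s j [] = []) :
    (wordRun φ x s j w).length ≤ w.length := by
  have := length_foldl_next_le_add hφ hw (drawable_arrivals hx s j)
  rw [wordRun] at h0
  rwa [h0] at this

theorem evenBuffer_evenPairs (w : List V) (n : ℕ) (x : ℤ → Arrival G) :
    φ.evenBuffer (fun _ => w) n (evenPairs x) = wordRun φ x 0 (2 * n) w := by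
  induction n with
  | zero => rfl
  | succ n ih =>
    rw [MatchingPolicy.evenBuffer, ih, show 2 * (n + 1) = 2 * n + 1 + 1 by ring, wordRun_succ,
      wordRun_succ]
    simp [evenPairs]

theorem shiftBy_evenPairs {α : Type*} (k : ℤ) (x : ℤ → α) :
    shiftBy k (evenPairs x) = evenPairs (shiftBy (2 * k) x) := by
  funext n
  simp only [shiftBy, evenPairs, mul_add]
  congr 2; ring

theorem shiftBy_shiftBy {α : Type*} (k l : ℤ) (x : ℤ → α) :
    shiftBy k (shiftBy l x) = shiftBy (k + l) x := by
  funext n; simp [shiftBy, add_assoc]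

theorem pairLetters_evenPairs (x : ℤ → Arrival G) (m : ℕ) :
    pairLetters (evenPairs x) m = (arrivals x 0 (2 * m)).map Prod.fst := by
  induction m with
  | zero => rfl
  | succ m ih =>
    rw [show 2 * (m + 1) = 2 * m + 1 + 1 by ring, arrivals_succ, arrivals_succ]
    simp only [List.map_append, ← ih]
    simp [pairLetters, List.range_succ, evenPairs]

/-- The system started empty at time `s` is empty at time `n`. -/
def Empties (x : ℤ → Arrival G) (s n : ℤ) : Prop :=
  ∃ j : ℕ, s + j = n ∧ wordRun φ x s j [] = []

theorem Empties.trans {φ : MatchingPolicy G} {x : ℤ → Arrival G} {s l n : ℤ}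
    (h : Empties φ x s l) (h' : Empties φ x l n) : Empties φ x s n := by
  obtain ⟨j, rfl, hj⟩ := h
  obtain ⟨k, rfl, hk⟩ := h'
  exact ⟨j + k, by push_cast; ring, by rw [wordRun_add, hj, hk]⟩

/-- A run that is empty at `l` continues as the run started empty at `l`. With `Empties.trans`, this
lets runs be exchanged after a common empty time. -/
theorem Empties.of_le {φ : MatchingPolicy G} {x : ℤ → Arrival G} {s l n : ℤ}
    (h : Empties φ x s l) (h' : Empties φ x s n) (hln : l ≤ n) : Empties φ x l n := by
  obtain ⟨j, rfl, hj⟩ := h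
  obtain ⟨k, rfl, hk⟩ := h'
  obtain ⟨d, rfl⟩ : ∃ d, k = j + d := ⟨k - j, by omega⟩
  exact ⟨d, by push_cast; ring, by rwa [wordRun_add, hj] at hk⟩

theorem empties_shiftBy (x : ℤ → Arrival G) (k s n : ℤ) :
    Empties φ (shiftBy k x) s n ↔ Empties φ x (s + k) (n + k) := by
  simp only [Empties, wordRun_shiftBy]
  refine exists_congr fun j => and_congr_left fun _ => ?_
  omega

theorem Empties.even {φ : MatchingPolicy G} {x : ℤ → Arrival G} {s n : ℤ} (h : Empties φ x s n) :
    Even (n - s) := by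
  obtain ⟨j, rfl, hj⟩ := h
  have := (even_length_foldl_next φ (arrivals x s j) nil_mem_admissibleWords).1
    (by rw [wordRun] at hj; simp [hj])
  rw [length_arrivals] at this
  simpa using this

end Runs

end GeneralMatching

namespace GeneralMatching

/-! ### Buffers of items, and their correspondence with perfect matchings -/

section Items

variable {V : Type*} {G : SimpleGraph V} (φ : MatchingPolicy G)

open Classical in
/-- The item of the buffer `b` with which the item arriving at time `n` is matched, if any. -/
noncomputable def selected (x : ℤ → Arrival G) (b : List ℤ) (n : ℤ) : Option ℤ :=
  if ∃ k ∈ b, G.Adj (x n).1 (x k).1 then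
    b[φ.choice (b.map fun k => (x k).1) (x n).1 (x n).2]? else none

open Classical in
/-- The buffer after the arrival of item `n`, if it is `b` just before. -/
noncomputable def itemNext (x : ℤ → Arrival G) (b : List ℤ) (n : ℤ) : List ℤ :=
  if ∃ k ∈ b, G.Adj (x n).1 (x k).1 then
    b.eraseIdx (φ.choice (b.map fun k => (x k).1) (x n).1 (x n).2) else b ++ [n]

theorem map_itemNext (x : ℤ → Arrival G) (b : List ℤ) (n : ℤ) :
    (itemNext φ x b n).map (fun k => (x k).1) = φ.next (b.map fun k => (x k).1) (x n) := by
  unfold itemNext MatchingPolicy.next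
  by_cases h : ∃ k ∈ b, G.Adj (x n).1 (x k).1
  · rw [if_pos h, if_pos (by simpa using h), List.eraseIdx_map]
  · rw [if_neg h, if_neg (by simpa using h)]; simp

/-- The lists of items that can be the buffer just before time `n`. -/
structure IsBuffer (x : ℤ → Arrival G) (n : ℤ) (b : List ℤ) : Prop where
  pairwise : b.Pairwise (· < ·)
  lt : ∀ k ∈ b, k < n
  admissible : b.map (fun k => (x k).1) ∈ admissibleWords G

theorem isBuffer_nil (x : ℤ → Arrival G) (n : ℤ) : IsBuffer x n [] :=
  ⟨List.Pairwise.nil, by simp, nil_mem_admissibleWords⟩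

/-- The policy names a position, a matching names an item. Since a buffer is strictly increasing it
has no repetition, so erasing at a position is removing one item. -/
theorem IsBuffer.selected_cases {x : ℤ → Arrival G} {n : ℤ} {b : List ℤ} (hb : IsBuffer x n b) :
    (∃ k ∈ b, (∃ k ∈ b, G.Adj (x n).1 (x k).1) ∧
      b[φ.choice (b.map fun k => (x k).1) (x n).1 (x n).2]? = some k ∧
      selected φ x b n = some k ∧ G.Adj (x n).1 (x k).1 ∧
      ∀ l, l ∈ itemNext φ x b n ↔ l ∈ b ∧ l ≠ k) ∨
    ((¬ ∃ k ∈ b, G.Adj (x n).1 (x k).1) ∧ selected φ x b n = none ∧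
      itemNext φ x b n = b ++ [n]) := by
  by_cases h : ∃ k ∈ b, G.Adj (x n).1 (x k).1
  · left
    obtain ⟨a, ha, hadj⟩ := φ.choice_compatible _ hb.admissible (x n).1 (x n).2 (by simpa using h)
    rw [List.getElem?_map, Option.map_eq_some_iff] at ha
    obtain ⟨k, hk, rfl⟩ := ha
    refine ⟨k, List.mem_of_getElem? hk, h, hk, by rw [selected, if_pos h, hk], hadj, fun l => ?_⟩
    rw [itemNext, if_pos h]
    obtain ⟨hlt, hget⟩ := List.getElem?_eq_some_iff.1 hk
    have hnd : b.Nodup := hb.pairwise.imp fun h => h.ne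
    rw [← hnd.erase_getElem _ hlt, hget, hnd.mem_erase_iff, and_comm]
  · right
    exact ⟨h, by rw [selected, if_neg h], by rw [itemNext, if_neg h]⟩

theorem IsBuffer.itemNext {x : ℤ → Arrival G} {n : ℤ} {b : List ℤ} (hb : IsBuffer x n b) :
    IsBuffer x (n + 1) (itemNext φ x b n) := by
  refine ⟨?_, ?_, ?_⟩
  · unfold GeneralMatching.itemNext
    split_ifs with h
    · exact hb.pairwise.sublist (List.eraseIdx_sublist _ _)
    · rw [List.pairwise_append]
      refine ⟨hb.pairwise, by simp, fun k hk l hl => ?_⟩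
      rw [List.mem_singleton.1 hl]; exact hb.lt k hk
  · intro k hk
    rcases hb.selected_cases φ with ⟨j, -, -, -, -, -, h⟩ | ⟨-, -, h⟩
    · have := hb.lt k ((h k).1 hk).1; omega
    · rw [h, List.mem_append, List.mem_singleton] at hk
      rcases hk with hk | rfl
      · have := hb.lt k hk; omega
      · omega
  · rw [map_itemNext]
    exact next_mem_admissibleWords φ hb.admissible _

/-- A bi-infinite evolution of the buffer. -/
structure IsTrajectory (x : ℤ → Arrival G) (B : ℤ → List ℤ) : Prop where
  isBuffer : ∀ n, IsBuffer x n (B n)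
  step : ∀ n, B (n + 1) = itemNext φ x (B n) n

variable {φ}

/-- An item can enter the buffer only at its own arrival, so membership propagates backwards to that
moment. -/
theorem IsTrajectory.mem_of_mem {x : ℤ → Arrival G} {B : ℤ → List ℤ} (hB : IsTrajectory φ x B)
    {k t n : ℤ} (hk : k ∈ B n) (hkt : k < t) (htn : t ≤ n) : k ∈ B t := by
  induction n, htn using Int.leInduction with
  | base => exact hk
  | succ n hn ih =>
    apply ih
    rw [hB.step] at hk
    rcases (hB.isBuffer n).selected_cases φ with ⟨j, -, -, -, -, -, h⟩ | ⟨-, -, h⟩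
    · exact ((h k).1 hk).1
    · rw [h, List.mem_append, List.mem_singleton] at hk
      rcases hk with hk | rfl
      · exact hk
      · omega

theorem IsTrajectory.selected_eq_none {x : ℤ → Arrival G} {B : ℤ → List ℤ}
    (hB : IsTrajectory φ x B) {k n : ℤ} (hk : k ∈ B n) : selected φ x (B k) k = none := by
  have hlt := (hB.isBuffer n).lt k hk
  have h1 : k ∈ B (k + 1) := hB.mem_of_mem hk (by omega) (by omega)
  rw [hB.step] at h1
  rcases (hB.isBuffer k).selected_cases φ with ⟨j, -, -, -, -, -, h⟩ | ⟨-, h, -⟩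
  · exact absurd ((hB.isBuffer k).lt k ((h k).1 h1).1) (lt_irrefl k)
  · exact h

theorem IsTrajectory.mem_of_selected {x : ℤ → Arrival G} {B : ℤ → List ℤ}
    (hB : IsTrajectory φ x B) {k n : ℤ} (h : selected φ x (B n) n = some k) :
    k ∈ B n ∧ G.Adj (x n).1 (x k).1 ∧ k ∉ B (n + 1) := by
  rcases (hB.isBuffer n).selected_cases φ with ⟨j, hj, -, -, hs, hadj, hm⟩ | ⟨-, h', -⟩
  · rw [h, Option.some_inj] at hs
    subst hs
    exact ⟨hj, hadj, by rw [hB.step, hm]; simp⟩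
  · rw [h'] at h; simp at h

/-- In the evolution `B`, item `n` is matched with item `k`. -/
def Matched (φ : MatchingPolicy G) (x : ℤ → Arrival G) (B : ℤ → List ℤ) (n k : ℤ) : Prop :=
  selected φ x (B n) n = some k ∨ selected φ x (B k) k = some n

/-- An item that selects on arrival is never stored, so it cannot be selected later; an item
selected once leaves the buffer for good. -/
theorem IsTrajectory.matched_unique {x : ℤ → Arrival G} {B : ℤ → List ℤ}
    (hB : IsTrajectory φ x B) {n k l : ℤ} (hk : Matched φ x B n k) (hl : Matched φ x B n l) :
    k = l := by
  have aux : ∀ k l, selected φ x (B n) n = some k → selected φ x (B l) l = some n → False := by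
    intro k l h h'
    rw [hB.selected_eq_none (hB.mem_of_selected h').1] at h
    simp at h
  have aux' : ∀ k l, selected φ x (B k) k = some n → selected φ x (B l) l = some n → ¬ k < l := by
    intro k l h h' hkl
    have h1 := hB.mem_of_selected h
    have h2 := hB.mem_of_selected h'
    have := (hB.isBuffer k).lt n h1.1
    exact h1.2.2 (hB.mem_of_mem h2.1 (by omega) (by omega))
  rcases hk with hk | hk <;> rcases hl with hl | hl
  · rw [hk] at hl; exact Option.some_inj.1 hl
  · exact (aux _ _ hk hl).elim
  · exact (aux _ _ hl hk).elim
  · have h1 := aux' _ _ hk hl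
    have h2 := aux' _ _ hl hk
    omega

/-- An unmatched item would stay in all later buffers, contradicting a later empty time. -/
theorem IsTrajectory.exists_matched {x : ℤ → Arrival G} {B : ℤ → List ℤ}
    (hB : IsTrajectory φ x B) (hzero : ∀ N, ∃ n ≥ N, B n = []) (n : ℤ) :
    ∃ k, Matched φ x B n k := by
  by_contra hne
  have hne' : ∀ k, ¬ Matched φ x B n k := fun k hk => hne ⟨k, hk⟩
  obtain ⟨t, ht, ht0⟩ := hzero (n + 1)
  have : n ∈ B t := by
    clear ht0
    induction t, ht using Int.leInduction with
    | base =>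
      rw [hB.step]
      rcases (hB.isBuffer n).selected_cases φ with ⟨j, -, -, -, hs, -, -⟩ | ⟨-, -, h⟩
      · exact (hne' j (Or.inl hs)).elim
      · rw [h]; simp
    | succ t ht ih =>
      rw [hB.step]
      rcases (hB.isBuffer t).selected_cases φ with ⟨j, -, -, -, hs, -, h⟩ | ⟨-, -, h⟩
      · refine (h n).2 ⟨ih, ?_⟩
        rintro rfl
        exact hne' t (Or.inr hs)
      · rw [h]; simp [ih]
  rw [ht0] at this
  simp at this

/-- A bi-infinite evolution of the buffer along which the buffer is infinitely often empty is
the evolution of the buffer of a perfect matching. -/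
theorem IsTrajectory.exists_isPerfectMatching {x : ℤ → Arrival G} {B : ℤ → List ℤ}
    (hB : IsTrajectory φ x B) (hzero : ∀ N, ∃ n ≥ N, B n = []) :
    ∃ m : ℤ → ℤ, IsPerfectMatching φ x m ∧ (∀ n k, k ∈ waiting m n ↔ k ∈ B n) ∧
      ∀ n k, m n = k ↔ Matched φ x B n k := by
  choose m hm using hB.exists_matched hzero
  have hiff : ∀ n k, m n = k ↔ Matched φ x B n k :=
    fun n k => ⟨fun h => h ▸ hm n, fun h => hB.matched_unique (hm n) h⟩
  have hwait : ∀ n k, k ∈ waiting m n ↔ k ∈ B n := by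
    intro n k
    constructor
    · rintro ⟨h1, h2⟩
      rcases hm k with h | h
      · have := (hB.isBuffer k).lt _ (hB.mem_of_selected h).1; omega
      · exact hB.mem_of_mem (hB.mem_of_selected h).1 h1 h2
    · intro hk
      have hkn := (hB.isBuffer n).lt k hk
      refine ⟨hkn, ?_⟩
      rcases hm k with h | h
      · rw [hB.selected_eq_none hk] at h; simp at h
      · by_contra hlt
        have h1 := hB.mem_of_selected h
        have := (hB.isBuffer _).lt k h1.1
        exact h1.2.2 (hB.mem_of_mem hk (by omega) (by omega))
  refine ⟨m, ⟨fun n => ?_, fun n hn => ?_, fun n => ?_, fun n => ?_⟩, hwait, hiff⟩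
  · exact (hiff _ _).2 (hm n).symm
  · have : selected φ x (B n) n = some n := by
      have := hm n
      rw [hn] at this
      rcases this with h | h <;> exact h
    exact lt_irrefl n ((hB.isBuffer n).lt n (hB.mem_of_selected this).1)
  · rcases hm n with h | h
    · exact (hB.mem_of_selected h).2.1
    · exact (hB.mem_of_selected h).2.1.symm
  · refine ⟨B n, (hB.isBuffer n).pairwise, fun k => (hwait n k).symm, fun h => ?_, fun h => ?_⟩
    · rcases (hB.isBuffer n).selected_cases φ with ⟨j, -, -, hj, hs, -, -⟩ | ⟨h', -, -⟩
      · rw [hj, (hiff n j).2 (Or.inl hs)]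
      · exact absurd h h'
    · rcases (hB.isBuffer n).selected_cases φ with ⟨j, -, h', -, -, -, -⟩ | ⟨-, hs, -⟩
      · exact absurd h' h
      · rcases hm n with h1 | h1
        · rw [hs] at h1; simp at h1
        · exact (hB.isBuffer _).lt n (hB.mem_of_selected h1).1

theorem eq_of_pairwise_lt_of_mem_iff {b c : List ℤ} (hb : b.Pairwise (· < ·))
    (hc : c.Pairwise (· < ·)) (h : ∀ k, k ∈ b ↔ k ∈ c) : b = c :=
  ((List.perm_ext_iff_of_nodup (hb.imp fun h => h.ne) (hc.imp fun h => h.ne)).2 h).eq_of_pairwise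
    (fun _ _ _ _ h1 h2 => absurd h1 (lt_asymm h2)) hb hc

/-- The converse passage: the lists provided by `follows_policy` enumerate the waiting sets in
increasing order, which determines them, so they evolve by `itemNext`. -/
theorem IsPerfectMatching.exists_isTrajectory {x : ℤ → Arrival G} {m : ℤ → ℤ}
    (hm : IsPerfectMatching φ x m) :
    ∃ B : ℤ → List ℤ, IsTrajectory φ x B ∧ (∀ n k, k ∈ B n ↔ k ∈ waiting m n) ∧
      ∀ n, selected φ x (B n) n = if m n < n then some (m n) else none := by
  choose B hpw hmem hadj hnadj using hm.follows_policy
  have hsel : ∀ n, (∃ k ∈ B n, G.Adj (x n).1 (x k).1) → m n < n := by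
    intro n h
    have := List.mem_of_getElem? (hadj n h)
    exact ((hmem n _).1 this).1
  have hbuf : ∀ n, IsBuffer x n (B n) := by
    intro n
    refine ⟨hpw n, fun k hk => ((hmem n k).1 hk).1, ?_⟩
    -- Had two waiting items been compatible, the later one would have been matched backwards on
    -- arrival and would not be waiting.
    have aux : ∀ k ∈ B n, ∀ l ∈ B n, k < l → ¬ G.Adj (x l).1 (x k).1 := by
      intro k hk l hl hkl h
      have h1 := (hmem n k).1 hk
      have h2 := (hmem n l).1 hl
      have h3 := hsel l ⟨k, (hmem l k).2 ⟨hkl, h2.1.le.trans h1.2⟩, h⟩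
      have h4 := h2.1
      have h5 := h2.2
      omega
    intro a ha b hb hab
    obtain ⟨k, hk, rfl⟩ := List.mem_map.1 ha
    obtain ⟨l, hl, rfl⟩ := List.mem_map.1 hb
    rcases lt_trichotomy k l with h | rfl | h
    · exact aux k hk l hl h hab.symm
    · exact G.irrefl hab
    · exact aux l hl k hk h hab
  refine ⟨B, ⟨hbuf, fun n => ?_⟩, hmem, fun n => ?_⟩
  · refine eq_of_pairwise_lt_of_mem_iff (hpw _) ((hbuf n).itemNext φ).pairwise fun k => ?_
    rw [hmem]
    rcases (hbuf n).selected_cases φ with ⟨j, -, h, hj, -, -, hk⟩ | ⟨h, -, hk⟩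
    · rw [hadj n h, Option.some_inj] at hj
      subst hj
      rw [hk, hmem]
      have hlt := hsel n h
      constructor
      · rintro ⟨h1, h2⟩
        have hkn : k ≠ n := by rintro rfl; omega
        refine ⟨⟨by omega, by omega⟩, ?_⟩
        rintro rfl
        rw [hm.involutive] at h2; omega
      · rintro ⟨⟨h1, h2⟩, h3⟩
        refine ⟨by omega, ?_⟩
        have : m k ≠ n := by
          rintro rfl
          exact h3 (hm.involutive k).symm
        omega
    · rw [hk, List.mem_append, List.mem_singleton, hmem]
      have hlt := hnadj n h
      constructor
      · rintro ⟨h1, h2⟩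
        by_cases hkn : k = n
        · exact Or.inr hkn
        · exact Or.inl ⟨by omega, by omega⟩
      · rintro (⟨h1, h2⟩ | rfl)
        · refine ⟨by omega, ?_⟩
          have : m k ≠ n := by
            rintro rfl
            rw [hm.involutive] at hlt; omega
          omega
        · exact ⟨by omega, by omega⟩
  · rcases (hbuf n).selected_cases φ with ⟨j, -, h, hj, hs, -, -⟩ | ⟨h, hs, -⟩
    · rw [hs, if_pos (hsel n h), ← hj, hadj n h]
    · rw [hs, if_neg (hnadj n h).le.not_gt]

theorem IsTrajectory.eq_of_eq {x : ℤ → Arrival G} {B B' : ℤ → List ℤ} (hB : IsTrajectory φ x B)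
    (hB' : IsTrajectory φ x B') {s n : ℤ} (h : B s = B' s) (hsn : s ≤ n) : B n = B' n := by
  induction n, hsn using Int.leInduction with
  | base => exact h
  | succ n hn ih => rw [hB.step, hB'.step, ih]

/-- Two perfect matchings whose buffers are simultaneously empty at arbitrarily large negative
times are equal. -/
theorem IsPerfectMatching.eq_of_waiting_eq_empty {x : ℤ → Arrival G} {m m' : ℤ → ℤ}
    (hm : IsPerfectMatching φ x m) (hm' : IsPerfectMatching φ x m')
    (h : ∀ N, ∃ n ≤ N, waiting m n = ∅ ∧ waiting m' n = ∅) : m = m' := by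
  obtain ⟨B, hB, hmem, hs⟩ := hm.exists_isTrajectory
  obtain ⟨B', hB', hmem', hs'⟩ := hm'.exists_isTrajectory
  have hBB : ∀ n, B n = B' n := by
    intro n
    obtain ⟨s, hsn, h1, h2⟩ := h n
    refine hB.eq_of_eq hB' ?_ hsn
    have h3 : B s = [] :=
      List.eq_nil_iff_forall_not_mem.2 fun k hk => by simpa [h1] using (hmem s k).1 hk
    have h4 : B' s = [] :=
      List.eq_nil_iff_forall_not_mem.2 fun k hk => by simpa [h2] using (hmem' s k).1 hk
    rw [h3, h4]
  -- The common buffer evolution determines all backward matches; involutivity then determines the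
  -- forward ones.
  have key : ∀ n, m n < n → m' n = m n := by
    intro n hn
    have := hs' n
    rw [← hBB, hs, if_pos hn] at this
    split_ifs at this with h'
    exact (Option.some_inj.1 this).symm
  funext n
  rcases lt_or_gt_of_ne (hm.ne_self n) with hn | hn
  · exact (key n hn).symm
  · have := key (m n) (by rwa [hm.involutive])
    rw [hm.involutive] at this
    rw [← hm'.involutive (m n), this]

end Items

end GeneralMatching

namespace GeneralMatching

/-! ### Limits of systems started ever earlier; parity and translation -/

section ItemRuns

variable {V : Type*} {G : SimpleGraph V} (φ : MatchingPolicy G)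

/-- The buffer after the `j` arrivals from time `s` on, in a system started empty at time `s`. -/
noncomputable def itemRun (x : ℤ → Arrival G) (s : ℤ) : ℕ → List ℤ
  | 0 => []
  | j + 1 => itemNext φ x (itemRun x s j) (s + j)

theorem map_itemRun (x : ℤ → Arrival G) (s : ℤ) (j : ℕ) :
    (itemRun φ x s j).map (fun k => (x k).1) = wordRun φ x s j [] := by
  induction j with
  | zero => rfl
  | succ j ih => rw [itemRun, map_itemNext, ih, wordRun_succ]

theorem isBuffer_itemRun (x : ℤ → Arrival G) (s : ℤ) (j : ℕ) :
    IsBuffer x (s + j) (itemRun φ x s j) := by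
  induction j with
  | zero => exact isBuffer_nil x _
  | succ j ih =>
    have := ih.itemNext φ
    rw [itemRun]; push_cast; rwa [← add_assoc]

theorem itemRun_add_of_eq_nil {x : ℤ → Arrival G} {s : ℤ} {j : ℕ}
    (h : wordRun φ x s j [] = []) (k : ℕ) : itemRun φ x s (j + k) = itemRun φ x (s + j) k := by
  induction k with
  | zero => rw [← map_itemRun, List.map_eq_nil_iff] at h; exact h
  | succ k ih =>
    rw [← add_assoc, itemRun, ih, itemRun]
    push_cast; rw [add_assoc]

/-- The buffer just before time `n` in a system started empty at time `s ≤ n`. -/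
noncomputable def itemsAt (x : ℤ → Arrival G) (s n : ℤ) : List ℤ := itemRun φ x s (n - s).toNat

variable {φ}

theorem itemsAt_add_one {x : ℤ → Arrival G} {s n : ℤ} (h : s ≤ n) :
    itemsAt φ x s (n + 1) = itemNext φ x (itemsAt φ x s n) n := by
  obtain ⟨j, rfl⟩ := Int.le.dest h
  simp only [itemsAt]
  rw [show (s + j + 1 - s).toNat = j + 1 by omega, show (s + j - s).toNat = j by omega, itemRun]

theorem isBuffer_itemsAt {x : ℤ → Arrival G} {s n : ℤ} (h : s ≤ n) :
    IsBuffer x n (itemsAt φ x s n) := by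
  obtain ⟨j, rfl⟩ := Int.le.dest h
  simp only [itemsAt]
  rw [show (s + j - s).toNat = j by omega]
  exact isBuffer_itemRun φ x s j

theorem itemsAt_eq_nil_iff {x : ℤ → Arrival G} {s n : ℤ} (h : s ≤ n) :
    itemsAt φ x s n = [] ↔ Empties φ x s n := by
  obtain ⟨j, rfl⟩ := Int.le.dest h
  simp only [itemsAt]
  rw [show (s + j - s).toNat = j by omega, ← List.map_eq_nil_iff (f := fun k => (x k).1),
    map_itemRun]
  constructor
  · exact fun h => ⟨j, rfl, h⟩
  · rintro ⟨k, hk, hk'⟩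
    obtain rfl : k = j := by omega
    exact hk'

theorem Empties.itemsAt_eq {x : ℤ → Arrival G} {s l n : ℤ} (h : Empties φ x s l) (hln : l ≤ n) :
    itemsAt φ x s n = itemsAt φ x l n := by
  obtain ⟨j, rfl, hj⟩ := h
  obtain ⟨k, rfl⟩ := Int.le.dest hln
  simp only [itemsAt]
  rw [show (s + j + k - s).toNat = j + k by omega, show (s + j + k - (s + j)).toNat = k by omega,
    itemRun_add_of_eq_nil φ hj]

/-- Item `n` is matched with item `k` in the system started empty at time `s`. -/
def MatchedFrom (φ : MatchingPolicy G) (x : ℤ → Arrival G) (s n k : ℤ) : Prop :=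
  selected φ x (itemsAt φ x s n) n = some k ∨ selected φ x (itemsAt φ x s k) k = some n

/-- If systems started empty at times tending to `-∞` are eventually coupled, and their limit is
infinitely often empty, then they converge to a perfect matching. -/
theorem exists_isPerfectMatching_of_coupling {x : ℤ → Arrival G} {s : ℕ → ℤ}
    (hs : Tendsto s atTop atBot)
    (hcouple : ∀ N : ℤ, ∀ᶠ i in atTop, ∃ l ≤ N, Empties φ x (s i) l ∧ Empties φ x (s (i + 1)) l)
    (hpos : ∀ N : ℤ, ∃ l ≥ N, ∃ᶠ i in atTop, Empties φ x (s i) l) :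
    ∃ m : ℤ → ℤ, IsPerfectMatching φ x m ∧
      (∀ n, waiting m n = ∅ ↔ ∀ᶠ i in atTop, Empties φ x (s i) n) ∧
      (∀ n, waiting m n = ∅ ↔ ∃ᶠ i in atTop, Empties φ x (s i) n) ∧
      (∀ n k, m n = k ↔ ∀ᶠ i in atTop, MatchedFrom φ x (s i) n k) := by
  have hle : ∀ n, ∀ᶠ i in atTop, s i ≤ n := fun n => hs.eventually (eventually_le_atBot n)
  -- Consecutive runs share an empty time before `n`, so they have the same buffer at `n`.
  have hconst : ∀ n, ∃ b, ∀ᶠ i in atTop, itemsAt φ x (s i) n = b := by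
    intro n
    obtain ⟨i₀, hi₀⟩ := eventually_atTop.1 (hcouple n)
    refine ⟨itemsAt φ x (s i₀) n, eventually_atTop.2 ⟨i₀, fun i hi => ?_⟩⟩
    induction i, hi using Nat.le_induction with
    | base => rfl
    | succ i hi ih =>
      obtain ⟨l, hl, h1, h2⟩ := hi₀ i hi
      rw [← ih, h1.itemsAt_eq hl, h2.itemsAt_eq hl]
  choose B hBev using hconst
  have hB : IsTrajectory φ x B := by
    refine ⟨fun n => ?_, fun n => ?_⟩
    · obtain ⟨i, h1, h2⟩ := ((hBev n).and (hle n)).exists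
      exact h1 ▸ isBuffer_itemsAt h2
    · obtain ⟨i, h1, h2, h3⟩ := ((hBev n).and ((hle n).and (hBev (n + 1)))).exists
      rw [← h1, ← h3, itemsAt_add_one h2]
  -- As the buffers stabilise, frequent and eventual emptiness at `n` coincide: the first is what
  -- probability estimates deliver, the second is what deterministic comparisons need.
  have hB0 : ∀ n, ∀ᶠ i in atTop, (B n = [] ↔ Empties φ x (s i) n) := by
    intro n
    filter_upwards [hBev n, hle n] with i h1 h2
    rw [← h1, itemsAt_eq_nil_iff h2]
  have hB1 : ∀ n, B n = [] ↔ ∀ᶠ i in atTop, Empties φ x (s i) n := by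
    intro n
    rw [← eventually_congr (hB0 n), eventually_const]
  have hB2 : ∀ n, B n = [] ↔ ∃ᶠ i in atTop, Empties φ x (s i) n := by
    intro n
    rw [← frequently_congr (hB0 n), frequently_const]
  obtain ⟨m, hm, hmem, hmatch⟩ := hB.exists_isPerfectMatching (by
    intro N
    obtain ⟨l, hl, h⟩ := hpos N
    exact ⟨l, hl, (hB2 l).2 h⟩)
  have hw : ∀ n, waiting m n = ∅ ↔ B n = [] := by
    intro n
    rw [Set.eq_empty_iff_forall_notMem, List.eq_nil_iff_forall_not_mem]
    simp only [hmem]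
  refine ⟨m, hm, fun n => (hw n).trans (hB1 n), fun n => (hw n).trans (hB2 n), fun n k => ?_⟩
  rw [hmatch]
  have : ∀ᶠ i in atTop, (Matched φ x B n k ↔ MatchedFrom φ x (s i) n k) := by
    filter_upwards [hBev n, hBev k] with i h1 h2
    rw [Matched, MatchedFrom, h1, h2]
  rw [← eventually_congr this, eventually_const]

theorem IsPerfectMatching.exists_word {x : ℤ → Arrival G} {m : ℤ → ℤ}
    (hm : IsPerfectMatching φ x m) :
    ∃ W : ℤ → List V, (∀ n, W n ∈ admissibleWords G) ∧ (∀ n, (W n).length = (waiting m n).ncard) ∧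
      (∀ n, (waiting m n).Finite) ∧ ∀ n (j : ℕ), W (n + j) = wordRun φ x n j (W n) := by
  obtain ⟨B, hB, hmem, -⟩ := hm.exists_isTrajectory
  have hset : ∀ n, waiting m n = ((B n).toFinset : Set ℤ) := by
    intro n; ext k; simp [hmem]
  refine ⟨fun n => (B n).map fun k => (x k).1, fun n => (hB.isBuffer n).admissible, fun n => ?_,
    fun n => ?_, fun n j => ?_⟩
  · rw [hset, Set.ncard_coe_finset, List.toFinset_card_of_nodup, List.length_map]
    exact (hB.isBuffer n).pairwise.imp fun h => h.ne
  · rw [hset]; exact Finset.finite_toSet _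
  · induction j with
    | zero => simp [wordRun_zero]
    | succ j ih =>
      rw [wordRun_succ, ← ih, ← map_itemNext, ← hB.step]
      push_cast; rw [add_assoc]

theorem IsPerfectMatching.even_ncard_waiting_add_one {x : ℤ → Arrival G} {m : ℤ → ℤ}
    (hm : IsPerfectMatching φ x m) (n : ℤ) :
    Even (waiting m (n + 1)).ncard ↔ ¬ Even (waiting m n).ncard := by
  obtain ⟨W, hW, hl, -, hr⟩ := hm.exists_word
  have := hr n 1
  rw [wordRun_succ, wordRun_zero] at this
  rw [← hl, ← hl]
  rw [Nat.cast_one] at this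
  rw [this]
  rcases length_next φ (hW n) (x (n + (0 : ℕ))) with h | h
  · rw [← h, Nat.even_add_one, not_not]
  · rw [h, Nat.even_add_one]

/-- The parity at time `0` fixes the parity at all times; this is the source of the dichotomy
between the two matchings. -/
theorem IsPerfectMatching.even_ncard_waiting {x : ℤ → Arrival G} {m : ℤ → ℤ}
    (hm : IsPerfectMatching φ x m) (n : ℤ) :
    Even (waiting m n).ncard ↔ (Even n ↔ Even (waiting m 0).ncard) := by
  induction n using Int.induction_on with
  | zero => simp
  | succ n ih => rw [hm.even_ncard_waiting_add_one, ih, Int.even_add_one]; tauto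
  | pred n ih =>
    have := hm.even_ncard_waiting_add_one (-(n : ℤ) - 1)
    rw [sub_add_cancel, ih] at this
    have h2 : Even (-(n : ℤ)) ↔ ¬ Even (-(n : ℤ) - 1) := by
      rw [← Int.even_add_one, sub_add_cancel]
    tauto

/-- The matching `m` after a translation of time by `k`. -/
def translate (k : ℤ) (m : ℤ → ℤ) : ℤ → ℤ := fun n => m (n + k) - k

theorem translate_translate (k l : ℤ) (m : ℤ → ℤ) :
    translate k (translate l m) = translate (k + l) m := by
  funext n
  simp only [translate]
  rw [add_assoc, sub_sub, add_comm l k]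

theorem translate_zero (m : ℤ → ℤ) : translate 0 m = m := by
  funext n; simp [translate]

theorem waiting_translate (k : ℤ) (m : ℤ → ℤ) (n : ℤ) :
    waiting (translate k m) n = (fun j => j + k) ⁻¹' waiting m (n + k) := by
  ext j
  simp only [waiting, translate, Set.mem_ofPred_eq, Set.mem_preimage]
  omega

theorem waiting_translate_eq_image (k : ℤ) (m : ℤ → ℤ) (n : ℤ) :
    waiting (translate k m) n = (fun j => j + -k) '' waiting m (n + k) := by
  rw [waiting_translate]
  ext j
  simp only [Set.mem_preimage, Set.mem_image]
  constructor
  · intro h; exact ⟨j + k, h, by ring⟩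
  · rintro ⟨i, hi, rfl⟩
    simpa using hi

theorem waiting_translate_eq_empty_iff (k : ℤ) (m : ℤ → ℤ) (n : ℤ) :
    waiting (translate k m) n = ∅ ↔ waiting m (n + k) = ∅ := by
  rw [waiting_translate_eq_image, Set.image_eq_empty]

theorem ncard_waiting_translate (k : ℤ) (m : ℤ → ℤ) (n : ℤ) :
    (waiting (translate k m) n).ncard = (waiting m (n + k)).ncard := by
  rw [waiting_translate_eq_image]
  exact Set.ncard_image_of_injective _ (add_left_injective (-k))

theorem IsPerfectMatching.translate {x : ℤ → Arrival G} {m : ℤ → ℤ}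
    (hm : IsPerfectMatching φ x m) (k : ℤ) :
    IsPerfectMatching φ (shiftBy k x) (translate k m) := by
  refine ⟨fun n => ?_, fun n h => ?_, fun n => ?_, fun n => ?_⟩
  · simp [GeneralMatching.translate, hm.involutive]
  · exact hm.ne_self (n + k) (by simp only [GeneralMatching.translate] at h; omega)
  · simpa [GeneralMatching.translate, shiftBy] using hm.compatible (n + k)
  · obtain ⟨b, h1, h2, h3, h4⟩ := hm.follows_policy (n + k)
    refine ⟨b.map fun j => j + -k, ?_, fun j => ?_, ?_, ?_⟩
    · rw [List.pairwise_map]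
      exact h1.imp fun h => by omega
    · rw [waiting_translate_eq_image, List.mem_map, Set.mem_image]
      simp only [h2]
    · intro h
      rw [List.getElem?_map]
      have := h3 (by simpa [shiftBy] using h)
      simp only [List.map_map, Function.comp_def, shiftBy, neg_add_cancel_right]
      rw [this]; rfl
    · intro h
      have := h4 (by simpa [shiftBy] using h)
      simp only [GeneralMatching.translate]; omega

end ItemRuns

end GeneralMatching

namespace GeneralMatching

theorem shiftBy_zero {α : Type*} (x : ℤ → α) : shiftBy 0 x = x := by
  funext n; simp [shiftBy]

/-! ### Measure-preserving shifts -/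

section Shift

variable {α : Type*} [MeasurableSpace α]

theorem measurable_shiftBy (k : ℤ) : Measurable (shiftBy k : (ℤ → α) → ℤ → α) :=
  measurable_pi_lambda _ fun n => measurable_pi_apply (n + k)

/-- The shift by `k`, as a measurable equivalence. -/
def shiftEquiv (k : ℤ) : (ℤ → α) ≃ᵐ (ℤ → α) where
  toFun := shiftBy k
  invFun := shiftBy (-k)
  left_inv x := by rw [shiftBy_shiftBy, neg_add_cancel, shiftBy_zero]
  right_inv x := by rw [shiftBy_shiftBy, add_neg_cancel, shiftBy_zero]
  measurable_toFun := measurable_shiftBy k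
  measurable_invFun := measurable_shiftBy (-k)

theorem measurePreserving_shiftBy {P : Measure (ℤ → α)}
    (hP : MeasurePreserving (shiftBy 1) P P) (k : ℤ) : MeasurePreserving (shiftBy k) P P := by
  have hneg : MeasurePreserving (shiftBy (-1)) P P := hP.symm (shiftEquiv 1)
  have hadd : ∀ {k l : ℤ}, MeasurePreserving (shiftBy k) P P →
      MeasurePreserving (shiftBy l) P P → MeasurePreserving (shiftBy (k + l)) P P := by
    intro k l hk hl
    have := hk.comp hl
    convert this using 1
    funext x
    exact (shiftBy_shiftBy k l x).symm
  induction k using Int.induction_on with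
  | zero =>
    convert MeasurePreserving.id P using 1
    funext x; exact shiftBy_zero x
  | succ n ih => exact hadd ih hP
  | pred n ih => exact hadd ih hneg

/-- The shift is a measurable equivalence, so no measurability of `A` is needed; the exceptional
events below can be shifted freely. -/
theorem measure_preimage_shiftBy {P : Measure (ℤ → α)}
    (hP : MeasurePreserving (shiftBy 1) P P) (k : ℤ) (A : Set (ℤ → α)) :
    P (shiftBy k ⁻¹' A) = P A :=
  (measurePreserving_shiftBy hP k).measure_preimage_equiv (f := shiftEquiv k) A

theorem ae_shiftBy {P : Measure (ℤ → α)} (hP : MeasurePreserving (shiftBy 1) P P) (k : ℤ)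
    {p : (ℤ → α) → Prop} (h : ∀ᵐ x ∂P, p x) : ∀ᵐ x ∂P, p (shiftBy k x) :=
  (measurePreserving_shiftBy hP k).quasiMeasurePreserving.ae h

end Shift

/-! ### Events depending on finitely many coordinates -/

section FiniteDependence

variable {α : Type*} [MeasurableSpace α] [Finite α] [DiscreteMeasurableSpace α]

/-- Over a finite alphabet such an event is a finite union of elementary cylinders. The σ-algebra of
the coordinates in `I` is kept explicit for the independence arguments. -/
theorem measurableSet_iSup_of_dependsOn (I : Finset ℤ) (A : Set (ℤ → α))
    (hA : ∀ x y : ℤ → α, (∀ n ∈ I, x n = y n) → (x ∈ A ↔ y ∈ A)) :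
    MeasurableSet[⨆ n ∈ (I : Set ℤ),
      MeasurableSpace.comap (fun x : ℤ → α => x n) inferInstance] A := by
  have hEq : A = ⋃ (f : I → α) (_ : ∃ y ∈ A, ∀ n : I, y n = f n),
      ⋂ n : I, (fun x : ℤ → α => x n) ⁻¹' {f n} := by
    ext x
    simp only [Set.mem_iUnion, Set.mem_iInter, Set.mem_preimage, Set.mem_singleton_iff,
      exists_prop]
    constructor
    · exact fun hx => ⟨fun n => x n, ⟨x, hx, fun _ => rfl⟩, fun _ => rfl⟩
    · rintro ⟨f, ⟨y, hy, hyf⟩, hxf⟩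
      exact (hA x y fun n hn => by rw [hxf ⟨n, hn⟩, hyf ⟨n, hn⟩]).2 hy
  rw [hEq]
  refine MeasurableSet.iUnion fun f => MeasurableSet.iUnion fun _ => MeasurableSet.iInter fun n => ?_
  have hle : MeasurableSpace.comap (fun x : ℤ → α => x n) inferInstance ≤
      ⨆ n ∈ (I : Set ℤ), MeasurableSpace.comap (fun x : ℤ → α => x n) inferInstance :=
    le_iSup₂_of_le (n : ℤ) n.2 le_rfl
  exact hle _ ⟨{f n}, MeasurableSet.of_discrete, rfl⟩

theorem measurableSet_of_dependsOn (I : Finset ℤ) (A : Set (ℤ → α))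
    (hA : ∀ x y : ℤ → α, (∀ n ∈ I, x n = y n) → (x ∈ A ↔ y ∈ A)) : MeasurableSet A := by
  have hle : (⨆ n ∈ (I : Set ℤ), MeasurableSpace.comap (fun x : ℤ → α => x n) inferInstance) ≤
      (MeasurableSpace.pi : MeasurableSpace (ℤ → α)) :=
    iSup₂_le fun n _ => (measurable_pi_apply n).comap_le
  exact hle _ (measurableSet_iSup_of_dependsOn I A hA)

end FiniteDependence

/-! ### Borel–Cantelli and Fatou estimates for sequences of events -/

section Sequences

variable {α : Type*} [MeasurableSpace α] {P : Measure α}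

/-- Fatou for sets: continuity from below along the increasing intersections of tails, valid without
measurability of the `B i`. -/
theorem measure_setOf_eventually_le {B : ℕ → Set α} {ε : ℝ≥0∞}
    (h : ∀ᶠ i in atTop, P (B i) ≤ ε) : P {x | ∀ᶠ i in atTop, x ∈ B i} ≤ ε := by
  have hEq : {x | ∀ᶠ i in atTop, x ∈ B i} = ⋃ I : ℕ, ⋂ i ≥ I, B i := by
    ext x; simp [eventually_atTop]
  have hmono : Monotone fun I : ℕ => ⋂ i ≥ I, B i := by
    intro I J hIJ x hx
    simp only [Set.mem_iInter] at hx ⊢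
    exact fun i hi => hx i (le_trans hIJ hi)
  rw [hEq, hmono.measure_iUnion]
  refine iSup_le fun I => ?_
  obtain ⟨i, hi, hle⟩ := ((eventually_ge_atTop I).and h).exists
  exact (measure_mono (Set.biInter_subset_of_mem (show i ∈ {i | i ≥ I} from hi))).trans hle

theorem ae_frequently_notMem {B : ℕ → Set α} (h : Tendsto (fun i => P (B i)) atTop (𝓝 0)) :
    ∀ᵐ x ∂P, ∃ᶠ i in atTop, x ∉ B i := by
  rw [ae_iff]
  have hEq : {x | ¬ ∃ᶠ i in atTop, x ∉ B i} = {x | ∀ᶠ i in atTop, x ∈ B i} := by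
    ext x; simp [Filter.Frequently]
  rw [hEq]
  refine le_antisymm (le_of_forall_pos_le_add fun ε hε => ?_) bot_le
  rw [zero_add]
  exact measure_setOf_eventually_le (h.eventually_le_const hε)

theorem ae_eventually_notMem_of_eventually_le {B : ℕ → Set α}
    (h : ∀ᶠ i in atTop, P (B i) ≤ (1 / 2 : ℝ≥0∞) ^ i) : ∀ᵐ x ∂P, ∀ᶠ i in atTop, x ∉ B i := by
  obtain ⟨I, hI⟩ := eventually_atTop.1 h
  have hsum : ∑' i, P (B (i + I)) ≠ ∞ := by
    refine ne_top_of_le_ne_top ?_ (ENNReal.tsum_le_tsum fun i =>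
      (hI (i + I) (by omega)).trans (pow_le_pow_of_le_one (by simp) (by simp) (Nat.le_add_right i I)))
    rw [ENNReal.tsum_geometric]
    simp
  filter_upwards [ae_eventually_notMem hsum] with x hx
  obtain ⟨J, hJ⟩ := eventually_atTop.1 hx
  refine eventually_atTop.2 ⟨J + I, fun i hi => ?_⟩
  obtain ⟨j, rfl⟩ : ∃ j, i = j + I := ⟨i - I, by omega⟩
  exact hJ j (by omega)

theorem tendsto_measure_compl_of_monotone [IsFiniteMeasure P] {E : ℕ → Set α}
    (hE : ∀ m, MeasurableSet (E m)) (hmono : Monotone E) (h : ∀ᵐ x ∂P, ∃ m, x ∈ E m) :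
    Tendsto (fun m => P (E m)ᶜ) atTop (𝓝 0) := by
  have h0 : P (⋂ m, (E m)ᶜ) = 0 := by
    rw [← Set.compl_iUnion]
    rw [ae_iff] at h
    convert h using 2
    ext x; simp
  rw [← h0]
  exact tendsto_measure_iInter_atTop (fun m => (hE m).compl.nullMeasurableSet)
    (fun _ _ h => Set.compl_subset_compl.2 (hmono h)) ⟨0, measure_ne_top _ _⟩

end Sequences

/-! ### Runs over a window depend only on the arrivals in it -/

section Dependence

variable {V : Type*} {G : SimpleGraph V} (φ : MatchingPolicy G)

theorem wordRun_congr {x y : ℤ → Arrival G} {s : ℤ} {j : ℕ}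
    (h : ∀ n, s ≤ n → n < s + j → x n = y n) (w : List V) :
    wordRun φ x s j w = wordRun φ y s j w := by
  have : arrivals x s j = arrivals y s j := by
    refine List.map_congr_left fun i hi => ?_
    rw [List.mem_range] at hi
    exact h _ (by omega) (by omega)
  rw [wordRun, this, wordRun]

theorem le_of_mem_itemRun {x : ℤ → Arrival G} {s : ℤ} {j : ℕ} {k : ℤ}
    (h : k ∈ itemRun φ x s j) : s ≤ k := by
  induction j with
  | zero => simp [itemRun] at h
  | succ j ih =>
    rw [itemRun] at h
    rcases (isBuffer_itemRun φ x s j).selected_cases φ with ⟨i, -, -, -, -, -, hi⟩ | ⟨-, -, hi⟩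
    · exact ih ((hi k).1 h).1
    · rw [hi, List.mem_append, List.mem_singleton] at h
      rcases h with h | rfl
      · exact ih h
      · omega

theorem exists_adj_congr {x y : ℤ → Arrival G} {b : List ℤ} {n : ℤ}
    (hb : ∀ k ∈ b, x k = y k) (hn : x n = y n) :
    (∃ k ∈ b, G.Adj (x n).1 (x k).1) ↔ ∃ k ∈ b, G.Adj (y n).1 (y k).1 := by
  refine exists_congr fun k => and_congr_right fun hk => ?_
  rw [hb k hk, hn]

theorem selected_congr {x y : ℤ → Arrival G} {b : List ℤ} {n : ℤ}
    (hb : ∀ k ∈ b, x k = y k) (hn : x n = y n) : selected φ x b n = selected φ y b n := by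
  have hmap : b.map (fun k => (x k).1) = b.map fun k => (y k).1 :=
    List.map_congr_left fun k hk => by rw [hb k hk]
  have hex := exists_adj_congr (G := G) hb hn
  unfold selected
  by_cases h : ∃ k ∈ b, G.Adj (x n).1 (x k).1
  · rw [if_pos h, if_pos (hex.1 h), hmap, hn]
  · rw [if_neg h, if_neg fun h' => h (hex.2 h')]

theorem itemNext_congr {x y : ℤ → Arrival G} {b : List ℤ} {n : ℤ}
    (hb : ∀ k ∈ b, x k = y k) (hn : x n = y n) : itemNext φ x b n = itemNext φ y b n := by
  have hmap : b.map (fun k => (x k).1) = b.map fun k => (y k).1 :=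
    List.map_congr_left fun k hk => by rw [hb k hk]
  have hex := exists_adj_congr (G := G) hb hn
  unfold itemNext
  by_cases h : ∃ k ∈ b, G.Adj (x n).1 (x k).1
  · rw [if_pos h, if_pos (hex.1 h), hmap, hn]
  · rw [if_neg h, if_neg fun h' => h (hex.2 h')]

theorem itemRun_congr {x y : ℤ → Arrival G} {s : ℤ} {j : ℕ}
    (h : ∀ n, s ≤ n → n < s + j → x n = y n) : itemRun φ x s j = itemRun φ y s j := by
  induction j with
  | zero => rfl
  | succ j ih =>
    have h' := ih fun n h1 h2 => h n h1 (by push_cast; omega)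
    rw [itemRun, itemRun, ← h']
    refine itemNext_congr φ (fun k hk => h k (le_of_mem_itemRun φ hk) ?_)
      (h _ (by omega) (by push_cast; omega))
    have := (isBuffer_itemRun φ x s j).lt k hk
    push_cast; omega

theorem selected_itemsAt_congr {x y : ℤ → Arrival G} {s n : ℤ}
    (h : ∀ k, s ≤ k → k ≤ n → x k = y k) :
    selected φ x (itemsAt φ x s n) n = selected φ y (itemsAt φ y s n) n := by
  rcases lt_or_ge n s with hn | hn
  · simp only [itemsAt]
    rw [show (n - s).toNat = 0 by omega]
    simp [itemRun, selected]
  · have heq : itemsAt φ x s n = itemsAt φ y s n :=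
      itemRun_congr φ fun k h1 h2 => h k h1 (by omega)
    rw [← heq]
    refine selected_congr φ (fun k hk => h k (le_of_mem_itemRun φ hk) ?_) (h n hn le_rfl)
    exact ((isBuffer_itemsAt hn).lt k hk).le

variable [Finite V] [MeasurableSpace V] [DiscreteMeasurableSpace V]

theorem measurableSet_matchedFrom (s n k : ℤ) :
    MeasurableSet {x : ℤ → Arrival G | MatchedFrom φ x s n k} := by
  refine measurableSet_of_dependsOn (Finset.Icc s (max n k)) _ fun x y h => ?_
  have hx : ∀ m, s ≤ m → m ≤ max n k → x m = y m := fun m h1 h2 => h m (Finset.mem_Icc.2 ⟨h1, h2⟩)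
  change MatchedFrom φ x s n k ↔ MatchedFrom φ y s n k
  unfold MatchedFrom
  rw [selected_itemsAt_congr φ fun m h1 h2 => hx m h1 (by omega),
    selected_itemsAt_congr (n := k) φ fun m h1 h2 => hx m h1 (by omega)]

/-- The predicate bears on the whole map from initial words to final words, so that it can involve
two runs at once. -/
theorem measurableSet_wordRun (s : ℤ) (j : ℕ) (p : (List V → List V) → Prop) :
    MeasurableSet {x : ℤ → Arrival G | p (wordRun φ x s j)} := by
  refine measurableSet_of_dependsOn (Finset.Ico s (s + j)) _ fun x y h => ?_
  have : wordRun φ x s j = wordRun φ y s j := funext fun w =>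
    wordRun_congr φ (fun n h1 h2 => h n (Finset.mem_Ico.2 ⟨h1, h2⟩)) w
  change p _ ↔ p _
  rw [this]

end Dependence

end GeneralMatching

namespace GeneralMatching

/-! ### Coupling from the past and the limit matching -/

section Coupling

variable {V : Type*} {G : SimpleGraph V} (φ : MatchingPolicy G)

/-- The systems started empty at times `s` and `s'` are simultaneously empty at some time
before `N`. -/
def Coupled (x : ℤ → Arrival G) (s s' N : ℤ) : Prop :=
  ∃ l ≤ N, Empties φ x s l ∧ Empties φ x s' l

/-- Within the first `m` pairs of arrivals, the system started empty at time `0` is empty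
simultaneously with the system started with any word of even length at most `r`. -/
def CouplesWithin (r m : ℕ) (x : ℤ → Arrival G) : Prop :=
  ∀ w ∈ admissibleWords G, Even w.length → w.length ≤ r →
    ∃ l ≤ m, wordRun φ x 0 (2 * l) w = [] ∧ wordRun φ x 0 (2 * l) [] = []

/-- Almost surely, the system started empty at time `0` is at some time empty simultaneously with
the system started with any given word of even length. -/
def AlmostSurelyCouples [MeasurableSpace V] (P : Measure (ℤ → Arrival G)) : Prop :=
  ∀ᵐ x ∂P, ∀ w ∈ admissibleWords G, Even w.length →
    ∃ l : ℕ, wordRun φ x 0 (2 * l) w = [] ∧ wordRun φ x 0 (2 * l) [] = []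

/-- The laws of the lengths of the queue details in the system started empty are tight. -/
def TightLengths [MeasurableSpace V] (P : Measure (ℤ → Arrival G)) : Prop :=
  ∀ ε : ℝ≥0∞, 0 < ε → ∃ r : ℕ, ∀ k : ℕ, P {x | r < (wordRun φ x 0 (2 * k) []).length} ≤ ε

theorem tendsto_neg_two_mul_atBot {k : ℕ → ℕ} (hk : StrictMono k) :
    Tendsto (fun i => -2 * (k i : ℤ)) atTop atBot := by
  rw [tendsto_atBot]
  intro b
  filter_upwards [eventually_ge_atTop b.natAbs] with i hi
  have := hk.id_le i
  simp only [id] at this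
  omega

/-- The sequences of arrivals for which the systems started empty at the times `-2 * k i`
converge. -/
structure IsGood (k : ℕ → ℕ) (x : ℤ → Arrival G) : Prop where
  coupled : ∀ N : ℤ, ∀ᶠ i in atTop, Coupled φ x (-2 * (k i : ℤ)) (-2 * (k (i + 1) : ℤ)) N
  pos : ∀ N : ℤ, ∃ l ≥ N, ∃ᶠ i in atTop, Empties φ x (-2 * (k i : ℤ)) l
  neg : ∀ N : ℤ, ∃ l ≤ N, ∃ᶠ i in atTop, Empties φ x (-2 * (k i : ℤ)) l

open Classical in
/-- The limit of the matchings in the systems started empty at the times `-2 * k i`. -/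
noncomputable def limitMatching (k : ℕ → ℕ) (x : ℤ → Arrival G) : ℤ → ℤ :=
  fun n => if h : ∃! j, ∀ᶠ i in atTop, MatchedFrom φ x (-2 * (k i : ℤ)) n j then h.choose else 0

variable {φ}

theorem IsGood.exists_isPerfectMatching {k : ℕ → ℕ} (hk : StrictMono k) {x : ℤ → Arrival G}
    (hx : IsGood φ k x) :
    ∃ m : ℤ → ℤ, IsPerfectMatching φ x m ∧
      (∀ n, waiting m n = ∅ ↔ ∀ᶠ i in atTop, Empties φ x (-2 * (k i : ℤ)) n) ∧
      (∀ n, waiting m n = ∅ ↔ ∃ᶠ i in atTop, Empties φ x (-2 * (k i : ℤ)) n) ∧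
      (∀ n j, m n = j ↔ ∀ᶠ i in atTop, MatchedFrom φ x (-2 * (k i : ℤ)) n j) :=
  exists_isPerfectMatching_of_coupling (s := fun i => -2 * (k i : ℤ))
    (tendsto_neg_two_mul_atBot hk) hx.coupled hx.pos

theorem IsGood.limitMatching_spec {k : ℕ → ℕ} (hk : StrictMono k) {x : ℤ → Arrival G}
    (hx : IsGood φ k x) :
    IsPerfectMatching φ x (limitMatching φ k x) ∧
      (∀ n, waiting (limitMatching φ k x) n = ∅ ↔
        ∀ᶠ i in atTop, Empties φ x (-2 * (k i : ℤ)) n) ∧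
      (∀ n, waiting (limitMatching φ k x) n = ∅ ↔
        ∃ᶠ i in atTop, Empties φ x (-2 * (k i : ℤ)) n) := by
  obtain ⟨m, h1, h2, h3, h4⟩ := hx.exists_isPerfectMatching hk
  have : limitMatching φ k x = m := by
    funext n
    have hex : ∃! j, ∀ᶠ i in atTop, MatchedFrom φ x (-2 * (k i : ℤ)) n j :=
      ⟨m n, (h4 n (m n)).1 rfl, fun j hj => ((h4 n j).2 hj).symm⟩
    have h' : limitMatching φ k x n = hex.choose := dif_pos hex
    rw [h']
    exact ((h4 n _).2 hex.choose_spec.1).symm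
  rw [this]
  exact ⟨h1, h2, h3⟩

theorem IsGood.emptiesAt_even {k : ℕ → ℕ} (hk : StrictMono k) {x : ℤ → Arrival G}
    (hx : IsGood φ k x) : EmptiesAt Even (limitMatching φ k x) := by
  obtain ⟨-, h2, h3⟩ := hx.limitMatching_spec hk
  refine ⟨fun n hn => ?_, fun N => ?_, fun N => ?_⟩
  · obtain ⟨i, hi⟩ := ((h2 n).1 hn).exists
    have := hi.even
    rw [Int.even_sub] at this
    exact this.2 ⟨-(k i : ℤ), by ring⟩
  · obtain ⟨l, hl, h⟩ := hx.pos N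
    exact ⟨l, hl, (h3 l).2 h⟩
  · obtain ⟨l, hl, h⟩ := hx.neg N
    exact ⟨l, hl, (h3 l).2 h⟩

variable [Finite V] [MeasurableSpace V] [DiscreteMeasurableSpace V]
  {P : Measure (ℤ → Arrival G)} [IsProbabilityMeasure P]

theorem measurableSet_couplesWithin (r m : ℕ) :
    MeasurableSet {x : ℤ → Arrival G | CouplesWithin φ r m x} := by
  have : {x : ℤ → Arrival G | CouplesWithin φ r m x} =
      ⋂ (w : List V) (_ : w ∈ admissibleWords G ∧ Even w.length ∧ w.length ≤ r),
        ⋃ (l : ℕ) (_ : l ≤ m), {x | wordRun φ x 0 (2 * l) w = [] ∧ wordRun φ x 0 (2 * l) [] = []} := by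
    ext x
    simp only [CouplesWithin, Set.mem_ofPred_eq, Set.mem_iInter, Set.mem_iUnion, exists_prop]
    exact ⟨fun h w hw => h w hw.1 hw.2.1 hw.2.2, fun h w h1 h2 h3 => h w ⟨h1, h2, h3⟩⟩
  rw [this]
  exact MeasurableSet.iInter fun w => MeasurableSet.iInter fun _ =>
    MeasurableSet.iUnion fun l => MeasurableSet.iUnion fun _ =>
      measurableSet_wordRun φ 0 (2 * l) fun f => f w = [] ∧ f [] = []

/-- There are finitely many words of length at most `r`, so almost surely their coupling times have
a finite maximum. -/
theorem tendsto_measure_not_couplesWithin (h1 : AlmostSurelyCouples φ P) (r : ℕ) :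
    Tendsto (fun m => P {x | CouplesWithin φ r m x}ᶜ) atTop (𝓝 0) := by
  refine tendsto_measure_compl_of_monotone (measurableSet_couplesWithin r) ?_ ?_
  · intro m m' hm x hx w h1 h2 h3
    obtain ⟨l, hl, h⟩ := hx w h1 h2 h3
    exact ⟨l, hl.trans hm, h⟩
  · filter_upwards [h1] with x hx
    have hfin : {w : List V | w.length ≤ r}.Finite := List.finite_length_le V r
    have : ∀ᶠ m : ℕ in atTop, ∀ w ∈ {w : List V | w.length ≤ r}, w ∈ admissibleWords G →
        Even w.length → ∃ l ≤ m, wordRun φ x 0 (2 * l) w = [] ∧ wordRun φ x 0 (2 * l) [] = [] := by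
      rw [Filter.eventually_all_finite hfin]
      intro w hwr
      by_cases hw : w ∈ admissibleWords G ∧ Even w.length
      · obtain ⟨l, hl⟩ := hx w hw.1 hw.2
        filter_upwards [eventually_ge_atTop l] with m hm _ _
        exact ⟨l, hm, hl⟩
      · exact Eventually.of_forall fun m h1 h2 => absurd ⟨h1, h2⟩ hw
    obtain ⟨m, hm⟩ := this.exists
    exact ⟨m, fun w h1 h2 h3 => hm w h3 h1 h2⟩

/-- By tightness the run from `s - 2 * d` has, up to probability `ε / 2`, length at most `r` at time
`s`; from there it couples within `m` pairs up to another `ε / 2`. The essential point is that `m`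
depends on neither `s` nor `d`. -/
theorem measure_not_coupled_le (hP : MeasurePreserving (shiftBy 1) P P)
    (h1 : AlmostSurelyCouples φ P) (h2 : TightLengths φ P) {ε : ℝ≥0∞} (hε : 0 < ε) :
    ∃ m₀ : ℕ, ∀ m ≥ m₀, ∀ (s : ℤ) (d : ℕ),
      P {x | ¬ ∃ l : ℕ, l ≤ m ∧ Empties φ x s (s + 2 * l) ∧
        Empties φ x (s - 2 * d) (s + 2 * l)} ≤ ε := by
  obtain ⟨r, hr⟩ := h2 (ε / 2) (ENNReal.half_pos hε.ne')
  obtain ⟨m₀, hm₀⟩ := eventually_atTop.1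
    ((tendsto_measure_not_couplesWithin h1 r).eventually_le_const (ENNReal.half_pos hε.ne'))
  refine ⟨m₀, fun m hm s d => ?_⟩
  have hsub : {x : ℤ → Arrival G | ¬ ∃ l : ℕ, l ≤ m ∧ Empties φ x s (s + 2 * l) ∧
      Empties φ x (s - 2 * d) (s + 2 * l)} ⊆
      shiftBy (s - 2 * d) ⁻¹' {x | r < (wordRun φ x 0 (2 * d) []).length} ∪
        shiftBy s ⁻¹' {x | CouplesWithin φ r m x}ᶜ := by
    intro x hx
    by_contra hcon
    simp only [Set.mem_union, Set.mem_preimage, Set.mem_compl_iff, Set.mem_ofPred_eq, not_or,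
      not_lt, not_not, wordRun_shiftBy, zero_add] at hcon
    obtain ⟨hlen, hc⟩ := hcon
    refine hx ?_
    have hw := wordRun_mem_admissibleWords φ x (s - 2 * d) (2 * d) nil_mem_admissibleWords
    have he := (even_length_wordRun φ x (s - 2 * d) d nil_mem_admissibleWords).2 (by simp)
    obtain ⟨l, hl, h3, h4⟩ := hc _ hw he hlen
    rw [wordRun_shiftBy, zero_add] at h3 h4
    refine ⟨l, hl, ⟨2 * l, by push_cast; ring, h4⟩, ⟨2 * d + 2 * l, by push_cast; ring, ?_⟩⟩
    rw [wordRun_add]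
    push_cast
    rwa [sub_add_cancel]
  calc _ ≤ _ := measure_mono hsub
    _ ≤ _ := measure_union_le _ _
    _ ≤ ε / 2 + ε / 2 := by
      rw [measure_preimage_shiftBy hP, measure_preimage_shiftBy hP]
      exact add_le_add (hr d) (hm₀ m hm)
    _ = ε := ENNReal.add_halves ε

theorem exists_strictMono_coupled (hP : MeasurePreserving (shiftBy 1) P P)
    (h1 : AlmostSurelyCouples φ P) (h2 : TightLengths φ P) :
    ∃ k : ℕ → ℕ, StrictMono k ∧ ∀ N c : ℤ, ∀ᶠ i in atTop, ∀ d : ℕ,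
      P {x | ¬ Coupled φ x (-2 * (k i : ℤ) + 2 * c) (-2 * (k i : ℤ) + 2 * c - 2 * d) N} ≤
        (1 / 2 : ℝ≥0∞) ^ i := by
  choose m hm using fun i : ℕ => measure_not_coupled_le hP h1 h2 (ε := (1 / 2 : ℝ≥0∞) ^ i)
    (ENNReal.pow_pos (by simp) i)
  -- The sum makes `k i` at least `i + m i`: a coupling within `m i` pairs of the start is over by
  -- time `-2 * i + 2 * c`, hence before `N` once `i` is large. The summand `i` also makes `k`
  -- strictly increasing.
  refine ⟨fun i => i + ∑ j ∈ Finset.range (i + 1), m j, ?_, fun N c => ?_⟩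
  · refine strictMono_nat_of_lt_succ fun i => ?_
    rw [Finset.sum_range_succ _ (i + 1)]
    omega
  · filter_upwards [eventually_ge_atTop (N.natAbs + c.natAbs)] with i hi d
    have hmi : m i ≤ ∑ j ∈ Finset.range (i + 1), m j :=
      Finset.single_le_sum (fun _ _ => Nat.zero_le _) (Finset.mem_range.2 (Nat.lt_succ_self i))
    set K := i + ∑ j ∈ Finset.range (i + 1), m j
    refine le_trans (measure_mono ?_) (hm i (m i) le_rfl (-2 * (K : ℤ) + 2 * c) d)
    intro x hx hcon
    obtain ⟨l, hl, h3, h4⟩ := hcon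
    exact hx ⟨_, by omega, h3, h4⟩

/-- The run from far back is empty somewhere in the window up to probability `ε`, because it couples
with the run started at `2 * N`. Fatou gives this for infinitely many `i`, and the finite window
contains one time that serves infinitely often. As `m` does not depend on `N`, the window can be
moved towards both infinities. -/
theorem measure_setOf_not_frequently_empties_le (hP : MeasurePreserving (shiftBy 1) P P)
    (h1 : AlmostSurelyCouples φ P) (h2 : TightLengths φ P) {k : ℕ → ℕ} (hk : StrictMono k)
    {ε : ℝ≥0∞} (hε : 0 < ε) :
    ∃ m : ℕ, ∀ N : ℤ, P {x | ¬ ∃ l, 2 * N ≤ l ∧ l ≤ 2 * N + 2 * m ∧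
      ∃ᶠ i in atTop, Empties φ x (-2 * (k i : ℤ)) l} ≤ ε := by
  obtain ⟨m, hm⟩ := measure_not_coupled_le hP h1 h2 hε
  refine ⟨m, fun N => ?_⟩
  have hle : ∀ᶠ i in atTop, P {x | ¬ ∃ l : ℤ, 2 * N ≤ l ∧ l ≤ 2 * N + 2 * m ∧
      Empties φ x (-2 * (k i : ℤ)) l} ≤ ε := by
    filter_upwards [(tendsto_neg_two_mul_atBot hk).eventually (eventually_le_atBot (2 * N))] with i hi
    obtain ⟨d, hd⟩ : ∃ d : ℕ, (d : ℤ) = N + k i := ⟨(N + k i).toNat, by omega⟩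
    refine le_trans (measure_mono ?_) (hm m le_rfl (2 * N) d)
    rintro x hx ⟨l, hl, h3, h4⟩
    refine hx ⟨2 * N + 2 * l, by omega, by omega, ?_⟩
    convert h4 using 1
    rw [hd]; ring
  refine le_trans (measure_mono ?_) (measure_setOf_eventually_le hle)
  intro x hx
  by_contra hcon
  refine hx ?_
  have hfr : ∃ᶠ i in atTop, ∃ l ∈ Set.Icc (2 * N) (2 * N + 2 * m),
      Empties φ x (-2 * (k i : ℤ)) l := by
    intro h
    refine hcon ?_
    filter_upwards [h] with i hi ⟨l, h3, h4, h5⟩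
    exact hi ⟨l, ⟨h3, h4⟩, h5⟩
  by_contra hcon'
  refine hfr ?_
  have : ∀ l ∈ Set.Icc (2 * N) (2 * N + 2 * m), ∀ᶠ i in atTop,
      ¬ Empties φ x (-2 * (k i : ℤ)) l := by
    intro l hl
    by_contra h
    exact hcon' ⟨l, hl.1, hl.2, h⟩
  filter_upwards [(Filter.eventually_all_finite (Set.finite_Icc _ _)).2 this] with i hi ⟨l, hl, h⟩
  exact hi l hl h

theorem ae_isGood (hP : MeasurePreserving (shiftBy 1) P P)
    (h1 : AlmostSurelyCouples φ P) (h2 : TightLengths φ P) {k : ℕ → ℕ} (hk : StrictMono k)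
    (hkc : ∀ N c : ℤ, ∀ᶠ i in atTop, ∀ d : ℕ,
      P {x | ¬ Coupled φ x (-2 * (k i : ℤ) + 2 * c) (-2 * (k i : ℤ) + 2 * c - 2 * d) N} ≤
        (1 / 2 : ℝ≥0∞) ^ i) :
    ∀ᵐ x ∂P, IsGood φ k x := by
  have hcoup : ∀ᵐ x ∂P, ∀ N : ℤ, ∀ᶠ i in atTop,
      Coupled φ x (-2 * (k i : ℤ)) (-2 * (k (i + 1) : ℤ)) N := by
    rw [ae_all_iff]
    intro N
    have := ae_eventually_notMem_of_eventually_le (P := P)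
      (B := fun i => {x | ¬ Coupled φ x (-2 * (k i : ℤ)) (-2 * (k (i + 1) : ℤ)) N}) (by
        filter_upwards [hkc N 0] with i hi
        have hlt := hk (Nat.lt_succ_self i)
        convert hi (k (i + 1) - k i) using 6
        · ring
        · push_cast [hlt.le]; ring)
    filter_upwards [this] with x hx
    filter_upwards [hx] with i hi
    simpa using hi
  -- The predicate `p` covers both directions; `ε` is arbitrary because a window of any length fits
  -- into the half-line prescribed by `p N`.
  have aux : ∀ p : ℤ → ℤ → Prop,
      (∀ (N : ℤ) (m : ℕ), ∃ N' : ℤ, ∀ l, 2 * N' ≤ l → l ≤ 2 * N' + 2 * m → p N l) →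
      ∀ᵐ x ∂P, ∀ N, ∃ l, p N l ∧ ∃ᶠ i in atTop, Empties φ x (-2 * (k i : ℤ)) l := by
    intro p hp
    rw [ae_all_iff]
    intro N
    rw [ae_iff]
    refine le_antisymm (le_of_forall_pos_le_add fun ε hε => ?_) bot_le
    obtain ⟨m, hm⟩ := measure_setOf_not_frequently_empties_le hP h1 h2 hk hε
    obtain ⟨N', hN'⟩ := hp N m
    rw [zero_add]
    refine le_trans (measure_mono ?_) (hm N')
    rintro x hx ⟨l, h3, h4, h5⟩
    exact hx ⟨l, hN' l h3 h4, h5⟩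
  filter_upwards [hcoup,
    aux (fun N l => l ≥ N) fun N m => ⟨N.natAbs, fun l h _ => by omega⟩,
    aux (fun N l => l ≤ N) fun N m =>
      ⟨-(N.natAbs + m : ℤ), fun l _ h => by omega⟩] with x h3 h4 h5
  exact ⟨h3, h4, h5⟩

theorem measurable_limitMatching (k : ℕ → ℕ) : Measurable (limitMatching φ k) := by
  refine measurable_pi_lambda _ fun n => measurable_to_countable' fun j => ?_
  have hA : ∀ j, MeasurableSet {x : ℤ → Arrival G | ∀ᶠ i in atTop,
      MatchedFrom φ x (-2 * (k i : ℤ)) n j} := by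
    intro j
    have : {x : ℤ → Arrival G | ∀ᶠ i in atTop, MatchedFrom φ x (-2 * (k i : ℤ)) n j} =
        ⋃ I : ℕ, ⋂ i : ℕ, ⋂ _ : I ≤ i, {x | MatchedFrom φ x (-2 * (k i : ℤ)) n j} := by
      ext x; simp [eventually_atTop]
    rw [this]
    exact MeasurableSet.iUnion fun I => MeasurableSet.iInter fun i => MeasurableSet.iInter fun _ =>
      measurableSet_matchedFrom φ _ n j
  set A := fun j => {x : ℤ → Arrival G | ∀ᶠ i in atTop, MatchedFrom φ x (-2 * (k i : ℤ)) n j}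
    with hAdef
  have hU : MeasurableSet {x | ∃! j, x ∈ A j} := by
    have : {x | ∃! j, x ∈ A j} = ⋃ j, (A j ∩ ⋂ j', ⋂ _ : j' ≠ j, (A j')ᶜ) := by
      ext x
      simp only [ExistsUnique, Set.mem_ofPred_eq, Set.mem_iUnion, Set.mem_inter_iff,
        Set.mem_iInter, Set.mem_compl_iff]
      refine exists_congr fun j => and_congr_right fun _ => forall_congr' fun j' => ?_
      tauto
    rw [this]
    exact MeasurableSet.iUnion fun j => (hA j).inter <| MeasurableSet.iInter fun j' =>
      MeasurableSet.iInter fun _ => (hA j').compl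
  have hEq : (fun x => limitMatching φ k x n) ⁻¹' {j} =
      ({x | ∃! j, x ∈ A j} ∩ A j) ∪ ({x | ∃! j, x ∈ A j}ᶜ ∩ {_x | (0 : ℤ) = j}) := by
    ext x
    by_cases h : ∃! j, x ∈ A j
    · have h' : limitMatching φ k x n = h.choose := dif_pos h
      have h3 : x ∈ {x | ∃! j, x ∈ A j} := h
      simp only [Set.mem_preimage, Set.mem_singleton_iff, h', Set.mem_union, Set.mem_inter_iff, h3,
        true_and, Set.mem_compl_iff, not_true, false_and, or_false]
      exact ⟨fun hj => hj ▸ h.choose_spec.1, fun hj => (h.choose_spec.2 j hj).symm⟩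
    · have h' : limitMatching φ k x n = 0 := dif_neg h
      have h3 : x ∉ {x | ∃! j, x ∈ A j} := h
      simp only [Set.mem_preimage, Set.mem_singleton_iff, h', Set.mem_union, Set.mem_inter_iff, h3,
        false_and, Set.mem_compl_iff, not_false_iff, true_and, false_or, Set.mem_ofPred_eq]
  rw [hEq]
  exact (hU.inter (hA j)).union (hU.compl.inter (MeasurableSet.const _))

end Coupling

end GeneralMatching

namespace GeneralMatching

/-! ### Stationarity of the limit, and uniqueness for each parity -/

section Uniqueness

variable {V : Type*} {G : SimpleGraph V} {φ : MatchingPolicy G}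

theorem IsPerfectMatching.waiting_eq_empty_iff {x : ℤ → Arrival G} {m : ℤ → ℤ}
    (hm : IsPerfectMatching φ x m) (n : ℤ) : waiting m n = ∅ ↔ (waiting m n).ncard = 0 := by
  obtain ⟨-, -, -, hfin, -⟩ := hm.exists_word
  rw [Set.ncard_eq_zero (hfin n)]

theorem IsPerfectMatching.waiting_eq_empty_of_empties {x : ℤ → Arrival G} {m : ℤ → ℤ}
    (hm : IsPerfectMatching φ x m) {s n : ℤ} (hs : waiting m s = ∅) (h : Empties φ x s n) :
    waiting m n = ∅ := by
  obtain ⟨W, -, hl, -, hr⟩ := hm.exists_word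
  obtain ⟨j, rfl, hj⟩ := h
  have h0 : W s = [] := by rw [← List.length_eq_zero_iff, hl, hs, Set.ncard_empty]
  rw [hm.waiting_eq_empty_iff, ← hl, hr, h0, hj, List.length_nil]

/-- On the shifted input the runs start at `-2 * k i + 2` in the original time; they merge with
those started at `-2 * k i`, so both limits have common empty times arbitrarily far back. -/
theorem IsGood.limitMatching_shiftBy {k : ℕ → ℕ} (hk : StrictMono k) {x : ℤ → Arrival G}
    (hx : IsGood φ k x) (hx2 : IsGood φ k (shiftBy 2 x))
    (hc : ∀ N : ℤ, ∀ᶠ i in atTop, Coupled φ x (-2 * (k i : ℤ) + 2) (-2 * (k i : ℤ)) N) :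
    limitMatching φ k (shiftBy 2 x) = translate 2 (limitMatching φ k x) := by
  obtain ⟨h1, h2, h3⟩ := hx.limitMatching_spec hk
  obtain ⟨h1', h2', h3'⟩ := hx2.limitMatching_spec hk
  refine h1'.eq_of_waiting_eq_empty (h1.translate 2) fun N => ?_
  obtain ⟨l, hl, h⟩ := hx.neg (N + 2)
  rw [← h3, h2] at h
  refine ⟨l - 2, by omega, ?_, ?_⟩
  · rw [h2']
    filter_upwards [h, hc l] with i hi ⟨l', hl', h4, h5⟩
    rw [empties_shiftBy, sub_add_cancel]
    exact h4.trans (h5.of_le hi hl')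
  · rw [waiting_translate_eq_empty_iff, sub_add_cancel, h2]
    exact h

/-- If `m` is empty at some early time together with the run from `-2 * k i`, it follows that run,
hence is empty at each later time where the run is. The run shares the empty times of the limit for
large `i`. -/
theorem IsGood.eq_limitMatching {k : ℕ → ℕ} (hk : StrictMono k) {x : ℤ → Arrival G}
    (hx : IsGood φ k x) {m : ℤ → ℤ} (hm : IsPerfectMatching φ x m)
    (h : ∀ N : ℤ, ∃ᶠ i in atTop, ∃ l ≤ N, Empties φ x (-2 * (k i : ℤ)) l ∧ waiting m l = ∅) :
    m = limitMatching φ k x := by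
  obtain ⟨h1, h2, h3⟩ := hx.limitMatching_spec hk
  refine hm.eq_of_waiting_eq_empty h1 fun N => ?_
  obtain ⟨l, hl, hl'⟩ := hx.neg N
  rw [← h3] at hl'
  obtain ⟨i, ⟨l', h4, h5, h6⟩, h7⟩ := ((h l).and_eventually ((h2 l).1 hl')).exists
  exact ⟨l, hl, hm.waiting_eq_empty_of_empties h6 (h5.of_le h7 h4), hl'⟩

variable [Finite V] [MeasurableSpace V] [DiscreteMeasurableSpace V]
  {P : Measure (ℤ → Arrival G)} [IsProbabilityMeasure P]
  {M : (ℤ → Arrival G) → ℤ → ℤ}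

omit [Finite V] [DiscreteMeasurableSpace V] [IsProbabilityMeasure P] in
theorem IsStationaryPerfectMatching.ae_shiftBy (hP : MeasurePreserving (shiftBy 1) P P)
    (hM : IsStationaryPerfectMatching φ P M) :
    ∀ᵐ x ∂P, ∀ j : ℕ, M (shiftBy (-2 * (j : ℤ)) x) = translate (-2 * (j : ℤ)) (M x) := by
  have h : ∀ᵐ x ∂P, ∀ c : ℤ,
      M (shiftBy 2 (shiftBy c x)) = translate 2 (M (shiftBy c x)) := by
    rw [ae_all_iff]
    intro c
    have h0 : ∀ᵐ x ∂P, M (shiftBy 2 x) = translate 2 (M x) := by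
      filter_upwards [hM.stationary] with x hx
      exact funext hx
    exact GeneralMatching.ae_shiftBy hP c h0
  filter_upwards [h] with x hx j
  induction j with
  | zero => simp [shiftBy_zero, translate_zero]
  | succ j ih =>
    have := hx (-2 * ((j + 1 : ℕ) : ℤ))
    rw [shiftBy_shiftBy, show 2 + -2 * ((j + 1 : ℕ) : ℤ) = -2 * (j : ℤ) by push_cast; ring, ih]
      at this
    have h2 := congrArg (translate (-2)) this
    rw [translate_translate, translate_translate, neg_add_cancel, translate_zero] at h2
    rw [← h2]
    congr 1
    push_cast; ring

omit [Finite V] [DiscreteMeasurableSpace V] [IsProbabilityMeasure P] in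
theorem IsStationaryPerfectMatching.measurableSet_waiting
    (hM : IsStationaryPerfectMatching φ P M) (F : Finset ℤ) :
    MeasurableSet {x | ∀ k, k ∈ F ↔ k ∈ waiting (M x) 0} := by
  have : {x | ∀ k, k ∈ F ↔ k ∈ waiting (M x) 0} =
      ⋂ k : ℤ, (fun x => M x k) ⁻¹' {j | k ∈ F ↔ (k < 0 ∧ 0 ≤ j)} := by
    ext x; simp [waiting]
  rw [this]
  exact MeasurableSet.iInter fun k =>
    (measurable_pi_iff.1 hM.measurable k) MeasurableSet.of_discrete

omit [Finite V] [DiscreteMeasurableSpace V] in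
-- Almost sure finiteness of the buffer already makes its size tight. The finite set `F` is explicit
-- because `Set.ncard` vanishes on infinite sets, and because it turns the event into a countable
-- union.
theorem IsStationaryPerfectMatching.tendsto_measure_ncard
    (hM : IsStationaryPerfectMatching φ P M) :
    Tendsto (fun r : ℕ => P {x | ∃ F : Finset ℤ, F.card ≤ r ∧ ∀ k, k ∈ F ↔ k ∈ waiting (M x) 0}ᶜ)
      atTop (𝓝 0) := by
  refine tendsto_measure_compl_of_monotone (fun r => ?_) ?_ ?_
  · have : {x | ∃ F : Finset ℤ, F.card ≤ r ∧ ∀ k, k ∈ F ↔ k ∈ waiting (M x) 0} =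
        ⋃ (F : Finset ℤ) (_ : F.card ≤ r), {x | ∀ k, k ∈ F ↔ k ∈ waiting (M x) 0} := by
      ext x; simp
    rw [this]
    exact MeasurableSet.iUnion fun F => MeasurableSet.iUnion fun _ => hM.measurableSet_waiting F
  · rintro r r' h x ⟨F, h1, h2⟩
    exact ⟨F, h1.trans h, h2⟩
  · filter_upwards [hM.perfect] with x hx
    obtain ⟨-, -, -, hfin, -⟩ := hx.exists_word
    exact ⟨(hfin 0).toFinset.card, (hfin 0).toFinset, le_rfl, by simp⟩

/-- A stationary perfect matching with an even number of items in the buffer at time `0` is the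
limit of the matchings in the systems started empty at even times. -/
theorem IsStationaryPerfectMatching.ae_eq_limitMatching
    (hP : MeasurePreserving (shiftBy 1) P P) (h1 : AlmostSurelyCouples φ P)
    {k : ℕ → ℕ} (hk : StrictMono k) (hgood : ∀ᵐ x ∂P, IsGood φ k x)
    (hM : IsStationaryPerfectMatching φ P M) (heven : ∀ᵐ x ∂P, Even (waiting (M x) 0).ncard) :
    M =ᵐ[P] limitMatching φ k := by
  have key : ∀ᵐ x ∂P, ∀ N : ℤ, ∃ᶠ i in atTop,
      ∃ l ≤ N, Empties φ x (-2 * (k i : ℤ)) l ∧ waiting (M x) l = ∅ := by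
    rw [ae_all_iff]
    intro N
    -- Seen from time `-2 * k i`, the buffer has the law of the buffer at time `0`: it has at most
    -- `r` items and then couples within `m` pairs, up to `ε`. Convergence in probability is enough,
    -- since only infinitely many `i` are needed.
    have hbad : Tendsto (fun i => P {x | ¬ ∃ l ≤ N, Empties φ x (-2 * (k i : ℤ)) l ∧
        waiting (M x) l = ∅}) atTop (𝓝 0) := by
      rw [ENNReal.tendsto_nhds_zero]
      intro ε hε
      obtain ⟨r, hr⟩ := (hM.tendsto_measure_ncard.eventually_le_const
        (ENNReal.half_pos hε.ne')).exists
      obtain ⟨m, hm⟩ := ((tendsto_measure_not_couplesWithin h1 r).eventually_le_const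
        (ENNReal.half_pos hε.ne')).exists
      filter_upwards [eventually_ge_atTop (N.natAbs + 2 * m)] with i hi
      have hki := hk.id_le i
      simp only [id] at hki
      have hsub : ({x | ¬ ∃ l ≤ N, Empties φ x (-2 * (k i : ℤ)) l ∧ waiting (M x) l = ∅} :
          Set (ℤ → Arrival G)) ≤ᵐ[P]
          (shiftBy (-2 * (k i : ℤ)) ⁻¹'
            {x | ∃ F : Finset ℤ, F.card ≤ r ∧ ∀ k, k ∈ F ↔ k ∈ waiting (M x) 0}ᶜ ∪
          shiftBy (-2 * (k i : ℤ)) ⁻¹' {x | CouplesWithin φ r m x}ᶜ : Set (ℤ → Arrival G)) := by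
        filter_upwards [hM.ae_shiftBy hP, GeneralMatching.ae_shiftBy hP (-2 * (k i : ℤ)) hM.perfect,
          GeneralMatching.ae_shiftBy hP (-2 * (k i : ℤ)) heven] with x hx1 hx2 hx3
        intro hx
        by_contra hcon
        have hcon' : ¬ (x ∈ shiftBy (-2 * (k i : ℤ)) ⁻¹'
            {x | ∃ F : Finset ℤ, F.card ≤ r ∧ ∀ k, k ∈ F ↔ k ∈ waiting (M x) 0}ᶜ ∪
            shiftBy (-2 * (k i : ℤ)) ⁻¹' {x | CouplesWithin φ r m x}ᶜ) := hcon
        simp only [Set.mem_union, Set.mem_preimage, Set.mem_compl_iff, Set.mem_ofPred_eq, not_or,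
          not_not] at hcon'
        obtain ⟨⟨F, hF1, hF2⟩, hc⟩ := hcon'
        obtain ⟨W, hW1, hW2, hW3, hW4⟩ := hx2.exists_word
        have hF : waiting (M (shiftBy (-2 * (k i : ℤ)) x)) 0 = F := by
          ext j; exact (hF2 j).symm
        obtain ⟨l, hl, h3, h4⟩ := hc (W 0) (hW1 0) (by rw [hW2]; exact hx3)
          (by rw [hW2, hF, Set.ncard_coe_finset]; exact hF1)
        refine hx ⟨2 * l + -2 * (k i : ℤ), by omega, ?_, ?_⟩
        · rw [← zero_add (-2 * (k i : ℤ)), ← add_assoc, add_zero, ← empties_shiftBy]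
          exact ⟨2 * l, by push_cast; ring, h4⟩
        · rw [← waiting_translate_eq_empty_iff, ← hx1, hx2.waiting_eq_empty_iff, ← hW2]
          have := hW4 0 (2 * l)
          rw [h3, zero_add] at this
          push_cast at this
          rw [this, List.length_nil]
      calc _ ≤ _ := measure_mono_ae hsub
        _ ≤ _ := measure_union_le _ _
        _ ≤ ε / 2 + ε / 2 := by
          rw [measure_preimage_shiftBy hP, measure_preimage_shiftBy hP]
          exact add_le_add hr hm
        _ = ε := ENNReal.add_halves ε
    filter_upwards [ae_frequently_notMem hbad] with x hx
    exact hx.mono fun i hi => by simpa using hi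
  filter_upwards [key, hgood, hM.perfect] with x hx1 hx2 hx3
  exact hx2.eq_limitMatching hk hx3 hx1

/-- The translation of time by `k` for matchings of the input. -/
def translateMap (k : ℤ) (M : (ℤ → Arrival G) → ℤ → ℤ) : (ℤ → Arrival G) → ℤ → ℤ :=
  fun x => translate k (M (shiftBy (-k) x))

omit [Finite V] [DiscreteMeasurableSpace V] [IsProbabilityMeasure P] in
theorem IsStationaryPerfectMatching.translateMap (hP : MeasurePreserving (shiftBy 1) P P)
    (hM : IsStationaryPerfectMatching φ P M) (k : ℤ) :
    IsStationaryPerfectMatching φ P (translateMap k M) where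
  measurable := by
    refine measurable_pi_lambda _ fun n => ?_
    have h1 : Measurable fun x => M (shiftBy (-k) x) (n + k) :=
      (measurable_pi_iff.1 hM.measurable (n + k)).comp (measurable_shiftBy (-k))
    exact (Measurable.of_discrete (f := fun j : ℤ => j - k)).comp h1
  perfect := by
    filter_upwards [GeneralMatching.ae_shiftBy hP (-k) hM.perfect] with x hx
    have := hx.translate k
    rwa [shiftBy_shiftBy, add_neg_cancel, shiftBy_zero] at this
  stationary := by
    filter_upwards [GeneralMatching.ae_shiftBy hP (-k) hM.stationary] with x hx n
    have h2 : M (shiftBy 2 (shiftBy (-k) x)) = translate 2 (M (shiftBy (-k) x)) := funext hx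
    have : GeneralMatching.translateMap k M (shiftBy 2 x) =
        translate 2 (GeneralMatching.translateMap k M x) := by
      simp only [GeneralMatching.translateMap]
      rw [shiftBy_shiftBy, add_comm, ← shiftBy_shiftBy, h2, translate_translate,
        translate_translate, add_comm]
    exact congrFun this n

/-- The theorem for an input whose systems started empty are tight and couple. -/
theorem exists_two_isStationaryPerfectMatching (hP : MeasurePreserving (shiftBy 1) P P)
    (herg : Ergodic (shiftBy 2) P) (h1 : AlmostSurelyCouples φ P) (h2 : TightLengths φ P) :
    ∃ M₀ M₁ : (ℤ → Arrival G) → ℤ → ℤ,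
      IsStationaryPerfectMatching φ P M₀ ∧ IsStationaryPerfectMatching φ P M₁ ∧
      (∀ᵐ x ∂P, EmptiesAt Even (M₀ x)) ∧ (∀ᵐ x ∂P, EmptiesAt Odd (M₁ x)) ∧
      ¬ (M₀ =ᵐ[P] M₁) ∧
      ∀ M : (ℤ → Arrival G) → ℤ → ℤ, IsStationaryPerfectMatching φ P M →
        M =ᵐ[P] M₀ ∨ M =ᵐ[P] M₁ := by
  obtain ⟨k, hk, hkc⟩ := exists_strictMono_coupled hP h1 h2
  have hgood := ae_isGood hP h1 h2 hk hkc
  have hM₀ : IsStationaryPerfectMatching φ P (limitMatching φ k) := by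
    refine ⟨measurable_limitMatching k, ?_, ?_⟩
    · filter_upwards [hgood] with x hx
      exact (hx.limitMatching_spec hk).1
    · have hc : ∀ᵐ x ∂P, ∀ N : ℤ, ∀ᶠ i in atTop,
          Coupled φ x (-2 * (k i : ℤ) + 2) (-2 * (k i : ℤ)) N := by
        rw [ae_all_iff]
        intro N
        have := ae_eventually_notMem_of_eventually_le (P := P)
          (B := fun i => {x | ¬ Coupled φ x (-2 * (k i : ℤ) + 2) (-2 * (k i : ℤ)) N}) (by
            filter_upwards [hkc N 1] with i hi
            -- The offset `c = 1` with `d = 1` compares the starts `-2 * k i + 2` and `-2 * k i`.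
            simpa using hi 1)
        filter_upwards [this] with x hx
        filter_upwards [hx] with i hi
        simpa using hi
      filter_upwards [hgood, GeneralMatching.ae_shiftBy hP 2 hgood, hc] with x hx1 hx2 hx3 n
      exact congrFun (hx1.limitMatching_shiftBy hk hx2 hx3) n
  have hE₀ : ∀ᵐ x ∂P, EmptiesAt Even (limitMatching φ k x) := by
    filter_upwards [hgood] with x hx
    exact hx.emptiesAt_even hk
  have hE₁ : ∀ᵐ x ∂P, EmptiesAt Odd (translateMap (-1) (limitMatching φ k) x) := by
    filter_upwards [GeneralMatching.ae_shiftBy hP (- -1) hE₀] with x hx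
    refine ⟨fun n hn => ?_, fun N => ?_, fun N => ?_⟩
    · have := hx.1 _ ((waiting_translate_eq_empty_iff _ _ _).1 hn)
      rw [Int.even_add] at this
      rw [← Int.not_even_iff_odd]
      intro h
      exact absurd (this.1 h) (by decide)
    · obtain ⟨n, hn, h⟩ := hx.2.1 N
      exact ⟨n + 1, by omega, (waiting_translate_eq_empty_iff _ _ _).2 (by simpa using h)⟩
    · obtain ⟨n, hn, h⟩ := hx.2.2 (N - 1)
      exact ⟨n + 1, by omega, (waiting_translate_eq_empty_iff _ _ _).2 (by simpa using h)⟩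
  refine ⟨limitMatching φ k, translateMap (-1) (limitMatching φ k), hM₀, hM₀.translateMap hP (-1),
    hE₀, hE₁, fun hEq => ?_, fun M hM => ?_⟩
  · obtain ⟨x, hx1, hx2, hx3⟩ := (hE₀.and (hE₁.and hEq)).exists
    obtain ⟨n, -, hn⟩ := hx1.2.1 0
    have h3 := hx1.1 n hn
    rw [hx3] at hn
    exact Int.not_even_iff_odd.2 (hx2.1 n hn) h3
  · have hmeas : MeasurableSet {x | ∃ F : Finset ℤ, Even F.card ∧
        ∀ k, k ∈ F ↔ k ∈ waiting (M x) 0} := by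
      have : {x | ∃ F : Finset ℤ, Even F.card ∧ ∀ k, k ∈ F ↔ k ∈ waiting (M x) 0} =
          ⋃ (F : Finset ℤ) (_ : Even F.card), {x | ∀ k, k ∈ F ↔ k ∈ waiting (M x) 0} := by
        ext x; simp
      rw [this]
      exact MeasurableSet.iUnion fun F => MeasurableSet.iUnion fun _ => hM.measurableSet_waiting F
    have hiff : ∀ x, IsPerfectMatching φ x (M x) →
        ((∃ F : Finset ℤ, Even F.card ∧ ∀ k, k ∈ F ↔ k ∈ waiting (M x) 0) ↔
          Even (waiting (M x) 0).ncard) := by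
      intro x hx
      obtain ⟨-, -, -, hfin, -⟩ := hx.exists_word
      constructor
      · rintro ⟨F, hF1, hF2⟩
        have hF : waiting (M x) 0 = F := by ext j; exact (hF2 j).symm
        rwa [hF, Set.ncard_coe_finset]
      · intro h
        exact ⟨(hfin 0).toFinset, by rwa [← Set.ncard_eq_toFinset_card _ (hfin 0)], by simp⟩
    -- Two arrivals preserve the parity of the buffer size, so ergodicity of the shift by two
    -- decides this parity almost surely.
    have hinv : shiftBy 2 ⁻¹' {x | ∃ F : Finset ℤ, Even F.card ∧
        ∀ k, k ∈ F ↔ k ∈ waiting (M x) 0} =ᵐ[P] {x | ∃ F : Finset ℤ, Even F.card ∧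
        ∀ k, k ∈ F ↔ k ∈ waiting (M x) 0} := by
      filter_upwards [hM.perfect, GeneralMatching.ae_shiftBy hP 2 hM.perfect, hM.stationary]
        with x hx1 hx2 hx3
      refine propext ?_
      change (∃ F : Finset ℤ, Even F.card ∧ ∀ k, k ∈ F ↔ k ∈ waiting (M (shiftBy 2 x)) 0) ↔
        (∃ F : Finset ℤ, Even F.card ∧ ∀ k, k ∈ F ↔ k ∈ waiting (M x) 0)
      have h3 : M (shiftBy 2 x) = translate 2 (M x) := funext hx3
      rw [hiff _ hx1, hiff _ hx2, h3, ncard_waiting_translate, hx1.even_ncard_waiting]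
      simp
    rcases herg.quasiErgodic.ae_mem_or_ae_notMem₀ hmeas.nullMeasurableSet hinv with h | h
    · left
      refine hM.ae_eq_limitMatching hP h1 hk hgood ?_
      filter_upwards [h, hM.perfect] with x hx1 hx2
      exact (hiff x hx2).1 hx1
    · right
      -- Translating by one item makes the buffer size at time `0` even; the resulting identity is
      -- translated back afterwards.
      have h' := (hM.translateMap hP 1).ae_eq_limitMatching hP h1 hk hgood (by
        filter_upwards [GeneralMatching.ae_shiftBy hP (-1) h,
          GeneralMatching.ae_shiftBy hP (-1) hM.perfect] with x hx1 hx2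
        simp only [translateMap]
        rw [ncard_waiting_translate, zero_add, hx2.even_ncard_waiting]
        have h3 : ¬ Even (waiting (M (shiftBy (-1) x)) 0).ncard := fun h => hx1 ((hiff _ hx2).2 h)
        rw [Nat.not_even_iff_odd] at h3
        simpa using h3)
      filter_upwards [GeneralMatching.ae_shiftBy hP (- -1) h'] with x hx
      have h3 := congrArg (translate (-1)) hx
      simp only [translateMap] at h3 ⊢
      rw [translate_translate, neg_add_cancel, translate_zero, shiftBy_shiftBy, neg_neg,
        neg_add_cancel, shiftBy_zero] at h3
      rw [h3, neg_neg]

end Uniqueness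

end GeneralMatching

namespace GeneralMatching

/-! ### Grouping arrivals by pairs -/

section Pairs

variable {α : Type*}

/-- The sequence whose pairs of consecutive terms, starting at even times, are given. -/
def unpair (y : ℤ → α × α) : ℤ → α := fun n => if Even n then (y (n / 2)).1 else (y (n / 2)).2

theorem unpair_evenPairs (x : ℤ → α) : unpair (evenPairs x) = x := by
  funext n
  by_cases h : Even n
  · simp only [unpair, evenPairs, if_pos h]
    rw [Int.mul_ediv_cancel' h.two_dvd]
  · simp only [unpair, evenPairs, if_neg h]
    rw [Int.not_even_iff_odd] at h
    rw [Int.two_mul_ediv_two_add_one_of_odd h]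

theorem evenPairs_unpair (y : ℤ → α × α) : evenPairs (unpair y) = y := by
  funext n
  have h1 : Even (2 * n) := even_two_mul n
  have h2 : ¬ Even (2 * n + 1) := Int.not_even_two_mul_add_one n
  have h3 : (2 * n + 1) / 2 = n := by omega
  simp only [evenPairs, unpair, if_pos h1, if_neg h2, h3]
  rw [Int.mul_ediv_cancel_left n two_ne_zero]

variable [MeasurableSpace α]

/-- Grouping by pairs, as a measurable equivalence. -/
def pairEquiv : (ℤ → α) ≃ᵐ (ℤ → α × α) where
  toFun := evenPairs
  invFun := unpair
  left_inv := unpair_evenPairs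
  right_inv := evenPairs_unpair
  measurable_toFun := measurable_pi_lambda _ fun n =>
    (measurable_pi_apply (2 * n)).prodMk (measurable_pi_apply (2 * n + 1))
  measurable_invFun := measurable_pi_lambda _ fun n => by
    by_cases h : Even n
    · simpa only [Equiv.coe_fn_symm_mk, unpair, if_pos h] using
        (measurable_pi_apply (n / 2)).fst
    · simpa only [Equiv.coe_fn_symm_mk, unpair, if_neg h] using
        (measurable_pi_apply (n / 2)).snd

/-- Ungrouping the pairs conjugates the shift of pairs to the shift by two, and ergodicity passes to
factors. -/
theorem ergodic_shiftBy_two_of_pairs {P : Measure (ℤ → α)}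
    (h : Ergodic (shiftBy 1) (P.map evenPairs)) : Ergodic (shiftBy 2) P := by
  have hg : MeasurePreserving unpair (P.map evenPairs) P := by
    refine ⟨(pairEquiv (α := α)).symm.measurable, ?_⟩
    exact (pairEquiv (α := α)).map_symm_map
  refine hg.ergodic_of_ergodic_semiconj h (measurable_shiftBy 2) fun y => ?_
  obtain ⟨x, rfl⟩ : ∃ x, evenPairs x = y := ⟨unpair y, evenPairs_unpair y⟩
  rw [shiftBy_evenPairs, unpair_evenPairs, unpair_evenPairs, mul_one]

end Pairs

/-! ### The law of the input -/

section Input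

variable {V : Type*} [MeasurableSpace V] {G : SimpleGraph V}
  {Ω : Type*} [MeasurableSpace Ω] {Pr : Measure Ω} {C : ℤ → Ω → V} {S : ℤ → Ω → Pref G}

theorem measurable_inputPath (hC : ∀ n, Measurable (C n)) (hS : ∀ n, Measurable (S n)) :
    Measurable (inputPath C S) :=
  measurable_pi_lambda _ fun n => (hC n).prodMk (hS n)

theorem evenPairLaw_eq_map (hC : ∀ n, Measurable (C n)) (hS : ∀ n, Measurable (S n)) :
    evenPairLaw Pr C S = (inputLaw Pr C S).map evenPairs := by
  exact (Measure.map_map (pairEquiv (α := Arrival G)).measurable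
    (measurable_inputPath hC hS)).symm

/-- Needed because sub-additivity and erasing are only assumed for preferences that can be drawn. -/
theorem ae_mem_support (φ : MatchingPolicy G) (hC : ∀ n, Measurable (C n))
    (hS : ∀ n, Measurable (S n)) (h : ∀ n, Pr.map (S n) = φ.prefLaw.toMeasure) :
    ∀ᵐ x ∂(inputLaw Pr C S), ∀ n, (x n).2 ∈ φ.prefLaw.support := by
  rw [ae_all_iff]
  intro n
  have h0 : ∀ᵐ σ ∂(Pr.map (S n)), σ ∈ φ.prefLaw.support := by
    rw [h n, ae_iff, PMF.toMeasure_apply_eq_zero_iff _ MeasurableSet.of_discrete]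
    exact disjoint_compl_right
  have h1 := ae_of_ae_map (hS n).aemeasurable h0
  refine (ae_map_iff (measurable_inputPath hC hS).aemeasurable ?_).2 h1
  exact (measurable_snd.comp (measurable_pi_apply n)) (MeasurableSet.of_discrete
    (s := φ.prefLaw.support))

end Input

/-! ### Coupling and tightness from the renovation condition -/

section Renovation

variable {V : Type*} {G : SimpleGraph V} {φ : MatchingPolicy G}

/-- The renovation event, for the sequence of arrivals. -/
def IsRenovated (φ : MatchingPolicy G) (z : List V) (n : ℕ) (x : ℤ → Arrival G) : Prop :=
  ∀ k : ℕ, ∃ l : ℕ, l ≤ n ∧ (wordRun φ x 0 (2 * l) [] = [] ∧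
    wordRun φ x (-2 * (k : ℤ)) (2 * (l + k)) [] = []) ∧
    (arrivals x (2 * (l : ℤ)) (2 * (z.length / 2))).map Prod.fst = z

theorem evenPairs_mem_renovationEvent_iff (z : List V) (n : ℕ) (x : ℤ → Arrival G) :
    evenPairs x ∈ φ.renovationEvent z n ↔ IsRenovated φ z n x := by
  simp only [MatchingPolicy.renovationEvent, IsRenovated, Set.mem_iInter, Set.mem_iUnion,
    Set.mem_inter_iff, exists_prop, Set.mem_preimage, MatchingPolicy.emptyEvent, arrivalEvent,
    Set.mem_ofPred_eq, shiftBy_evenPairs, evenBuffer_evenPairs, pairLetters_evenPairs,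
    wordRun_shiftBy, arrivals_shiftBy, zero_add]
  refine forall_congr' fun k => exists_congr fun l => ?_
  rw [show 2 * -(k : ℤ) = -2 * k by ring]

variable [Finite V] [MeasurableSpace V] [DiscreteMeasurableSpace V]

theorem measurableSet_isRenovated (z : List V) (n : ℕ) :
    MeasurableSet {x : ℤ → Arrival G | IsRenovated φ z n x} := by
  have : {x : ℤ → Arrival G | IsRenovated φ z n x} =
      ⋂ k : ℕ, ⋃ (l : ℕ) (_ : l ≤ n), (({x | wordRun φ x 0 (2 * l) [] = []} ∩
        {x | wordRun φ x (-2 * (k : ℤ)) (2 * (l + k)) [] = []}) ∩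
        {x | (arrivals x (2 * (l : ℤ)) (2 * (z.length / 2))).map Prod.fst = z}) := by
    ext x
    simp only [IsRenovated, Set.mem_ofPred_eq, Set.mem_iInter, Set.mem_iUnion, Set.mem_inter_iff,
      exists_prop]
  rw [this]
  refine MeasurableSet.iInter fun k => MeasurableSet.iUnion fun l => MeasurableSet.iUnion fun _ =>
    ((measurableSet_wordRun φ _ _ fun f => f [] = []).inter
      (measurableSet_wordRun φ _ _ fun f => f [] = [])).inter ?_
  refine measurableSet_of_dependsOn
    (Finset.Ico (2 * (l : ℤ)) (2 * (l : ℤ) + (2 * (z.length / 2) : ℕ))) _ fun x y h => ?_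
  have heq : arrivals x (2 * (l : ℤ)) (2 * (z.length / 2)) =
      arrivals y (2 * (l : ℤ)) (2 * (z.length / 2)) := by
    refine List.map_congr_left fun i hi => h _ (Finset.mem_Ico.2 ?_)
    rw [List.mem_range] at hi
    omega
  change _ = _ ↔ _ = _
  rw [heq]

variable {P : Measure (ℤ → Arrival G)} [IsProbabilityMeasure P]

theorem tendsto_measure_not_isRenovated {z : List V}
    (h : Tendsto (fun n : ℕ => (P.map evenPairs) (φ.renovationEvent z n)) atTop (𝓝 1)) :
    Tendsto (fun n : ℕ => P {x | IsRenovated φ z n x}ᶜ) atTop (𝓝 0) := by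
  have h1 : ∀ n, (P.map evenPairs) (φ.renovationEvent z n) = P {x | IsRenovated φ z n x} := by
    intro n
    have : (P.map evenPairs) (φ.renovationEvent z n) =
        P (evenPairs ⁻¹' φ.renovationEvent z n) :=
      (pairEquiv (α := Arrival G)).map_apply _
    rw [this]
    congr 1
    ext x
    exact evenPairs_mem_renovationEvent_iff z n x
  simp only [h1] at h
  have h2 : ∀ n, P {x | IsRenovated φ z n x}ᶜ = 1 - P {x | IsRenovated φ z n x} := fun n =>
    prob_compl_eq_one_sub (measurableSet_isRenovated z n)
  simp only [h2]
  have := ENNReal.Tendsto.sub (tendsto_const_nhds (x := (1 : ℝ≥0∞))) h (Or.inl ENNReal.one_ne_top)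
  simpa using this

theorem ae_exists_isRenovated {z : List V}
    (h : Tendsto (fun n : ℕ => (P.map evenPairs) (φ.renovationEvent z n)) atTop (𝓝 1)) :
    ∀ᵐ x ∂P, ∃ n, IsRenovated φ z n x := by
  filter_upwards [ae_frequently_notMem (tendsto_measure_not_isRenovated h)] with x hx
  obtain ⟨n, hn⟩ := hx.exists
  exact ⟨n, by simpa using hn⟩

/-- At the renovation time the system started empty is empty, so by sub-additivity the run from `w`
is no longer than `w`; the strong erasing words that follow then empty both. -/
theorem almostSurelyCouples_of_renovation (hφ : φ.SubAdditive)
    (hsupp : ∀ᵐ x ∂P, ∀ n, (x n).2 ∈ φ.prefLaw.support)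
    (h : ∀ r : ℕ, 1 ≤ r → φ.Renovation (P.map evenPairs) r) : AlmostSurelyCouples φ P := by
  have key : ∀ᵐ x ∂P, ∀ r : ℕ, ∀ w ∈ admissibleWords G, Even w.length → w.length ≤ 2 * (r + 1) →
      ∃ l : ℕ, wordRun φ x 0 (2 * l) w = [] ∧ wordRun φ x 0 (2 * l) [] = [] := by
    rw [ae_all_iff]
    intro r
    -- The order `r + 1` is at least one, as the condition requires, and absorbs `2 * (r + 1)`
    -- letters.
    obtain ⟨zs, hlen, hzs, hlim⟩ := h (r + 1) (by omega)
    filter_upwards [hsupp, ae_exists_isRenovated hlim] with x hx ⟨n, hn⟩ w hw he hwr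
    obtain ⟨l, -, ⟨hl, -⟩, hz⟩ := hn 0
    have hle := length_wordRun_le hφ hx 0 (2 * l) hw hl
    refine ⟨l + zs.flatten.length / 2, ?_, ?_⟩
    · rw [mul_add, wordRun_add]
      push_cast
      rw [zero_add]
      exact foldl_next_of_isStrongErasing hφ zs hzs (wordRun_mem_admissibleWords φ _ _ _ hw)
        ((even_length_wordRun φ _ _ _ hw).2 he) (by omega) (drawable_arrivals hx _ _) hz
    · rw [mul_add, wordRun_add, hl]
      push_cast
      rw [zero_add]
      exact foldl_next_of_isStrongErasing hφ zs hzs nil_mem_admissibleWords (by simp) (by simp)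
        (drawable_arrivals hx _ _) hz
  filter_upwards [key] with x hx w hw he
  exact hx w.length w hw he (by omega)

/-- On the renovation event every system started empty in the past at an even time is empty again
within `n` pairs after time `0`. An arrival removes at most one letter, so its length at time `0` is
at most `2 * n`. -/
theorem tightLengths_of_renovation (hP : MeasurePreserving (shiftBy 1) P P)
    (h : φ.Renovation (P.map evenPairs) 1) : TightLengths φ P := by
  obtain ⟨zs, -, -, hlim⟩ := h
  intro ε hε
  obtain ⟨n, hn⟩ := ((tendsto_measure_not_isRenovated hlim).eventually_le_const hε).exists
  refine ⟨2 * n, fun k => ?_⟩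
  rw [← measure_preimage_shiftBy hP (-2 * (k : ℤ))]
  refine le_trans (measure_mono ?_) hn
  intro x hx hcon
  simp only [Set.mem_preimage, Set.mem_ofPred_eq, wordRun_shiftBy, zero_add] at hx
  obtain ⟨l, hl, ⟨-, h0⟩, -⟩ := hcon k
  have hle := length_le_length_foldl_next_add φ (arrivals x (-2 * (k : ℤ) + (2 * k : ℕ)) (2 * l))
    (wordRun_mem_admissibleWords φ x (-2 * (k : ℤ)) (2 * k) nil_mem_admissibleWords)
  rw [show 2 * (l + k) = 2 * k + 2 * l by ring, wordRun_add, wordRun] at h0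
  rw [h0, length_arrivals, List.length_nil] at hle
  omega

end Renovation

end GeneralMatching

namespace GeneralMatching

/-! ### Ergodicity of the shifts of a product measure -/

section IID

theorem abs_measureReal_sub_le_symmDiff {α : Type*} [MeasurableSpace α] (P : Measure α)
    [IsFiniteMeasure P] (A B : Set α) : |P.real A - P.real B| ≤ P.real (symmDiff A B) := by
  have aux : ∀ A B : Set α, P.real A ≤ P.real B + P.real (symmDiff A B) := fun A B =>
    (measureReal_mono fun x hx => by
      simp only [Set.mem_union, Set.mem_symmDiff]; tauto).trans (measureReal_union_le _ _)
  have h1 := aux A B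
  have h2 := aux B A
  rw [symmDiff_comm] at h2
  rw [abs_le]
  constructor <;> linarith

variable {α : Type*} [MeasurableSpace α] (ρ : Measure α) [IsProbabilityMeasure ρ]

theorem measurePreserving_shiftBy_infinitePi (k : ℤ) :
    MeasurePreserving (shiftBy k) (Measure.infinitePi fun _ : ℤ => ρ)
      (Measure.infinitePi fun _ : ℤ => ρ) :=
  ⟨measurable_shiftBy k, Measure.map_infinitePi_infinitePi_of_inj (P := fun _ : ℤ => ρ)
    (add_left_injective k)⟩

theorem indep_coordinates {S T : Set ℤ} (h : Disjoint S T) :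
    Indep (⨆ n ∈ S, MeasurableSpace.comap (fun x : ℤ → α => x n) inferInstance)
      (⨆ n ∈ T, MeasurableSpace.comap (fun x : ℤ → α => x n) inferInstance)
      (Measure.infinitePi fun _ : ℤ => ρ) := by
  have hind : iIndepFun (fun (n : ℤ) (x : ℤ → α) => x n) (Measure.infinitePi fun _ : ℤ => ρ) :=
    iIndepFun_infinitePi (P := fun _ : ℤ => ρ) (X := fun _ y => y) fun _ => measurable_id
  exact indep_iSup_of_disjoint (fun n => (measurable_pi_apply n).comap_le) hind.iIndep h

theorem measure_inter_of_disjoint_coordinates {S T : Set ℤ} (h : Disjoint S T)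
    {A B : Set (ℤ → α)}
    (hA : MeasurableSet[⨆ n ∈ S, MeasurableSpace.comap (fun x : ℤ → α => x n) inferInstance] A)
    (hB : MeasurableSet[⨆ n ∈ T, MeasurableSpace.comap (fun x : ℤ → α => x n) inferInstance] B) :
    Measure.infinitePi (fun _ : ℤ => ρ) (A ∩ B) =
      Measure.infinitePi (fun _ : ℤ => ρ) A * Measure.infinitePi (fun _ : ℤ => ρ) B :=
  (Indep_iff _ _ _).1 (indep_coordinates ρ h) A B hA hB

variable [Finite α] [DiscreteMeasurableSpace α]

/-- An invariant event is close to a cylinder and to a far translate of it; these are independent,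
which forces `P A = P A * P A`. -/
theorem ergodic_shiftBy_infinitePi {k : ℤ} (hk : 0 < k) :
    Ergodic (shiftBy k) (Measure.infinitePi fun _ : ℤ => ρ) := by
  set P := Measure.infinitePi fun _ : ℤ => ρ with hPdef
  refine ⟨measurePreserving_shiftBy_infinitePi ρ k, ⟨fun A hA hinv => ?_⟩⟩
  have hiter : ∀ n : ℕ, shiftBy (n * k) ⁻¹' A = A := by
    intro n
    induction n with
    | zero => ext x; simp [shiftBy_zero]
    | succ n ih =>
      ext x
      have h1 : shiftBy (((n + 1 : ℕ) : ℤ) * k) x = shiftBy k (shiftBy (n * k) x) := by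
        rw [shiftBy_shiftBy]; congr 1; push_cast; ring
      have h2 : ∀ y, shiftBy k y ∈ A ↔ y ∈ A := fun y => by
        rw [← Set.mem_preimage, hinv]
      have h3 : shiftBy (n * k) x ∈ A ↔ x ∈ A := by rw [← Set.mem_preimage, ih]
      rw [Set.mem_preimage, h1, h2, h3]
  have hreal : ∀ ε : ℝ, 0 < ε → |P.real A - P.real A * P.real A| ≤ 4 * ε := by
    intro ε hε
    obtain ⟨t, ht, htε⟩ := (Measure.MeasureDense.of_generateFrom_isSetAlgebra_finite P
      (isSetAlgebra_measurableCylinders) (generateFrom_measurableCylinders).symm).approx A hA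
      (measure_ne_top _ _) ε hε
    obtain ⟨I, B, hB, rfl⟩ := (mem_measurableCylinders t).1 ht
    have hdep : ∀ x y : ℤ → α, (∀ n ∈ I, x n = y n) → 
        (x ∈ cylinder (α := fun _ : ℤ => α) I B ↔ y ∈ cylinder (α := fun _ : ℤ => α) I B) := by
      intro x y h
      have : I.restrict x = I.restrict y := funext fun n => h n n.2
      rw [mem_cylinder, mem_cylinder, this]
    set t := cylinder (α := fun _ : ℤ => α) I B with htdef
    have htm : MeasurableSet t := hB.cylinder I
    obtain ⟨b, hb⟩ : ∃ b : ℕ, ∀ n ∈ I, n.natAbs ≤ b :=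
      ⟨I.sup Int.natAbs, fun n hn => Finset.le_sup (f := Int.natAbs) hn⟩
    -- A multiple of `k`, so that `A` is invariant under it, and larger than the diameter `2 * b` of
    -- the coordinates of the cylinder.
    set c : ℤ := ((2 * b + 1 : ℕ) : ℤ) * k with hc
    have hcb : 2 * (b : ℤ) < c := by
      rw [hc]; push_cast; nlinarith
    set t' := shiftBy c ⁻¹' t with ht'
    have hdep' : ∀ x y : ℤ → α, (∀ n ∈ I.map (addRightEmbedding c), x n = y n) →
        (x ∈ t' ↔ y ∈ t') := by
      intro x y h
      exact hdep _ _ fun n hn => h (n + c) (Finset.mem_map.2 ⟨n, hn, rfl⟩)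
    have hdisj : Disjoint (I : Set ℤ) (I.map (addRightEmbedding c) : Set ℤ) := by
      rw [Set.disjoint_left]
      intro n hn hn'
      obtain ⟨l, hl, rfl⟩ := Finset.mem_map.1 (Finset.mem_coe.1 hn')
      have h1 := hb _ (Finset.mem_coe.1 hn)
      have h2 := hb _ hl
      simp only [addRightEmbedding_apply] at h1
      omega
    have hprod : P.real (t ∩ t') = P.real t * P.real t' := by
      have := measure_inter_of_disjoint_coordinates ρ hdisj
        (measurableSet_iSup_of_dependsOn I t hdep)
        (measurableSet_iSup_of_dependsOn _ t' hdep')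
      simp only [Measure.real, hPdef, this, ENNReal.toReal_mul]
    have hpres : ∀ s : Set (ℤ → α), P (shiftBy c ⁻¹' s) = P s := fun s =>
      measure_preimage_shiftBy (measurePreserving_shiftBy_infinitePi ρ 1) c s
    have ht't : P.real t' = P.real t := by
      simp only [Measure.real, ht', hpres]
    have hsymm : P.real (symmDiff A t) ≤ ε := by
      rw [Measure.real]
      exact ENNReal.toReal_le_of_le_ofReal hε.le htε.le
    have hsymm' : P.real (symmDiff A t') ≤ ε := by
      have : symmDiff A t' = shiftBy c ⁻¹' symmDiff A t := by
        rw [Set.preimage_symmDiff, hiter]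
      rw [Measure.real, this, hpres]
      exact hsymm
    have hA_inter : |P.real A - P.real (t ∩ t')| ≤ 2 * ε := by
      refine (abs_measureReal_sub_le_symmDiff P _ _).trans ?_
      have hsub : symmDiff A (t ∩ t') ⊆ symmDiff A t ∪ symmDiff A t' := by
        intro x
        simp only [Set.mem_symmDiff, Set.mem_inter_iff, Set.mem_union]
        tauto
      exact (measureReal_mono hsub).trans ((measureReal_union_le _ _).trans (by linarith))
    have hA_t : |P.real A - P.real t| ≤ ε := (abs_measureReal_sub_le_symmDiff P _ _).trans hsymm
    rw [hprod, ht't] at hA_inter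
    have h1 : P.real A ≤ 1 := measureReal_le_one
    have h2 : P.real t ≤ 1 := measureReal_le_one
    have h3 : 0 ≤ P.real A := measureReal_nonneg
    have h4 : 0 ≤ P.real t := measureReal_nonneg
    have h5 : |P.real t * P.real t - P.real A * P.real A| ≤ 2 * ε := by
      have : P.real t * P.real t - P.real A * P.real A =
          (P.real A - P.real t) * (-(P.real A + P.real t)) := by ring
      rw [this, abs_mul, abs_neg, abs_of_nonneg (add_nonneg h3 h4), mul_comm]
      exact mul_le_mul (by linarith) hA_t (abs_nonneg _) (by norm_num)
    calc |P.real A - P.real A * P.real A|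
        ≤ |P.real A - P.real t * P.real t| + |P.real t * P.real t - P.real A * P.real A| :=
          abs_sub_le _ _ _
      _ ≤ 4 * ε := by linarith
  have hzero : P.real A - P.real A * P.real A = 0 := by
    rw [← abs_eq_zero]
    refine le_antisymm (le_of_forall_pos_le_add fun ε hε => ?_) (abs_nonneg _)
    have := hreal (ε / 4) (by linarith)
    linarith
  have h01 : P.real A = 0 ∨ P.real A = 1 := by
    have : P.real A * (1 - P.real A) = 0 := by linarith
    rcases mul_eq_zero.1 this with h | h
    · exact Or.inl h
    · exact Or.inr (by linarith)
  rw [Filter.eventuallyConst_set]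
  rcases h01 with h | h
  · right
    have : P A = 0 := (measureReal_eq_zero_iff).1 h
    exact measure_eq_zero_iff_ae_notMem.1 this
  · left
    rw [measureReal_def] at h
    have : P A = 1 := by
      rw [← ENNReal.toReal_eq_one_iff]; exact h
    exact (mem_ae_iff_prob_eq_one hA).2 this

end IID

end GeneralMatching

namespace GeneralMatching

/-! ### Tightness and recurrence from an integrable return time -/

section Recurrence

variable {V : Type*} {G : SimpleGraph V} (φ : MatchingPolicy G)

/-- The system started empty at time `0` is not empty after `1, …, j` pairs of arrivals. -/
def NotEmptyUntil (j : ℕ) (x : ℤ → Arrival G) : Prop :=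
  ∀ i : ℕ, 0 < i → i ≤ j → wordRun φ x 0 (2 * i) [] ≠ []

variable {φ} [Finite V] [MeasurableSpace V] [DiscreteMeasurableSpace V]

theorem measurableSet_notEmptyUntil (j : ℕ) :
    MeasurableSet {x : ℤ → Arrival G | NotEmptyUntil φ j x} := by
  have : {x : ℤ → Arrival G | NotEmptyUntil φ j x} =
      ⋂ (i : ℕ) (_ : 0 < i) (_ : i ≤ j), {x | wordRun φ x 0 (2 * i) [] ≠ []} := by
    ext x; simp [NotEmptyUntil]
  rw [this]
  exact MeasurableSet.iInter fun i => MeasurableSet.iInter fun _ => MeasurableSet.iInter fun _ =>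
    measurableSet_wordRun φ _ _ fun f => f [] ≠ []

variable {P : Measure (ℤ → Arrival G)}

/-- The number of `j` with no return during the first `j` pairs is at most the return time, so the
series is bounded by its mean. -/
theorem tsum_measure_notEmptyUntil_ne_top
    (h : φ.IntegrableFirstEmptyTime (P.map evenPairs) (fun _ => [])) :
    ∑' j, P {x | NotEmptyUntil φ j x} ≠ ∞ := by
  have h' : ∫⁻ x, φ.firstEmptyTime (fun _ => []) (evenPairs x) ∂P ≠ ∞ := by
    have := lintegral_map_equiv (μ := P)
      (fun ω => φ.firstEmptyTime (fun _ => []) ω) (pairEquiv (α := Arrival G))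
    rw [MatchingPolicy.IntegrableFirstEmptyTime] at h
    exact fun hcon => h (this.trans hcon)
  refine ne_top_of_le_ne_top h' ?_
  have hind : ∀ j, P {x | NotEmptyUntil φ j x} =
      ∫⁻ x, {x | NotEmptyUntil φ j x}.indicator 1 x ∂P := fun j =>
    (lintegral_indicator_one (measurableSet_notEmptyUntil j)).symm
  simp only [hind]
  rw [← lintegral_tsum fun j =>
    (measurable_one.indicator (measurableSet_notEmptyUntil j)).aemeasurable]
  refine lintegral_mono fun x => ?_
  refine le_iInf fun n => le_iInf fun hn => ?_
  have hzero : ∀ j ∉ Finset.range n,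
      ({x | NotEmptyUntil φ j x}.indicator 1 x : ℝ≥0∞) = 0 := by
    intro j hj
    rw [Finset.mem_range, not_lt] at hj
    have h0 := hn.2
    rw [MatchingPolicy.emptyEvent, Set.mem_ofPred_eq, evenBuffer_evenPairs] at h0
    exact Set.indicator_of_notMem (fun hcon : NotEmptyUntil φ j x => hcon n hn.1 hj h0) _
  rw [tsum_eq_sum hzero]
  calc ∑ j ∈ Finset.range n, ({x | NotEmptyUntil φ j x}.indicator 1 x : ℝ≥0∞)
      ≤ ∑ _j ∈ Finset.range n, 1 :=
        Finset.sum_le_sum fun j _ => Set.indicator_le_self' (fun _ _ => zero_le) x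
    _ = n := by simp

omit [Finite V] [DiscreteMeasurableSpace V] in
-- More than `2 * r` letters need more than `r` pairs since the last empty time, hence an excursion
-- of that length. Summing over its starting point gives, by stationarity, a tail of the convergent
-- series, whatever `k` is.
theorem tightLengths_of_integrable (hP : MeasurePreserving (shiftBy 1) P P)
    (h : ∑' j, P {x | NotEmptyUntil φ j x} ≠ ∞) : TightLengths φ P := by
  intro ε hε
  obtain ⟨r, hr⟩ := ((ENNReal.tendsto_sum_nat_add _ h).eventually_le_const hε).exists
  refine ⟨2 * r, fun k => ?_⟩
  have hsub : {x : ℤ → Arrival G | 2 * r < (wordRun φ x 0 (2 * k) []).length} ⊆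
      ⋃ j : ℕ, shiftBy (2 * ((k : ℤ) - (j + r : ℕ))) ⁻¹' {x | NotEmptyUntil φ (j + r) x} := by
    classical
    intro x hx
    simp only [Set.mem_ofPred_eq] at hx
    obtain ⟨l, hlk, hl0, hmax⟩ : ∃ l ≤ k, wordRun φ x 0 (2 * l) [] = [] ∧
        ∀ i, l < i → i ≤ k → wordRun φ x 0 (2 * i) [] ≠ [] :=
      ⟨Nat.findGreatest (fun l => wordRun φ x 0 (2 * l) [] = []) k, Nat.findGreatest_le k,
        Nat.findGreatest_spec (P := fun l => wordRun φ x 0 (2 * l) [] = []) (Nat.zero_le k) rfl,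
        fun _ => Nat.findGreatest_is_greatest⟩
    obtain ⟨d, rfl⟩ : ∃ d, k = l + d := ⟨k - l, by omega⟩
    have hlen := length_foldl_next_le φ (arrivals x (0 + (2 * l : ℕ)) (2 * d))
      nil_mem_admissibleWords
    rw [mul_add, wordRun_add, hl0, wordRun] at hx
    rw [length_arrivals, List.length_nil] at hlen
    obtain ⟨j, rfl⟩ : ∃ j, d = j + r := ⟨d - r, by omega⟩
    refine Set.mem_iUnion.2 ⟨j, ?_⟩
    intro i hi hij hcon
    refine hmax (l + i) (by omega) (by omega) ?_
    rw [mul_add, wordRun_add, hl0]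
    rw [wordRun_shiftBy] at hcon
    rw [← hcon]
    congr 1
    push_cast; ring
  calc _ ≤ _ := measure_mono hsub
    _ ≤ _ := measure_iUnion_le _
    _ = ∑' j, P {x | NotEmptyUntil φ (j + r) x} := by
      simp only [measure_preimage_shiftBy hP]
    _ ≤ ε := hr

omit [Finite V] [DiscreteMeasurableSpace V] in
-- Borel–Cantelli gives one return; by stationarity it holds from all even times at once, so returns
-- can be iterated.
theorem ae_exists_empty_ge (hP : MeasurePreserving (shiftBy 1) P P)
    (h : ∑' j, P {x | NotEmptyUntil φ j x} ≠ ∞) :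
    ∀ᵐ x ∂P, ∀ n : ℕ, ∃ l ≥ n, wordRun φ x 0 (2 * l) [] = [] := by
  have h1 : ∀ᵐ x ∂P, ∃ i : ℕ, 0 < i ∧ wordRun φ x 0 (2 * i) [] = [] := by
    filter_upwards [ae_eventually_notMem h] with x hx
    obtain ⟨j, hj⟩ := hx.exists
    simp only [NotEmptyUntil, not_forall, not_not] at hj
    obtain ⟨i, hi, -, h0⟩ := hj
    exact ⟨i, hi, h0⟩
  have h2 : ∀ᵐ x ∂P, ∀ t : ℕ, ∃ i : ℕ, 0 < i ∧ wordRun φ (shiftBy (2 * t : ℤ) x) 0 (2 * i) [] = [] := by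
    rw [ae_all_iff]
    exact fun t => ae_shiftBy hP _ h1
  filter_upwards [h2] with x hx n
  induction n with
  | zero => exact ⟨0, le_rfl, rfl⟩
  | succ n ih =>
    obtain ⟨l, hl, h0⟩ := ih
    obtain ⟨i, hi, h3⟩ := hx l
    refine ⟨l + i, by omega, ?_⟩
    rw [mul_add, wordRun_add, h0]
    rw [wordRun_shiftBy] at h3
    exact_mod_cast h3

end Recurrence

/-! ### Renewal: a given finite word arrives at an empty time -/

section Renewal

variable {V : Type*} {G : SimpleGraph V} {φ : MatchingPolicy G}

/-- The system started empty at time `0` is never empty just before arrivals that spell `L`. -/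
def NeverRenewed (φ : MatchingPolicy G) (L : List (Arrival G)) (x : ℤ → Arrival G) : Prop :=
  ∀ l : ℕ, wordRun φ x 0 (2 * l) [] = [] → arrivals x (2 * (l : ℤ)) L.length ≠ L

theorem arrivals_congr {x y : ℤ → Arrival G} {s : ℤ} {j : ℕ}
    (h : ∀ n, s ≤ n → n < s + j → x n = y n) : arrivals x s j = arrivals y s j := by
  refine List.map_congr_left fun i hi => ?_
  rw [List.mem_range] at hi
  exact h _ (by omega) (by omega)

theorem arrivals_eq_iff (L : List (Arrival G)) (x : ℤ → Arrival G) :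
    arrivals x 0 L.length = L ↔
      x ∈ Set.pi (Finset.Ico (0 : ℤ) L.length : Set ℤ) fun n => {y | L[n.toNat]? = some y} := by
  constructor
  · intro h n hn
    rw [Finset.mem_coe, Finset.mem_Ico] at hn
    change L[n.toNat]? = some (x n)
    have h2 : (arrivals x 0 L.length)[n.toNat]? = some (x n) := by
      simp only [arrivals, List.getElem?_map]
      rw [List.getElem?_range (by omega)]
      simp [hn.1]
    rwa [h] at h2
  · intro h
    refine List.ext_getElem? fun i => ?_
    by_cases hi : i < L.length
    · have h2 : L[((i : ℤ)).toNat]? = some (x i) :=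
        h (i : ℤ) (by rw [Finset.mem_coe, Finset.mem_Ico]; omega)
      rw [Int.toNat_natCast] at h2
      simp only [arrivals, List.getElem?_map]
      rw [List.getElem?_range hi, h2]
      simp
    · rw [List.getElem?_eq_none (by rw [length_arrivals]; omega),
        List.getElem?_eq_none (by omega)]

variable [Finite V] [MeasurableSpace V] [DiscreteMeasurableSpace V]
  (ρ : Measure (Arrival G)) [IsProbabilityMeasure ρ]

theorem measure_arrivals_eq_pos {L : List (Arrival G)} (hL : ∀ y ∈ L, ρ {y} ≠ 0) :
    (Measure.infinitePi fun _ : ℤ => ρ) {x | arrivals x 0 L.length = L} ≠ 0 := by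
  have : {x : ℤ → Arrival G | arrivals x 0 L.length = L} =
      Set.pi (Finset.Ico (0 : ℤ) L.length : Set ℤ) fun n => {y | L[n.toNat]? = some y} :=
    Set.ext fun x => arrivals_eq_iff L x
  rw [this, Measure.infinitePi_pi _ fun _ _ => MeasurableSet.of_discrete, Finset.prod_ne_zero_iff]
  intro n hn
  rw [Finset.mem_Ico] at hn
  have hlt : n.toNat < L.length := by omega
  have h2 : {y | L[n.toNat]? = some y} = {L[n.toNat]} := by
    ext y
    simp only [Set.mem_ofPred_eq, Set.mem_singleton_iff, List.getElem?_eq_getElem hlt,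
      Option.some_inj]
    exact eq_comm
  rw [h2]
  exact hL _ (List.getElem_mem hlt)

theorem measurableSet_preimage_neverRenewed (L : List (Arrival G)) (t : ℕ) :
    MeasurableSet[⨆ n ∈ Set.Ici (2 * (t : ℤ)),
      MeasurableSpace.comap (fun x : ℤ → Arrival G => x n) inferInstance]
      (shiftBy (2 * (t : ℤ)) ⁻¹' {x | NeverRenewed φ L x}) := by
  have : (shiftBy (2 * (t : ℤ)) ⁻¹' {x | NeverRenewed φ L x}) =
      ⋂ l : ℕ, {x | wordRun φ x (2 * (t : ℤ)) (2 * l) [] = [] →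
        arrivals x (2 * (l : ℤ) + 2 * t) L.length ≠ L} := by
    ext x
    simp only [Set.mem_preimage, Set.mem_ofPred_eq, NeverRenewed, wordRun_shiftBy, arrivals_shiftBy,
      zero_add, Set.mem_iInter]
  rw [this]
  refine MeasurableSet.iInter fun l => ?_
  have hle : (⨆ n ∈ ((Finset.Ico (2 * (t : ℤ)) (2 * t + 2 * l + L.length) : Finset ℤ) : Set ℤ),
      MeasurableSpace.comap (fun x : ℤ → Arrival G => x n) inferInstance) ≤
      ⨆ n ∈ Set.Ici (2 * (t : ℤ)),
        MeasurableSpace.comap (fun x : ℤ → Arrival G => x n) inferInstance :=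
    biSup_mono fun n hn => (Finset.mem_Ico.1 (Finset.mem_coe.1 hn)).1
  refine hle _ (measurableSet_iSup_of_dependsOn _ _ fun x y h => ?_)
  have hw : wordRun φ x (2 * (t : ℤ)) (2 * l) [] = wordRun φ y (2 * (t : ℤ)) (2 * l) [] :=
    wordRun_congr φ (fun n h1 h2 => h n (Finset.mem_Ico.2 ⟨h1, by push_cast at h2; omega⟩)) []
  have ha : arrivals x (2 * (l : ℤ) + 2 * t) L.length = arrivals y (2 * (l : ℤ) + 2 * t) L.length :=
    arrivals_congr fun n h1 h2 => h n (Finset.mem_Ico.2 ⟨by omega, by omega⟩)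
  change (_ = _ → _ ≠ _) ↔ (_ = _ → _ ≠ _)
  rw [hw, ha]

/-- The arrivals do not begin with `L`, and the first time after the first `m` pairs of arrivals at
which the system is empty is the time `t`. -/
def FirstEmptyAfter (φ : MatchingPolicy G) (L : List (Arrival G)) (m t : ℕ) (x : ℤ → Arrival G) :
    Prop :=
  arrivals x 0 L.length ≠ L ∧ m ≤ t ∧ wordRun φ x 0 (2 * t) [] = [] ∧
    ∀ l, m ≤ l → l < t → wordRun φ x 0 (2 * l) [] ≠ []

omit [Finite V] [MeasurableSpace V] [DiscreteMeasurableSpace V] in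
theorem firstEmptyAfter_congr {L : List (Arrival G)} {m : ℕ} (hm : L.length ≤ 2 * m) (t : ℕ)
    {x y : ℤ → Arrival G} (h : ∀ n ∈ Finset.Ico (0 : ℤ) (2 * t), x n = y n) :
    FirstEmptyAfter φ L m t x ↔ FirstEmptyAfter φ L m t y := by
  by_cases hmt : m ≤ t
  · have ha : arrivals x 0 L.length = arrivals y 0 L.length :=
      arrivals_congr fun n h1 h2 => h n (Finset.mem_Ico.2 ⟨h1, by omega⟩)
    have hw : ∀ l ≤ t, wordRun φ x 0 (2 * l) [] = wordRun φ y 0 (2 * l) [] := fun l hl =>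
      wordRun_congr φ (fun n h1 h2 => h n (Finset.mem_Ico.2 ⟨h1, by push_cast at h2; omega⟩)) []
    unfold FirstEmptyAfter
    rw [ha, hw t le_rfl]
    refine and_congr_right fun _ => and_congr_right fun _ => and_congr_right fun _ =>
      forall_congr' fun l => forall_congr' fun _ => forall_congr' fun hl => ?_
    rw [hw l hl.le]
  · exact ⟨fun h => absurd h.2.1 hmt, fun h => absurd h.2.1 hmt⟩

/-- If `L` fails to arrive at time `0`, the system starts afresh at its first empty time after
`L.length` pairs. That time and the failed trial depend on the past only, so the probability `p` of
never succeeding satisfies `p ≤ q * p`, with `q < 1` the probability that a trial fails; hence `p =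
0`. -/
theorem ae_not_neverRenewed {L : List (Arrival G)} (hL : ∀ y ∈ L, ρ {y} ≠ 0)
    (hrec : ∀ᵐ x ∂(Measure.infinitePi fun _ : ℤ => ρ),
      ∀ n : ℕ, ∃ l ≥ n, wordRun φ x 0 (2 * l) [] = []) :
    ∀ᵐ x ∂(Measure.infinitePi fun _ : ℤ => ρ), ¬ NeverRenewed φ L x := by
  classical
  set P := Measure.infinitePi fun _ : ℤ => ρ with hPdef
  set m := L.length with hm
  set N : Set (ℤ → Arrival G) := {x | NeverRenewed φ L x} with hN
  have hmeas : ∀ t, MeasurableSet {x | FirstEmptyAfter φ L m t x} := fun t =>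
    measurableSet_of_dependsOn _ _ fun x y h => firstEmptyAfter_congr (by omega) t h
  have hcover : (N : Set (ℤ → Arrival G)) ≤ᵐ[P]
      (⋃ t : ℕ, {x | FirstEmptyAfter φ L m t x} ∩ shiftBy (2 * (t : ℤ)) ⁻¹' N :
        Set (ℤ → Arrival G)) := by
    filter_upwards [hrec] with x hx hxN
    have hex : ∃ l, m ≤ l ∧ wordRun φ x 0 (2 * l) [] = [] := by
      obtain ⟨l, h1, h2⟩ := hx m
      exact ⟨l, h1, h2⟩
    obtain ⟨h1, h2⟩ := Nat.find_spec hex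
    refine Set.mem_iUnion.2 ⟨Nat.find hex, ⟨hxN 0 rfl, h1, h2, fun l hml hl h3 =>
      Nat.find_min hex hl ⟨hml, h3⟩⟩, ?_⟩
    intro l hl
    rw [arrivals_shiftBy]
    rw [wordRun_shiftBy, zero_add] at hl
    have := hxN (Nat.find hex + l) (by
      rw [mul_add, wordRun_add, h2]
      push_cast
      rw [zero_add]; exact hl)
    rw [add_comm]
    push_cast at this
    rwa [mul_add] at this
  have hindep : ∀ t : ℕ, P ({x | FirstEmptyAfter φ L m t x} ∩ shiftBy (2 * (t : ℤ)) ⁻¹' N) =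
      P {x | FirstEmptyAfter φ L m t x} * P N := by
    intro t
    have hdisj : Disjoint ((Finset.Ico (0 : ℤ) (2 * t) : Finset ℤ) : Set ℤ)
        (Set.Ici (2 * (t : ℤ))) := by
      rw [Set.disjoint_left]
      intro n h1 h2
      rw [Finset.mem_coe, Finset.mem_Ico] at h1
      exact absurd h2 (not_le.2 h1.2)
    have h1 := measurableSet_iSup_of_dependsOn (Finset.Ico (0 : ℤ) (2 * t))
      {x | FirstEmptyAfter φ L m t x} fun x y h => firstEmptyAfter_congr (by omega) t h
    rw [hPdef, measure_inter_of_disjoint_coordinates ρ hdisj h1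
      (measurableSet_preimage_neverRenewed L t),
      measure_preimage_shiftBy (measurePreserving_shiftBy_infinitePi ρ 1)]
  -- The first empty time takes one value only, so these events are disjoint, and all lie in the
  -- failure of the first trial.
  have hsum : ∑' t, P {x | FirstEmptyAfter φ L m t x} ≤ P {x | arrivals x 0 m = L}ᶜ := by
    rw [← measure_iUnion _ hmeas]
    · refine measure_mono (Set.iUnion_subset fun t x hx => hx.1)
    · intro t t' htt'
      refine Set.disjoint_left.2 fun x hx hx' => ?_
      rcases lt_or_gt_of_ne htt' with h | h
      · exact hx'.2.2.2 t hx.2.1 h hx.2.2.1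
      · exact hx.2.2.2 t' hx'.2.1 h hx'.2.2.1
  have hle : P N ≤ P {x | arrivals x 0 m = L}ᶜ * P N :=
    calc P N ≤ _ := measure_mono_ae hcover
      _ ≤ _ := measure_iUnion_le _
      _ = (∑' t, P {x | FirstEmptyAfter φ L m t x}) * P N := by
        simp only [hindep, ENNReal.tsum_mul_right]
      _ ≤ _ := by gcongr
  have hlt : P {x | arrivals x 0 m = L}ᶜ < 1 := by
    have hB : MeasurableSet {x : ℤ → Arrival G | arrivals x 0 m = L} :=
      measurableSet_of_dependsOn (Finset.Ico (0 : ℤ) m) _ fun x y h => by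
        have : arrivals x 0 m = arrivals y 0 m :=
          arrivals_congr fun n h1 h2 => h n (Finset.mem_Ico.2 ⟨h1, by omega⟩)
        change _ = _ ↔ _ = _
        rw [this]
    rw [prob_compl_eq_one_sub hB]
    exact ENNReal.sub_lt_self ENNReal.one_ne_top one_ne_zero (measure_arrivals_eq_pos ρ hL)
  have hzero : P N = 0 := by
    by_contra h0
    have := ENNReal.mul_lt_mul_left h0 (measure_ne_top P N) hlt
    rw [one_mul] at this
    exact absurd hle (not_le.2 this)
  exact measure_eq_zero_iff_ae_notMem.1 hzero

/-- One word erases all admissible words of even length at most `r`. When it arrives at an empty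
time of the system started empty, sub-additivity guarantees that the run from `w` is still among
them. -/
theorem almostSurelyCouples_of_recurrent (hconn : G.Connected) (hbip : ¬ G.IsBipartite)
    (hφ : φ.SubAdditive) {σ : Pref G} (hσ : σ ∈ φ.prefLaw.support) (hρ : ∀ v, ρ {(v, σ)} ≠ 0)
    (hsupp : ∀ᵐ x ∂(Measure.infinitePi fun _ : ℤ => ρ), ∀ n, (x n).2 ∈ φ.prefLaw.support)
    (hrec : ∀ᵐ x ∂(Measure.infinitePi fun _ : ℤ => ρ),
      ∀ n : ℕ, ∃ l ≥ n, wordRun φ x 0 (2 * l) [] = []) :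
    AlmostSurelyCouples φ (Measure.infinitePi fun _ : ℤ => ρ) := by
  have key : ∀ᵐ x ∂(Measure.infinitePi fun _ : ℤ => ρ), ∀ r : ℕ, ∀ w ∈ admissibleWords G,
      Even w.length → w.length ≤ r →
      ∃ l : ℕ, wordRun φ x 0 (2 * l) w = [] ∧ wordRun φ x 0 (2 * l) [] = [] := by
    rw [ae_all_iff]
    intro r
    have hfin : {w : List V | w ∈ admissibleWords G ∧ Even w.length ∧ w.length ≤ r}.Finite :=
      (List.finite_length_le V r).subset fun w hw => hw.2.2
    obtain ⟨z, hz, hz1, hz2⟩ := exists_erasing_word_of_list hconn hbip hφ hσ hfin.toFinset.toList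
      (fun w hw => by
        rw [Finset.mem_toList, Set.Finite.mem_toFinset] at hw
        exact ⟨hw.1, hw.2.1⟩)
    obtain ⟨p, hp⟩ := hz
    filter_upwards [hsupp, ae_not_neverRenewed ρ (φ := φ) (L := z.map fun v => (v, σ))
      (fun y hy => by
        obtain ⟨v, -, rfl⟩ := List.mem_map.1 hy
        exact hρ v) hrec] with x hx hx' w hw he hwr
    simp only [NeverRenewed, not_forall, not_not] at hx'
    obtain ⟨l, hl, ha⟩ := hx'
    rw [List.length_map] at ha
    have hle := length_wordRun_le hφ hx 0 (2 * l) hw hl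
    refine ⟨l + p, ?_, ?_⟩
    · rw [mul_add, wordRun_add, show 2 * p = z.length by omega]
      push_cast
      rw [zero_add, wordRun, ha]
      refine hz1 _ ?_
      rw [Finset.mem_toList, Set.Finite.mem_toFinset]
      exact ⟨wordRun_mem_admissibleWords φ _ _ _ hw, (even_length_wordRun φ _ _ _ hw).2 he,
        hle.trans hwr⟩
    · rw [mul_add, wordRun_add, hl, show 2 * p = z.length by omega]
      push_cast
      rw [zero_add, wordRun, ha]
      exact hz2
  filter_upwards [key] with x hx w hw he
  exact hx w.length w hw he le_rfl

end Renewal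

end GeneralMatching

namespace GeneralMatching

/-! ### Coupling and tightness for i.i.d. inputs -/

section IIDInput

variable {V : Type*} [Finite V] [MeasurableSpace V] [DiscreteMeasurableSpace V]
  {G : SimpleGraph V} {φ : MatchingPolicy G}
  {Ω : Type*} [MeasurableSpace Ω] {Pr : Measure Ω}
  {C : ℤ → Ω → V} {S : ℤ → Ω → Pref G} {μ : PMF V}

omit [Finite V] [DiscreteMeasurableSpace V] in
theorem IIDInput.inputLaw_eq {ν : PMF (Pref G)} (hC : ∀ n, Measurable (C n))
    (hS : ∀ n, Measurable (S n)) (h : IIDInput Pr C S μ ν) :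
    inputLaw Pr C S = Measure.infinitePi fun _ : ℤ => μ.toMeasure.prod ν.toMeasure := by
  have := h.indep.map_fun_eq_infinitePi_map fun n => (hC n).prodMk (hS n)
  simp only [h.law] at this
  exact this

omit [Finite V] [DiscreteMeasurableSpace V] in
theorem IIDInput.map_pref {ν : PMF (Pref G)} (hC : ∀ n, Measurable (C n))
    (hS : ∀ n, Measurable (S n)) (h : IIDInput Pr C S μ ν) (n : ℤ) :
    Pr.map (S n) = ν.toMeasure := by
  have h1 := congrArg (Measure.map Prod.snd) (h.law n)
  rw [Measure.map_map measurable_snd ((hC n).prodMk (hS n)), Measure.map_snd_prod,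
    measure_univ, one_smul] at h1
  exact h1

theorem IIDInput.couples_and_tight (hconn : G.Connected) (hbip : ¬ G.IsBipartite)
    (hφ : φ.SubAdditive) (hC : ∀ n, Measurable (C n)) (hS : ∀ n, Measurable (S n))
    (hμ : μ.support = Set.univ) (h : IIDInput Pr C S μ φ.prefLaw)
    (hτ : φ.IntegrableFirstEmptyTime (evenPairLaw Pr C S) (fun _ => [])) :
    AlmostSurelyCouples φ (inputLaw Pr C S) ∧ TightLengths φ (inputLaw Pr C S) := by
  have hsupp := ae_mem_support φ hC hS (h.map_pref hC hS)
  rw [evenPairLaw_eq_map hC hS] at hτ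
  have hsum := tsum_measure_notEmptyUntil_ne_top hτ
  rw [h.inputLaw_eq hC hS] at hsum hsupp ⊢
  have hP := measurePreserving_shiftBy_infinitePi (μ.toMeasure.prod φ.prefLaw.toMeasure) 1
  obtain ⟨σ, hσ⟩ := φ.prefLaw.support_nonempty
  refine ⟨almostSurelyCouples_of_recurrent _ hconn hbip hφ hσ (fun v => ?_) hsupp
    (ae_exists_empty_ge hP hsum), tightLengths_of_integrable hP hsum⟩
  -- Every class has positive mass and `σ` can be drawn, so each letter of an erasing word has
  -- positive probability.
  rw [← Set.singleton_prod_singleton, Measure.prod_prod,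
    PMF.toMeasure_apply_singleton _ _ MeasurableSet.of_discrete,
    PMF.toMeasure_apply_singleton _ _ MeasurableSet.of_discrete]
  refine mul_ne_zero ?_ ((PMF.mem_support_iff _ _).1 hσ)
  exact (PMF.mem_support_iff _ _).1 (hμ ▸ Set.mem_univ v)

end IIDInput

end GeneralMatching

/-! ### Conclusion under either set of conditions -/

theorem mainTheorem6 {V : Type*} [Finite V] [MeasurableSpace V] [DiscreteMeasurableSpace V]
    (G : SimpleGraph V) (hconn : G.Connected) (hbip : ¬ G.IsBipartite)
    (φ : MatchingPolicy G) (hφ : φ.SubAdditive)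
    {Ω : Type*} [MeasurableSpace Ω] (Pr : MeasureTheory.Measure Ω)
    [MeasureTheory.IsProbabilityMeasure Pr]
    (C : ℤ → Ω → V) (S : ℤ → Ω → Pref G)
    (hC : ∀ n, Measurable (C n)) (hS : ∀ n, Measurable (S n))
    (μ : PMF V) (hμ : μ.support = Set.univ)
    (h : (StationaryErgodicInput Pr C S μ φ.prefLaw ∧
          (∃ μ₀ μ₁ : PMF V, StationaryErgodicEvenPairs Pr C S μ₀ μ₁ φ.prefLaw) ∧
          (∃ μ₀ μ₁ : PMF V, StationaryErgodicOddPairs Pr C S μ₀ μ₁ φ.prefLaw) ∧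
          (∃ z : List V, φ.IsStrongErasing z) ∧
          (∀ r : ℕ, 1 ≤ r → φ.Renovation (evenPairLaw Pr C S) r)) ∨
        (IIDInput Pr C S μ φ.prefLaw ∧
          φ.IntegrableFirstEmptyTime (evenPairLaw Pr C S) (fun _ => []))) :
    ∃ M₀ M₁ : (ℤ → Arrival G) → ℤ → ℤ,
      IsStationaryPerfectMatching φ (inputLaw Pr C S) M₀ ∧
      IsStationaryPerfectMatching φ (inputLaw Pr C S) M₁ ∧
      (∀ᵐ x ∂(inputLaw Pr C S), EmptiesAt Even (M₀ x)) ∧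
      (∀ᵐ x ∂(inputLaw Pr C S), EmptiesAt Odd (M₁ x)) ∧
      ¬ (M₀ =ᵐ[inputLaw Pr C S] M₁) ∧
      ∀ M : (ℤ → Arrival G) → ℤ → ℤ,
        IsStationaryPerfectMatching φ (inputLaw Pr C S) M →
        M =ᵐ[inputLaw Pr C S] M₀ ∨ M =ᵐ[inputLaw Pr C S] M₁ := by
  have : IsProbabilityMeasure (inputLaw Pr C S) :=
    Measure.isProbabilityMeasure_map (measurable_inputPath hC hS).aemeasurable
  rcases h with ⟨hin, ⟨μ₀, μ₁, heven⟩, -, -, hren⟩ | ⟨hiid, hτ⟩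
  · have hP := hin.ergodic.toMeasurePreserving
    have hpair := heven.ergodic
    rw [evenPairLaw_eq_map hC hS] at hpair hren
    exact exists_two_isStationaryPerfectMatching hP (ergodic_shiftBy_two_of_pairs hpair)
      (almostSurelyCouples_of_renovation hφ (ae_mem_support φ hC hS hin.pref_law) hren)
      (tightLengths_of_renovation hP (hren 1 le_rfl))
  · obtain ⟨h1, h2⟩ := hiid.couples_and_tight hconn hbip hφ hC hS hμ hτ
    have hlaw := hiid.inputLaw_eq hC hS
    refine exists_two_isStationaryPerfectMatching ?_ ?_ h1 h2
    · rw [hlaw]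
      exact measurePreserving_shiftBy_infinitePi _ 1
    · rw [hlaw]
      exact ergodic_shiftBy_infinitePi _ two_pos
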